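/- Setting. Let $M$ be a connected, paracompact Hausdorff smooth manifold of dimension $n=2k\ge 4$, let $p+q=n$, and fix unitary matrices $\gamma^a\in M_{2^k}(\mathbb C)$ with $\gamma^a\gamma^b+\gamma^b\gamma^a=2\varepsilon\eta^{ab}$, where $\varepsilon\in\{1,-1\}$ and $\eta=\mathrm{diag}(1^p,(-1)^q)$; put $\gamma_M=i^{k+q}\gamma^1\cdots\gamma^n$, so that $\gamma_M^2=1$. Let $G$ be a compact Lie group, $\rho_F:G\to SU(N_F)$, $N_F\ge1$, a smooth faithful representation, and $\chi$ an involution of $\mathbb C^{N_F}$ that commutes with $\rho_F(G)$. A chiral fermion bundle $\xi_F$ is a complex vector bundle over $M$ with fibre $\mathbb C^{2^k}\otimes\mathbb C^{N_F}$ and transition functions $S_{ij}\otimes\rho_F(g_{ij})$ given by a smooth cocycle $(S_{ij},g_{ij})$ with values in $\mathrm{Spin}(p,q)\times G$. A Dirac type operator on $\xi_F$ is a first order operator $D$, odd with respect to $\gamma_M\otimes\chi$, that in each of these trivializations has the form $D=e^\mu_a(\gamma^a\otimes1)\partial_\mu+b$ with $(e^\mu_a)$ smooth and invertible. It defines the semi-Riemannian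 metric $g_M$ with $g^{\mu\nu}=e^\mu_ae^\nu_b\eta^{ab}$ and the Clifford action $\gamma(dx^\mu)=e^\mu_a\gamma^a\otimes1$. There is a unique connection $\hat\nabla$ on $\xi_F$ for which $D^2-\triangle_D$, with $\triangle_D=\varepsilon\,\mathrm{tr}_{g_M}(\hat\nabla\hat\nabla)$ the Bochner-Laplacian, is of order zero; the Dirac-Lagrangian is $\mathcal L_D(D)=\mathrm{tr}(D^2-\triangle_D)\,\mu_M$, with $\mu_M$ the volume form of $g_M$. The operator $D$ is of simple type if $\hat\nabla$ is a Clifford connection $\partial_A$, that is, $[\partial_A,\gamma(\alpha)]=\gamma(\nabla\alpha)$ for all one-forms $\alpha$, with $\nabla$ the Levi-Civita connection of $g_M$; put ${\partial\!\!\!/}_A=\gamma\circ\partial_A$. Denote by $\mathrm{End}^-_{Cl}(\xi_F)$ the bundle of endomorphisms that are locally of the form $1\otimes\phi$ with $\phi\chi=-\chi\phi$. Statement. Let $D$ be of simple type with Clifford connection $A$, and suppose that the zero order operator $\Phi=D-{\partial\!\!\!/}_A$ satisfies $\Phi^\dagger=\sigma\Phi$ with $\sigma\in\{1,-1\}$.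 Assume: (a) $D$ solves the Euler-Lagrange equations of the Dirac-Lagrangian with $\Phi$ as a background field: in each trivialization over a coordinate domain $U$ and for each compact $K\subset U$, the action $\int_K\mathcal L_D$ is stationary at $D$ under all smooth variations, supported in $K$, of the frame $(e^\mu_a)$ (that is, of the Clifford action and the metric) and of the Clifford connection, with $\Phi$ kept fixed. (b) The Yang-Mills gauge group acts transitively on the image of $\Phi$: the values of $\Phi/\|\Phi\|$ (at the points where $\Phi\ne0$, where $\|\Phi\|^2=\mathrm{tr}(\Phi^\dagger\Phi)$) in all frames of the principal $G$-bundle of $\xi_F$ lie in a single orbit of $G$, which acts through conjugation by $1\otimes\rho_F(g)$. Then there is a smooth section $\mathcal D$ of $\mathrm{End}^-_{Cl}(\xi_F)$ with $\mathcal D^\dagger=\sigma\mathcal D$ and $D={\partial\!\!\!/}_A+\gamma_M\otimes\mathcal D$ that is constant in the following sense: there are a matrix $\mathfrak z_0\in M_{N_F}(\mathbb C)$, $\mathfrak z_0^\dagger=\sigma\mathfrak z_0$, and a smooth reduction of the structure group $G$ to the isotropy subgroup $H=\{g\in G:\rho_F(g)\mathfrak z_0\rho_F(g)^{-1}=\mathfrak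 z_0\}$ such that $\mathcal D$ is represented by the constant $\mathfrak z_0$ in all frames of the reduced bundle. Moreover, $(M,g_M)$ is an Einstein manifold, $\mathrm{Ric}=c\,g_M$ with $c\in\mathbb R$ constant, and its scalar curvature is $$r_M=\lambda\,\|M_F\|^2,\qquad \|M_F\|^2=\mathrm{tr}(M_F^\dagger M_F),\qquad iM_F=\gamma_M\otimes\mathcal D,$$ with the non-zero constant $\lambda=\dfrac{4n\,\varepsilon\,\sigma}{(n-2)\,2^kN_F}$. -/

import Mathlib

open scoped Manifold ContDiff Kronecker Matrix Topology

noncomputable section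

namespace DiracGauge

/-! ### Local model: coordinates, index types, fibres -/

/-- The coordinate space of dimension `n = 2k`. -/
abbrev Coord (k : ℕ) := EuclideanSpace ℝ (Fin (2 * k))

/-- Index type of the typical fibre `ℂ^(2^k) ⊗ ℂ^N`. -/
abbrev FibIdx (k N : ℕ) := Fin (2 ^ k) × Fin N

/-- The typical fibre `ℂ^(2^k) ⊗ ℂ^N` of the fermion bundle. -/
abbrev Fib (k N : ℕ) := FibIdx k N → ℂ

/-- Endomorphisms of the typical fibre. -/
abbrev EndFib (k N : ℕ) := Matrix (FibIdx k N) (FibIdx k N) ℂ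

/-- Partial derivative in the coordinate direction `μ`. -/
def pderiv {k : ℕ} {V : Type*} [NormedAddCommGroup V] [NormedSpace ℝ V]
    (f : Coord k → V) (μ : Fin (2 * k)) (x : Coord k) : V :=
  fderiv ℝ f x (EuclideanSpace.single μ 1)

/-- Entrywise partial derivative of a matrix-valued function. -/
def matDeriv {k : ℕ} {m l : Type*} (f : Coord k → Matrix m l ℂ) (μ : Fin (2 * k))
    (x : Coord k) : Matrix m l ℂ :=
  Matrix.of fun s t => pderiv (fun y => f y s t) μ x

/-- Entrywise smoothness of a matrix-valued function on a set. -/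
def SmoothMatOn {X R m l : Type*} [NormedAddCommGroup X] [NormedSpace ℝ X]
    [NormedAddCommGroup R] [NormedSpace ℝ R] (f : X → Matrix m l R) (U : Set X) : Prop :=
  ∀ s t, ContDiffOn ℝ ∞ (fun y => f y s t) U

/-- `‖Z‖² = tr(Z† Z)`. -/
def normSq {m : Type*} [Fintype m] (Z : Matrix m m ℂ) : ℝ := (Zᴴ * Z).trace.re

/-- `Z / ‖Z‖`. -/
def normalized {m : Type*} [Fintype m] (Z : Matrix m m ℂ) : Matrix m m ℂ :=
  (((Real.sqrt (normSq Z))⁻¹ : ℝ) : ℂ) • Z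

/-! ### Semi-Riemannian geometry in a chart -/

/-- Christoffel symbols `Γ^l_{μν}` of the metric `g = (g_{μν})`. -/
def christoffel {k : ℕ} (g : Coord k → Matrix (Fin (2 * k)) (Fin (2 * k)) ℝ)
    (l μ ν : Fin (2 * k)) (x : Coord k) : ℝ :=
  (1 / 2) * ∑ r, (g x)⁻¹ l r *
    (pderiv (fun y => g y r ν) μ x + pderiv (fun y => g y r μ) ν x
      - pderiv (fun y => g y μ ν) r x)

/-- Curvature `R^r_{sμν}`, i.e. `R(∂_μ, ∂_ν) ∂_s = R^r_{sμν} ∂_r`. -/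
def riemann {k : ℕ} (g : Coord k → Matrix (Fin (2 * k)) (Fin (2 * k)) ℝ)
    (r s μ ν : Fin (2 * k)) (x : Coord k) : ℝ :=
  pderiv (christoffel g r ν s) μ x - pderiv (christoffel g r μ s) ν x
    + ∑ l, (christoffel g r μ l x * christoffel g l ν s x
      - christoffel g r ν l x * christoffel g l μ s x)

/-- Ricci tensor `R_{sν} = R^r_{srν}`. -/
def ricci {k : ℕ} (g : Coord k → Matrix (Fin (2 * k)) (Fin (2 * k)) ℝ)
    (x : Coord k) : Matrix (Fin (2 * k)) (Fin (2 * k)) ℝ :=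
  Matrix.of fun s ν => ∑ r, riemann g r s r ν x

/-- Scalar curvature `g^{sν} R_{sν}`. -/
def scalarCurvature {k : ℕ} (g : Coord k → Matrix (Fin (2 * k)) (Fin (2 * k)) ℝ)
    (x : Coord k) : ℝ :=
  ∑ s, ∑ ν, (g x)⁻¹ s ν * ricci g x s ν

/-- The standard quadratic form of `ℝ^{p,q}`, `p + q = 2k`: `p` plus signs first. -/
def eta (k p : ℕ) (a : Fin (2 * k)) : ℝ := if (a : ℕ) < p then 1 else -1

/-- The metric `(g_{μν})` for which the frame `e_a = e^μ_a ∂_μ` is orthonormal of type `(p,q)`;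
its inverse is `g^{μν} = e^μ_a e^ν_b η^{ab}`. -/
def metricOf {k : ℕ} (p : ℕ) (e : Coord k → Matrix (Fin (2 * k)) (Fin (2 * k)) ℝ)
    (x : Coord k) : Matrix (Fin (2 * k)) (Fin (2 * k)) ℝ :=
  (e x * Matrix.diagonal (eta k p) * (e x)ᵀ)⁻¹

/-! ### Clifford data -/

/-- Unitary `γ`-matrices on `ℂ^(2^k)` for `ℝ^{p,q}`, `p + q = 2k`, with either sign convention
`γ^a γ^b + γ^b γ^a = ± 2 η^{ab}`. -/
structure GammaMatrices (k p : ℕ) where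
  sgn : ℝ
  sgn_eq : sgn = 1 ∨ sgn = -1
  gam : Fin (2 * k) → Matrix (Fin (2 ^ k)) (Fin (2 ^ k)) ℂ
  clifford : ∀ a b, gam a * gam b + gam b * gam a =
    if a = b then ((2 * sgn * eta k p a : ℝ) : ℂ) • 1 else 0
  unitary : ∀ a, (gam a)ᴴ * gam a = 1

namespace GammaMatrices

variable {k p : ℕ} (γ : GammaMatrices k p)

/-- Clifford multiplication by a vector of `ℝ^{p,q}`. -/
def slash (v : Fin (2 * k) → ℝ) : Matrix (Fin (2 ^ k)) (Fin (2 ^ k)) ℂ :=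
  ∑ a, ((v a : ℝ) : ℂ) • γ.gam a

/-- The group `Spin(p,q)`, as a group of matrices on `ℂ^(2^k)`: it is generated by the products
of two vectors of square `± 1`. -/
def spin : Subgroup (Matrix (Fin (2 ^ k)) (Fin (2 ^ k)) ℂ)ˣ :=
  Subgroup.closure {u | ∃ v w : Fin (2 * k) → ℝ,
    |∑ a, eta k p a * v a ^ 2| = 1 ∧ |∑ a, eta k p a * w a ^ 2| = 1 ∧
    (u : Matrix (Fin (2 ^ k)) (Fin (2 ^ k)) ℂ) = γ.slash v * γ.slash w}

/-- The grading involution `γ_M`: the Clifford action of the volume form, multiplied by the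
phase `i^(k+q)`, `q = 2k - p`, that makes its square equal to `1`. -/
def gammaM : Matrix (Fin (2 ^ k)) (Fin (2 ^ k)) ℂ :=
  (Complex.I ^ (k + (2 * k - p))) • (List.ofFn γ.gam).prod

/-- Clifford action `γ(dx^μ) = e^μ_a γ^a ⊗ 1` defined by the frame `e`. -/
def symbol (N : ℕ) (e : Coord k → Matrix (Fin (2 * k)) (Fin (2 * k)) ℝ) (μ : Fin (2 * k))
    (x : Coord k) : EndFib k N :=
  γ.slash (fun a => e x μ a) ⊗ₖ (1 : Matrix (Fin N) (Fin N) ℂ)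

/-! ### Local first order operators and connections -/

/-- The local operator `D ψ = γ(dx^μ) ∂_μ ψ + b ψ`. -/
def localOp {N : ℕ} (e : Coord k → Matrix (Fin (2 * k)) (Fin (2 * k)) ℝ)
    (b : Coord k → EndFib k N) (ψ : Coord k → Fib k N) (x : Coord k) : Fib k N :=
  (∑ μ, γ.symbol N e μ x *ᵥ pderiv ψ μ x) + b x *ᵥ ψ x

/-- The zero order part `γ(dx^μ) B_μ` of `γ ∘ (d + B)`. -/
def slashConn {N : ℕ} (e : Coord k → Matrix (Fin (2 * k)) (Fin (2 * k)) ℝ)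
    (B : Coord k → Fin (2 * k) → EndFib k N) (x : Coord k) : EndFib k N :=
  ∑ μ, γ.symbol N e μ x * B x μ

end GammaMatrices

/-- The covariant derivative `∇_μ ψ = ∂_μ ψ + B_μ ψ`. -/
def covDeriv {k N : ℕ} (B : Coord k → Fin (2 * k) → EndFib k N)
    (ψ : Coord k → Fib k N) (μ : Fin (2 * k)) (x : Coord k) : Fib k N :=
  pderiv ψ μ x + B x μ *ᵥ ψ x

namespace GammaMatrices

variable {k p : ℕ} (γ : GammaMatrices k p)

/-- The Bochner-Laplacian `± tr(∇^{T*M ⊗ E} ∘ ∇^E)` of the connection `d + B`, where `±` is the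
sign in the Clifford relation. -/
def bochnerLaplacian {N : ℕ} (e : Coord k → Matrix (Fin (2 * k)) (Fin (2 * k)) ℝ)
    (B : Coord k → Fin (2 * k) → EndFib k N) (ψ : Coord k → Fib k N) (x : Coord k) : Fib k N :=
  γ.sgn • ∑ μ, ∑ ν, (metricOf p e x)⁻¹ μ ν •
    (covDeriv B (covDeriv B ψ ν) μ x
      - ∑ l, christoffel (metricOf p e) l μ ν x • covDeriv B ψ l x)

/-- `D² = Δ_B + Q` on `U` with `Q` of order zero, for `D = γ(dx^μ) ∂_μ + b`. -/
def IsLichnerowicz {N : ℕ} (U : Set (Coord k))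
    (e : Coord k → Matrix (Fin (2 * k)) (Fin (2 * k)) ℝ) (b : Coord k → EndFib k N)
    (B : Coord k → Fin (2 * k) → EndFib k N) (Q : Coord k → EndFib k N) : Prop :=
  ∀ ψ : Coord k → Fib k N, ContDiffOn ℝ ∞ ψ U → ∀ x ∈ U,
    γ.localOp e b (γ.localOp e b ψ) x = γ.bochnerLaplacian e B ψ x + Q x *ᵥ ψ x

open Classical in
/-- The Dirac potential `tr(D² - Δ_D)` on `U`, where `Δ_D` is the Bochner-Laplacian that belongs
to the (unique) connection for which `D² - Δ_D` is of order zero. -/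
def diracPotential {N : ℕ} (U : Set (Coord k))
    (e : Coord k → Matrix (Fin (2 * k)) (Fin (2 * k)) ℝ) (b : Coord k → EndFib k N)
    (x : Coord k) : ℂ :=
  if h : ∃ Q : Coord k → EndFib k N, ∃ B : Coord k → Fin (2 * k) → EndFib k N,
      (∀ μ, SmoothMatOn (fun y => B y μ) U) ∧ γ.IsLichnerowicz U e b B Q
  then (h.choose x).trace else 0

/-- `d + B` is a Clifford connection on `U`: `[∇_μ, γ(dx^ν)] = γ(∇_μ dx^ν)`, with the
Levi-Civita connection of the metric on the right. -/
def IsCliffordOn {N : ℕ} (U : Set (Coord k))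
    (e : Coord k → Matrix (Fin (2 * k)) (Fin (2 * k)) ℝ)
    (B : Coord k → Fin (2 * k) → EndFib k N) : Prop :=
  ∀ x ∈ U, ∀ μ ν, matDeriv (γ.symbol N e ν) μ x
      + (B x μ * γ.symbol N e ν x - γ.symbol N e ν x * B x μ)
    = - ∑ l, ((christoffel (metricOf p e) ν μ l x : ℝ) : ℂ) • γ.symbol N e l x

/-- The local action `∫_K V_D(D) μ_M`, for `D = γ(dx^μ) ∂_μ + b` on `U`. -/
def action {N : ℕ} (U K : Set (Coord k))
    (e : Coord k → Matrix (Fin (2 * k)) (Fin (2 * k)) ℝ) (b : Coord k → EndFib k N) : ℂ :=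
  ∫ x in K, γ.diracPotential U e b x * ((Real.sqrt |(metricOf p e x).det| : ℝ) : ℂ)

end GammaMatrices

/-! ### Fermion bundles -/

/-- A smooth faithful representation `ρ : G → SU(N)`, even with respect to an involution `χ`
of `ℂ^N`. -/
structure FermionRep {EG : Type*} [NormedAddCommGroup EG] [NormedSpace ℝ EG] (G : Type*)
    [TopologicalSpace G] [ChartedSpace EG G] [Group G] (N : ℕ) where
  ρ : G →* Matrix.specialUnitaryGroup (Fin N) ℂ
  smooth : ∀ a b, ContMDiff 𝓘(ℝ, EG) 𝓘(ℝ, ℂ) ∞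
    (fun g : G => (ρ g : Matrix (Fin N) (Fin N) ℂ) a b)
  faithful : Function.Injective ρ
  chi : Matrix (Fin N) (Fin N) ℂ
  chi_sq : chi * chi = 1
  chi_comm : ∀ g, chi * (ρ g : Matrix (Fin N) (Fin N) ℂ) = ρ g * chi

section Bundles

variable {k p N : ℕ} {EG : Type*} [NormedAddCommGroup EG] [NormedSpace ℝ EG]
  {G : Type*} [TopologicalSpace G] [ChartedSpace EG G] [Group G]
  {M : Type*} [TopologicalSpace M] [ChartedSpace (Coord k) M] {ι : Type*}

/-- The matrix `ρ(g)`. -/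
def FermionRep.mat (R : FermionRep (EG := EG) G N) (g : G) : Matrix (Fin N) (Fin N) ℂ := R.ρ g

/-- The action `1 ⊗ ρ(g)` of the Yang-Mills structure group on the typical fibre. -/
def FermionRep.act (k : ℕ) (R : FermionRep (EG := EG) G N) (g : G) : EndFib k N :=
  (1 : Matrix (Fin (2 ^ k)) (Fin (2 ^ k)) ℂ) ⊗ₖ R.mat g

/-- The isotropy group of `z` under `g ↦ ρ(g) z ρ(g)⁻¹`. -/
def FermionRep.isotropy (R : FermionRep (EG := EG) G N) (z : Matrix (Fin N) (Fin N) ℂ) :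
    Subgroup G where
  carrier := {g | R.mat g * z = z * R.mat g}
  mul_mem' := by
    intro a b ha hb
    simp only [Set.mem_ofPred_eq, FermionRep.mat, map_mul, Submonoid.coe_mul] at *
    rw [Matrix.mul_assoc, hb, ← Matrix.mul_assoc, ha, Matrix.mul_assoc]
  one_mem' := by simp [FermionRep.mat]
  inv_mem' := by
    intro a ha
    simp only [Set.mem_ofPred_eq, FermionRep.mat] at *
    have h1 : (R.ρ a⁻¹ : Matrix (Fin N) (Fin N) ℂ) * R.ρ a = 1 := by
      rw [← Submonoid.coe_mul, ← map_mul]; simp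
    have h2 : (R.ρ a : Matrix (Fin N) (Fin N) ℂ) * R.ρ a⁻¹ = 1 := by
      rw [← Submonoid.coe_mul, ← map_mul]; simp
    calc (R.ρ a⁻¹ : Matrix (Fin N) (Fin N) ℂ) * z
        = R.ρ a⁻¹ * z * (R.ρ a * R.ρ a⁻¹) := by rw [h2, Matrix.mul_one]
      _ = R.ρ a⁻¹ * (z * R.ρ a) * R.ρ a⁻¹ := by simp only [Matrix.mul_assoc]
      _ = R.ρ a⁻¹ * (R.ρ a * z) * R.ρ a⁻¹ := by rw [ha]
      _ = (R.ρ a⁻¹ * R.ρ a) * z * R.ρ a⁻¹ := by simp only [Matrix.mul_assoc]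
      _ = z * R.ρ a⁻¹ := by rw [h1, Matrix.one_mul]

/-- A fermion bundle over `M`: a vector bundle with typical fibre `ℂ^(2^k) ⊗ ℂ^N`, given by local
trivializations over coordinate domains whose transition functions form a smooth cocycle with
values in `Spin(p,q) × G`. Local representatives of sections obey
`ψ_i = (S_ij ⊗ ρ(g_ij)) ψ_j`. -/
structure FermionBundle (γ : GammaMatrices k p) (R : FermionRep (EG := EG) G N)
    (M : Type*) [TopologicalSpace M] [ChartedSpace (Coord k) M] (ι : Type*) where
  chart : ι → OpenPartialHomeomorph M (Coord k)
  chart_mem : ∀ i, chart i ∈ IsManifold.maximalAtlas 𝓘(ℝ, Coord k) ∞ M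
  cover : ∀ x, ∃ i, x ∈ (chart i).source
  S : ι → ι → M → (Matrix (Fin (2 ^ k)) (Fin (2 ^ k)) ℂ)ˣ
  S_spin : ∀ i j, ∀ x ∈ (chart i).source ∩ (chart j).source, S i j x ∈ γ.spin
  S_smooth : ∀ i j s t, ContMDiffOn 𝓘(ℝ, Coord k) 𝓘(ℝ, ℂ) ∞
    (fun x => (S i j x : Matrix (Fin (2 ^ k)) (Fin (2 ^ k)) ℂ) s t)
    ((chart i).source ∩ (chart j).source)
  S_cocycle : ∀ i j l, ∀ x ∈ (chart i).source ∩ (chart j).source ∩ (chart l).source,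
    S i j x * S j l x = S i l x
  g : ι → ι → M → G
  g_smooth : ∀ i j, ContMDiffOn 𝓘(ℝ, Coord k) 𝓘(ℝ, EG) ∞ (g i j)
    ((chart i).source ∩ (chart j).source)
  g_cocycle : ∀ i j l, ∀ x ∈ (chart i).source ∩ (chart j).source ∩ (chart l).source,
    g i j x * g j l x = g i l x

variable {γ : GammaMatrices k p} {R : FermionRep (EG := EG) G N}

namespace FermionBundle

variable (F : FermionBundle γ R M ι)

/-- The transition function `S_ij ⊗ ρ(g_ij)` of the vector bundle, in the coordinates `i`. -/
def trans (i j : ι) (x : Coord k) : EndFib k N :=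
  (F.S i j ((F.chart i).symm x) : Matrix (Fin (2 ^ k)) (Fin (2 ^ k)) ℂ)
    ⊗ₖ R.mat (F.g i j ((F.chart i).symm x))

/-- The coordinate change from `i` to `j`. -/
def coordChange (i j : ι) (x : Coord k) : Coord k := F.chart j ((F.chart i).symm x)

/-- The overlap of the coordinate domains `i` and `j`, in the coordinates `i`. -/
def overlap (i j : ι) : Set (Coord k) :=
  (F.chart i).target ∩ (F.chart i).symm ⁻¹' (F.chart j).source

/-- The local representative over `i` that belongs to the representative `ψ` over `j`. -/
def transport (i j : ι) (ψ : Coord k → Fib k N) (x : Coord k) : Fib k N :=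
  F.trans i j x *ᵥ ψ (F.coordChange i j x)

end FermionBundle

/-- A Dirac type operator on a chiral fermion bundle: in each trivialization it is
`D_i = γ_i^μ ∂_μ + b_i` with `γ_i^μ = e^μ_a γ^a ⊗ 1`, compatibly with the transition functions,
and it is odd with respect to `Γ = γ_M ⊗ χ`. -/
structure DiracOperator (F : FermionBundle γ R M ι) where
  e : ι → Coord k → Matrix (Fin (2 * k)) (Fin (2 * k)) ℝ
  e_smooth : ∀ i, SmoothMatOn (e i) (F.chart i).target
  e_invertible : ∀ i, ∀ x ∈ (F.chart i).target, (e i x).det ≠ 0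
  b : ι → Coord k → EndFib k N
  b_smooth : ∀ i, SmoothMatOn (b i) (F.chart i).target
  compatible : ∀ i j, ∀ ψ : Coord k → Fib k N, ContDiffOn ℝ ∞ ψ (F.chart j).target →
    ∀ x ∈ F.overlap i j,
      γ.localOp (e i) (b i) (F.transport i j ψ) x
        = F.trans i j x *ᵥ γ.localOp (e j) (b j) ψ (F.coordChange i j x)
  odd : ∀ i, ∀ x ∈ (F.chart i).target,
    (γ.gammaM ⊗ₖ R.chi) * b i x = - (b i x * (γ.gammaM ⊗ₖ R.chi))

/-- A linear connection on the fermion bundle, given by its local connection forms `B_i`. -/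
structure Connection (F : FermionBundle γ R M ι) where
  B : ι → Coord k → Fin (2 * k) → EndFib k N
  smooth : ∀ i μ, SmoothMatOn (fun y => B i y μ) (F.chart i).target
  compatible : ∀ i j, ∀ ψ : Coord k → Fib k N, ContDiffOn ℝ ∞ ψ (F.chart j).target →
    ∀ x ∈ F.overlap i j, ∀ v w : Coord k, w = fderiv ℝ (F.coordChange i j) x v →
      fderiv ℝ (F.transport i j ψ) x v + (∑ μ, v μ • B i x μ) *ᵥ F.transport i j ψ x
        = F.trans i j x *ᵥ (fderiv ℝ ψ (F.coordChange i j x) w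
          + (∑ μ, w μ • B j (F.coordChange i j x) μ) *ᵥ ψ (F.coordChange i j x))

namespace DiracOperator

variable {F : FermionBundle γ R M ι} (D : DiracOperator F)

/-- The metric `g_M` defined by the principal symbol of `D`, in the coordinates `i`. -/
def metric (i : ι) : Coord k → Matrix (Fin (2 * k)) (Fin (2 * k)) ℝ := metricOf p (D.e i)

/-- `A` is a Clifford connection with respect to the Clifford action defined by `D`. -/
def IsClifford (A : Connection F) : Prop :=
  ∀ i, γ.IsCliffordOn (F.chart i).target (D.e i) (A.B i)

/-- `A` defines the Bochner-Laplacian of `D`: `D² - Δ_A` is of order zero. -/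
def IsBochner (A : Connection F) : Prop :=
  ∀ i, ∃ Q : Coord k → EndFib k N,
    γ.IsLichnerowicz (F.chart i).target (D.e i) (D.b i) (A.B i) Q

/-- `D` is of simple type and `A` is the Clifford connection that defines its
Bochner-Laplacian. -/
def IsSimpleType (A : Connection F) : Prop := D.IsClifford A ∧ D.IsBochner A

/-- The zero order operator `D - γ ∘ ∇_A`. -/
def zeroOrder (A : Connection F) (i : ι) (x : Coord k) : EndFib k N :=
  D.b i x - γ.slashConn (D.e i) (A.B i) x

/-- The Euler-Lagrange equations of the Dirac-Lagrangian, the zero order operator `D - γ ∘ ∇_A`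
being a background field: for each trivialization over `U`, the action over each compact `K ⊆ U`
is stationary under all smooth variations, supported in `K`, of the Clifford action (the frame
`e`) and of the Clifford connection. -/
def EulerLagrange (A : Connection F) : Prop :=
  ∀ (i : ι) (K : Set (Coord k)), IsCompact K → K ⊆ (F.chart i).target →
  ∀ (δ : ℝ), 0 < δ →
  ∀ (e : ℝ → Coord k → Matrix (Fin (2 * k)) (Fin (2 * k)) ℝ)
    (B : ℝ → Coord k → Fin (2 * k) → EndFib k N),
    SmoothMatOn (fun z : ℝ × Coord k => e z.1 z.2) (Set.Ioo (-δ) δ ×ˢ (F.chart i).target) →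
    (∀ μ, SmoothMatOn (fun z : ℝ × Coord k => B z.1 z.2 μ)
      (Set.Ioo (-δ) δ ×ˢ (F.chart i).target)) →
    (∀ t ∈ Set.Ioo (-δ) δ, ∀ x ∈ (F.chart i).target, (e t x).det ≠ 0) →
    (∀ t ∈ Set.Ioo (-δ) δ, γ.IsCliffordOn (F.chart i).target (e t) (B t)) →
    (∀ x ∈ (F.chart i).target, e 0 x = D.e i x ∧ B 0 x = A.B i x) →
    (∀ t ∈ Set.Ioo (-δ) δ, ∀ x ∈ (F.chart i).target \ K,
      e t x = D.e i x ∧ B t x = A.B i x) →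
    HasDerivAt (fun t => γ.action (F.chart i).target K (e t)
      (fun x => γ.slashConn (e t) (B t) x + D.zeroOrder A i x)) 0 0

/-- The values, in all frames of the Yang-Mills principal bundle, of the section
`(D - γ ∘ ∇_A) / ‖D - γ ∘ ∇_A‖` of the unit sphere bundle (where `D - γ ∘ ∇_A ≠ 0`). -/
def unitImage (A : Connection F) : Set (EndFib k N) :=
  {Z | ∃ i, ∃ x ∈ (F.chart i).target, D.zeroOrder A i x ≠ 0 ∧ ∃ g : G,
    Z = R.act k g * normalized (D.zeroOrder A i x) * R.act k g⁻¹}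

/-- The Yang-Mills gauge group acts transitively on the image of `D - γ ∘ ∇_A`. -/
def IsTransitive (A : Connection F) : Prop :=
  ∀ Z ∈ D.unitImage A, ∀ W ∈ D.unitImage A, ∃ g : G, W = R.act k g * Z * R.act k g⁻¹

/-- `(M, g_M)` is an Einstein manifold. -/
def IsEinstein : Prop :=
  ∃ c : ℝ, ∀ i, ∀ x ∈ (F.chart i).target, ricci (D.metric i) x = c • D.metric i x

end DiracOperator

/-- A section of `End⁻_Cl(ξ)`: its local representatives `1 ⊗ 𝒟_i` commute with the Clifford
action and are odd with respect to `χ`. -/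
structure OddClSection (F : FermionBundle γ R M ι) where
  val : ι → Coord k → Matrix (Fin N) (Fin N) ℂ
  smooth : ∀ i, SmoothMatOn (val i) (F.chart i).target
  odd : ∀ i, ∀ x ∈ (F.chart i).target, R.chi * val i x = - (val i x * R.chi)
  compatible : ∀ i j, ∀ x ∈ F.overlap i j,
    val i x = R.mat (F.g i j ((F.chart i).symm x)) * val j (F.coordChange i j x)
      * R.mat (F.g i j ((F.chart i).symm x))⁻¹

/-- The total fermionic mass operator `M_F`, defined by `i M_F = γ_M ⊗ 𝒟`. -/
def OddClSection.massOp {F : FermionBundle γ R M ι} (𝒟 : OddClSection F) (i : ι)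
    (x : Coord k) : EndFib k N :=
  (-Complex.I) • (γ.gammaM ⊗ₖ 𝒟.val i x)

/-- A reduction to the subgroup `H` of the principal `G`-bundle that belongs to the cocycle
`g_ij`: around each point `a` a smooth change of frame `h_a`, such that the transition
functions of the new frames take their values in `H`. -/
structure Reduction (F : FermionBundle γ R M ι) (H : Subgroup G) where
  nbhd : M → Set M
  nbhd_open : ∀ a, IsOpen (nbhd a)
  mem_nbhd : ∀ a, a ∈ nbhd a
  idx : M → ι
  nbhd_sub : ∀ a, nbhd a ⊆ (F.chart (idx a)).source
  h : M → M → G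
  smooth : ∀ a, ContMDiffOn 𝓘(ℝ, Coord k) 𝓘(ℝ, EG) ∞ (h a) (nbhd a)
  mem : ∀ a c, ∀ x ∈ nbhd a ∩ nbhd c,
    (h a x)⁻¹ * F.g (idx a) (idx c) x * h c x ∈ H

/-- In all the frames of the reduction the section `𝒟` is the constant matrix `z`. -/
def OddClSection.IsConstant {F : FermionBundle γ R M ι} (𝒟 : OddClSection F) {H : Subgroup G}
    (Q : Reduction F H) (z : Matrix (Fin N) (Fin N) ℂ) : Prop :=
  ∀ a, ∀ x ∈ Q.nbhd a,
    R.mat (Q.h a x)⁻¹ * 𝒟.val (Q.idx a) (F.chart (Q.idx a) x) * R.mat (Q.h a x) = z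

end Bundles

end DiracGauge

end

/-! For D of simple type the operator Φ = D − γ∘∇_A anticommutes with the Clifford action, because
γΦ + Φγ is exactly the first order discrepancy between D² and the Bochner-Laplacian of A
(`anticommute_of_isLichnerowicz`). The γ-matrices generate all of M_{2^k}(ℂ), so a Schur type
argument gives Φ = γ_M ⊗ 𝒟 (`eq_gammaM_kronecker_of_anticommute`), and oddness of D makes 𝒟
anticommute with χ.

The Weitzenböck formula and the uniqueness of the Bochner connection give tr(D² − Δ_D) = −ε 2^k N/4
· r + tr Φ² (`diracPotential_eq`). With Φ fixed, the Dirac-Lagrangian is therefore the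
Einstein-Hilbert Lagrangian with tr Φ² = σ‖Φ‖² as cosmological term. Varying the frame, with the
spin connection following it, yields the Einstein equation (`einstein_equation`, via the Palatini
identity `palatini`). Since n > 2 its trace can be solved for r, and then Ric = f g with f =
4εσ‖Φ‖²/((n−2)2^k N) (`IsCliffordData.ricci_eq`).

A priori f is a function. The contracted second Bianchi identity (`pderiv_eq_zero_of_ricci`) forces
df = 0, so ‖Φ‖ is constant on the connected manifold M. The normalization in the transitivity
hypothesis is then harmless, and 𝒟 itself takes values in a single conjugation orbit of G. For
compact G the orbit map has smooth local sections (`exists_contMDiffOn_orbit_section`), so locally 𝒟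
= ρ(h) z ρ(h)⁻¹ with h smooth, and these h are the frames of a reduction to the isotropy group of z.
-/

noncomputable section
namespace DiracGauge

/-! ### Partial derivatives in coordinates and smooth dependence on a parameter. -/

section Calculus

variable {k : ℕ} {V : Type*} [NormedAddCommGroup V] [NormedSpace ℝ V]

/-- Entrywise partial derivative of a matrix-valued function, over any normed space of scalars. -/
def dmat {m l : Type*} (f : Coord k → Matrix m l V) (μ : Fin (2 * k)) (x : Coord k) :
    Matrix m l V :=
  Matrix.of fun s t => pderiv (fun y => f y s t) μ x

theorem differentiableAt_of_contDiffOn {X : Type*} [NormedAddCommGroup X] [NormedSpace ℝ X]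
    {f : X → V} {U : Set X} (hf : ContDiffOn ℝ ∞ f U) (hU : IsOpen U) {x : X} (hx : x ∈ U) :
    DifferentiableAt ℝ f x :=
  (hf.contDiffAt (hU.mem_nhds hx)).differentiableAt (by simp)

theorem pderiv_congr {f g : Coord k → V} {x : Coord k} (h : f =ᶠ[𝓝 x] g) (μ : Fin (2 * k)) :
    pderiv f μ x = pderiv g μ x := by
  rw [pderiv, pderiv, h.fderiv_eq]

theorem pderiv_congr_on {f g : Coord k → V} {U : Set (Coord k)} (hU : IsOpen U)
    (h : ∀ y ∈ U, f y = g y) {x : Coord k} (hx : x ∈ U) (μ : Fin (2 * k)) :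
    pderiv f μ x = pderiv g μ x :=
  pderiv_congr (Filter.eventuallyEq_of_mem (hU.mem_nhds hx) h) μ

@[simp] theorem pderiv_const (c : V) (μ : Fin (2 * k)) (x : Coord k) :
    pderiv (fun _ => c) μ x = 0 := by simp [pderiv]

theorem pderiv_add {f g : Coord k → V} {x : Coord k} (hf : DifferentiableAt ℝ f x)
    (hg : DifferentiableAt ℝ g x) (μ : Fin (2 * k)) :
    pderiv (fun y => f y + g y) μ x = pderiv f μ x + pderiv g μ x := by
  simp [pderiv, fderiv_fun_add hf hg]

theorem pderiv_sub {f g : Coord k → V} {x : Coord k} (hf : DifferentiableAt ℝ f x)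
    (hg : DifferentiableAt ℝ g x) (μ : Fin (2 * k)) :
    pderiv (fun y => f y - g y) μ x = pderiv f μ x - pderiv g μ x := by
  simp [pderiv, fderiv_fun_sub hf hg]

theorem pderiv_neg (f : Coord k → V) (x : Coord k) (μ : Fin (2 * k)) :
    pderiv (fun y => - f y) μ x = - pderiv f μ x := by
  simp [pderiv, fderiv_fun_neg]

theorem pderiv_mul {𝔸 : Type*} [NormedRing 𝔸] [NormedAlgebra ℝ 𝔸] {f g : Coord k → 𝔸}
    {x : Coord k} (hf : DifferentiableAt ℝ f x)
    (hg : DifferentiableAt ℝ g x) (μ : Fin (2 * k)) :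
    pderiv (fun y => f y * g y) μ x = pderiv f μ x * g x + f x * pderiv g μ x := by
  simp [pderiv, fderiv_fun_mul' hf hg, add_comm]

theorem pderiv_sum {ι : Type*} (s : Finset ι) {f : ι → Coord k → V} {x : Coord k}
    (hf : ∀ i ∈ s, DifferentiableAt ℝ (f i) x) (μ : Fin (2 * k)) :
    pderiv (fun y => ∑ i ∈ s, f i y) μ x = ∑ i ∈ s, pderiv (f i) μ x := by
  simp [pderiv, fderiv_fun_sum hf]

theorem pderiv_clm {W : Type*} [NormedAddCommGroup W] [NormedSpace ℝ W] (L : V →L[ℝ] W)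
    {f : Coord k → V} {x : Coord k} (hf : DifferentiableAt ℝ f x) (μ : Fin (2 * k)) :
    pderiv (fun y => L (f y)) μ x = L (pderiv f μ x) := by
  have := (L.hasFDerivAt (x := f x)).comp x hf.hasFDerivAt
  rw [pderiv, pderiv]
  have h2 := this.fderiv
  rw [show (fun y => L (f y)) = L ∘ f from rfl, h2]; rfl

theorem pderiv_pi {ι : Type*} [Fintype ι] {f : Coord k → ι → V} {x : Coord k}
    (hf : DifferentiableAt ℝ f x) (μ : Fin (2 * k)) (i : ι) :
    pderiv f μ x i = pderiv (fun y => f y i) μ x :=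
  (pderiv_clm (ContinuousLinearMap.proj (R := ℝ) (φ := fun _ : ι => V) i) hf μ).symm

theorem pderiv_ofReal {f : Coord k → ℝ} {x : Coord k} (hf : DifferentiableAt ℝ f x)
    (μ : Fin (2 * k)) :
    pderiv (fun y => ((f y : ℝ) : ℂ)) μ x = ((pderiv f μ x : ℝ) : ℂ) :=
  pderiv_clm Complex.ofRealCLM hf μ

/-- Partial derivatives of a function that depends smoothly on a parameter, in terms of the
total derivative. -/
theorem pderiv_slice {F : ℝ × Coord k → V} {t : ℝ} {x : Coord k}
    (hF : DifferentiableAt ℝ F (t, x)) (μ : Fin (2 * k)) :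
    pderiv (fun y => F (t, y)) μ x = fderiv ℝ F (t, x) (0, EuclideanSpace.single μ 1) := by
  have h : HasFDerivAt (fun y : Coord k => (t, y)) (ContinuousLinearMap.inr ℝ ℝ (Coord k)) x :=
    hasFDerivAt_prodMk_right t x
  have := HasFDerivAt.comp (f := fun y : Coord k => (t, y)) (g := F) x hF.hasFDerivAt h
  rw [pderiv, show (fun y => F (t, y)) = F ∘ (fun y : Coord k => (t, y)) from rfl, this.fderiv]
  rfl

theorem hasDerivAt_slice {F : ℝ × Coord k → V} {t : ℝ} {x : Coord k}
    (hF : DifferentiableAt ℝ F (t, x)) :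
    HasDerivAt (fun s => F (s, x)) (fderiv ℝ F (t, x) (1, 0)) t := by
  have h : HasFDerivAt (fun s : ℝ => (s, x)) (ContinuousLinearMap.inl ℝ ℝ (Coord k)) t :=
    hasFDerivAt_prodMk_left t x
  have := HasFDerivAt.comp (f := fun s : ℝ => (s, x)) (g := F) t hF.hasFDerivAt h
  have h2 := this.hasDerivAt
  rw [ContinuousLinearMap.comp_apply, ContinuousLinearMap.inl_apply] at h2
  exact h2

theorem contDiffOn_fderiv_apply {X : Type*} [NormedAddCommGroup X] [NormedSpace ℝ X]
    {F : X → V} {Ω : Set X} (hΩ : IsOpen Ω) (hF : ContDiffOn ℝ ∞ F Ω) (v : X) :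
    ContDiffOn ℝ ∞ (fun z => fderiv ℝ F z v) Ω :=
  (hF.fderiv_of_isOpen hΩ (by simp)).clm_apply contDiffOn_const

theorem contDiffOn_pderiv {f : Coord k → V} {U : Set (Coord k)} (hU : IsOpen U)
    (hf : ContDiffOn ℝ ∞ f U) (μ : Fin (2 * k)) : ContDiffOn ℝ ∞ (pderiv f μ) U :=
  contDiffOn_fderiv_apply hU hf _

theorem contDiffOn_pderiv_param {F : ℝ × Coord k → V} {Ω : Set (ℝ × Coord k)} (hΩ : IsOpen Ω)
    (hF : ContDiffOn ℝ ∞ F Ω) (μ : Fin (2 * k)) :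
    ContDiffOn ℝ ∞ (fun z : ℝ × Coord k => pderiv (fun y => F (z.1, y)) μ z.2) Ω :=
  (contDiffOn_fderiv_apply hΩ hF (0, EuclideanSpace.single μ 1)).congr fun _ hz =>
    pderiv_slice (differentiableAt_of_contDiffOn hF hΩ hz) μ

theorem fderiv_fderiv_comm {X : Type*} [NormedAddCommGroup X] [NormedSpace ℝ X]
    {F : X → V} {Ω : Set X} (hΩ : IsOpen Ω) (hF : ContDiffOn ℝ ∞ F Ω) {z : X} (hz : z ∈ Ω)
    (v w : X) :
    fderiv ℝ (fun y => fderiv ℝ F y v) z w = fderiv ℝ (fun y => fderiv ℝ F y w) z v := by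
  have h1 : ContDiffAt ℝ ∞ F z := hF.contDiffAt (hΩ.mem_nhds hz)
  have h2 : DifferentiableAt ℝ (fderiv ℝ F) z :=
    ((hF.fderiv_of_isOpen hΩ (m := ∞) (by simp)).contDiffAt (hΩ.mem_nhds hz)).differentiableAt
      (by simp)
  have hs := h1.isSymmSndFDerivAt (by
    rw [minSmoothness_of_isRCLikeNormedField]; exact WithTop.coe_le_coe.mpr (le_top : (2 : ℕ∞) ≤ ⊤))
  have h3 : ∀ u, fderiv ℝ (fun y => fderiv ℝ F y u) z = (fderiv ℝ (fderiv ℝ F) z).flip u := by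
    intro u
    have := (h2.hasFDerivAt.clm_apply (hasFDerivAt_const u z)).fderiv
    rw [this]; ext; simp
  rw [h3, h3]
  exact hs _ _

theorem pderiv_comm {f : Coord k → V} {U : Set (Coord k)} (hU : IsOpen U)
    (hf : ContDiffOn ℝ ∞ f U) {x : Coord k} (hx : x ∈ U) (μ ν : Fin (2 * k)) :
    pderiv (pderiv f μ) ν x = pderiv (pderiv f ν) μ x :=
  fderiv_fderiv_comm hU hf hx _ _

/-- The derivative in the parameter commutes with partial derivatives. -/
theorem hasDerivAt_pderiv {F : ℝ × Coord k → V} {Ω : Set (ℝ × Coord k)} (hΩ : IsOpen Ω)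
    (hF : ContDiffOn ℝ ∞ F Ω) {t : ℝ} {x : Coord k} (hz : (t, x) ∈ Ω) (μ : Fin (2 * k)) :
    HasDerivAt (fun s => pderiv (fun y => F (s, y)) μ x)
      (pderiv (fun y => deriv (fun s => F (s, y)) t) μ x) t := by
  have h1 := contDiffOn_pderiv_param hΩ hF μ
  have h2 := hasDerivAt_slice (differentiableAt_of_contDiffOn h1 hΩ hz)
  have hnx : ∀ᶠ y in 𝓝 x, (t, y) ∈ Ω :=
    (Continuous.tendsto (f := fun y : Coord k => (t, y)) (by fun_prop) x).eventually
      (hΩ.mem_nhds hz)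
  have e1 : pderiv (fun y => deriv (fun s => F (s, y)) t) μ x
      = pderiv (fun y => fderiv ℝ F (t, y) (1, 0)) μ x := by
    refine pderiv_congr ?_ μ
    filter_upwards [hnx] with y hy
    exact (hasDerivAt_slice (differentiableAt_of_contDiffOn hF hΩ hy)).deriv
  have h3 := contDiffOn_fderiv_apply hΩ hF (1, 0)
  -- Both sides are mixed second derivatives of `F` in the directions `(1, 0)` and `(0, e_μ)`, equal
  -- by symmetry.
  rw [e1, pderiv_slice (F := fun z => fderiv ℝ F z (1, 0))
    (differentiableAt_of_contDiffOn h3 hΩ hz), fderiv_fderiv_comm hΩ hF hz]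
  convert h2 using 1
  refine congrArg (fun L : (ℝ × Coord k) →L[ℝ] V => L (1, 0)) (Filter.EventuallyEq.fderiv_eq ?_)
  filter_upwards [hΩ.mem_nhds hz] with z hz'
  exact (pderiv_slice (differentiableAt_of_contDiffOn hF hΩ hz') μ).symm

end Calculus

/-! ### Smooth matrix-valued functions and their partial derivatives. -/

section SmoothMat

variable {X R : Type*} [NormedAddCommGroup X] [NormedSpace ℝ X] {U : Set X} {m l r : Type*}

theorem SmoothMatOn.add [NormedAddCommGroup R] [NormedSpace ℝ R] {f g : X → Matrix m l R}
    (hf : SmoothMatOn f U) (hg : SmoothMatOn g U) : SmoothMatOn (fun y => f y + g y) U :=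
  fun s t => (hf s t).add (hg s t)

theorem SmoothMatOn.sub [NormedAddCommGroup R] [NormedSpace ℝ R] {f g : X → Matrix m l R}
    (hf : SmoothMatOn f U) (hg : SmoothMatOn g U) : SmoothMatOn (fun y => f y - g y) U :=
  fun s t => (hf s t).sub (hg s t)

theorem SmoothMatOn.neg [NormedAddCommGroup R] [NormedSpace ℝ R] {f : X → Matrix m l R}
    (hf : SmoothMatOn f U) : SmoothMatOn (fun y => - f y) U :=
  fun s t => (hf s t).neg

theorem SmoothMatOn.const [NormedAddCommGroup R] [NormedSpace ℝ R] (c : Matrix m l R) :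
    SmoothMatOn (fun _ : X => c) U :=
  fun _ _ => contDiffOn_const

theorem SmoothMatOn.mul [Fintype l] [NormedRing R] [NormedAlgebra ℝ R] {f : X → Matrix m l R}
    {g : X → Matrix l r R} (hf : SmoothMatOn f U) (hg : SmoothMatOn g U) :
    SmoothMatOn (fun y => f y * g y) U := by
  intro s t
  simp only [Matrix.mul_apply]
  exact ContDiffOn.sum fun i _ => (hf s i).mul (hg i t)

theorem SmoothMatOn.sum [NormedAddCommGroup R] [NormedSpace ℝ R] {ι : Type*} (I : Finset ι)
    {f : ι → X → Matrix m l R} (hf : ∀ i ∈ I, SmoothMatOn (f i) U) :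
    SmoothMatOn (fun y => ∑ i ∈ I, f i y) U := by
  intro s t
  simp only [Matrix.sum_apply]
  exact ContDiffOn.sum fun i hi => hf i hi s t

theorem SmoothMatOn.smul [NormedRing R] [NormedAlgebra ℝ R] {c : X → R} {f : X → Matrix m l R}
    (hc : ContDiffOn ℝ ∞ c U) (hf : SmoothMatOn f U) : SmoothMatOn (fun y => c y • f y) U :=
  fun s t => hc.mul (hf s t)

theorem SmoothMatOn.transpose [NormedAddCommGroup R] [NormedSpace ℝ R] {f : X → Matrix m l R}
    (hf : SmoothMatOn f U) : SmoothMatOn (fun y => (f y)ᵀ) U :=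
  fun s t => hf t s

theorem SmoothMatOn.congr [NormedAddCommGroup R] [NormedSpace ℝ R] {f g : X → Matrix m l R}
    (hf : SmoothMatOn f U) (h : ∀ y ∈ U, g y = f y) : SmoothMatOn g U :=
  fun s t => (hf s t).congr fun y hy => by rw [h y hy]

theorem contDiffOn_ofReal {f : X → ℝ} (hf : ContDiffOn ℝ ∞ f U) :
    ContDiffOn ℝ ∞ (fun y => ((f y : ℝ) : ℂ)) U :=
  Complex.ofRealCLM.contDiff.comp_contDiffOn hf

theorem SmoothMatOn.det [Fintype m] [DecidableEq m] {f : X → Matrix m m ℝ}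
    (hf : SmoothMatOn f U) : ContDiffOn ℝ ∞ (fun y => (f y).det) U := by
  simp only [Matrix.det_apply]
  exact ContDiffOn.sum fun σ _ => (contDiffOn_prod fun i _ => hf _ _).const_smul _

/-- Cramer's rule: an entry is a cofactor over the determinant, and a cofactor is the determinant of
the matrix with one row made constant. -/
theorem SmoothMatOn.inv [Fintype m] [DecidableEq m] {f : X → Matrix m m ℝ}
    (hf : SmoothMatOn f U) (h : ∀ y ∈ U, (f y).det ≠ 0) : SmoothMatOn (fun y => (f y)⁻¹) U := by
  intro s t
  simp only [Matrix.inv_def, Ring.inverse_eq_inv', Matrix.smul_apply, smul_eq_mul,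
    Matrix.adjugate_apply]
  refine (hf.det.inv h).mul (SmoothMatOn.det (f := fun y => (f y).updateRow t (Pi.single s 1)) ?_)
  intro i j
  by_cases hi : i = t
  · subst hi; simp only [Matrix.updateRow_self]; exact contDiffOn_const
  · simp only [Matrix.updateRow_ne hi]; exact hf i j

end SmoothMat

section Dmat

variable {k : ℕ} {R : Type*} {U : Set (Coord k)} {m l r : Type*}

theorem dmat_smooth [NormedAddCommGroup R] [NormedSpace ℝ R] (hU : IsOpen U)
    {f : Coord k → Matrix m l R} (hf : SmoothMatOn f U) (μ : Fin (2 * k)) :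
    SmoothMatOn (dmat f μ) U :=
  fun s t => contDiffOn_pderiv hU (hf s t) μ

theorem dmat_congr_on [NormedAddCommGroup R] [NormedSpace ℝ R] (hU : IsOpen U)
    {f g : Coord k → Matrix m l R} (h : ∀ y ∈ U, f y = g y) {x : Coord k} (hx : x ∈ U)
    (μ : Fin (2 * k)) : dmat f μ x = dmat g μ x := by
  ext s t
  exact pderiv_congr_on hU (fun y hy => by rw [h y hy]) hx μ

theorem dmat_comm [NormedAddCommGroup R] [NormedSpace ℝ R] (hU : IsOpen U)
    {f : Coord k → Matrix m l R} (hf : SmoothMatOn f U) {x : Coord k} (hx : x ∈ U)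
    (μ ν : Fin (2 * k)) : dmat (dmat f μ) ν x = dmat (dmat f ν) μ x := by
  ext s t
  exact pderiv_comm hU (hf s t) hx μ ν

theorem dmat_const [NormedAddCommGroup R] [NormedSpace ℝ R] (c : Matrix m l R)
    (μ : Fin (2 * k)) (x : Coord k) : dmat (fun _ => c) μ x = 0 := by
  ext s t
  exact pderiv_const _ _ _

theorem dmat_transpose [NormedAddCommGroup R] [NormedSpace ℝ R]
    (f : Coord k → Matrix m l R) (μ : Fin (2 * k)) (x : Coord k) :
    dmat (fun y => (f y)ᵀ) μ x = (dmat f μ x)ᵀ := rfl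

theorem dmat_add [NormedAddCommGroup R] [NormedSpace ℝ R] (hU : IsOpen U)
    {f g : Coord k → Matrix m l R} (hf : SmoothMatOn f U) (hg : SmoothMatOn g U) {x : Coord k}
    (hx : x ∈ U) (μ : Fin (2 * k)) :
    dmat (fun y => f y + g y) μ x = dmat f μ x + dmat g μ x := by
  ext s t
  exact pderiv_add (differentiableAt_of_contDiffOn (hf s t) hU hx)
    (differentiableAt_of_contDiffOn (hg s t) hU hx) μ

theorem dmat_sub [NormedAddCommGroup R] [NormedSpace ℝ R] (hU : IsOpen U)
    {f g : Coord k → Matrix m l R} (hf : SmoothMatOn f U) (hg : SmoothMatOn g U) {x : Coord k}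
    (hx : x ∈ U) (μ : Fin (2 * k)) :
    dmat (fun y => f y - g y) μ x = dmat f μ x - dmat g μ x := by
  ext s t
  exact pderiv_sub (differentiableAt_of_contDiffOn (hf s t) hU hx)
    (differentiableAt_of_contDiffOn (hg s t) hU hx) μ

theorem dmat_neg [NormedAddCommGroup R] [NormedSpace ℝ R]
    (f : Coord k → Matrix m l R) (x : Coord k) (μ : Fin (2 * k)) :
    dmat (fun y => - f y) μ x = - dmat f μ x := by
  ext s t
  exact pderiv_neg _ _ _

theorem dmat_sum [NormedAddCommGroup R] [NormedSpace ℝ R] (hU : IsOpen U) {ι : Type*}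
    (I : Finset ι) {f : ι → Coord k → Matrix m l R} (hf : ∀ i ∈ I, SmoothMatOn (f i) U)
    {x : Coord k} (hx : x ∈ U) (μ : Fin (2 * k)) :
    dmat (fun y => ∑ i ∈ I, f i y) μ x = ∑ i ∈ I, dmat (f i) μ x := by
  ext s t
  rw [Matrix.sum_apply]
  simp only [dmat, Matrix.of_apply, Matrix.sum_apply]
  exact pderiv_sum I (fun i hi => differentiableAt_of_contDiffOn (hf i hi s t) hU hx) μ

theorem dmat_mul [Fintype l] [NormedRing R] [NormedAlgebra ℝ R] (hU : IsOpen U)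
    {f : Coord k → Matrix m l R} {g : Coord k → Matrix l r R} (hf : SmoothMatOn f U)
    (hg : SmoothMatOn g U) {x : Coord k} (hx : x ∈ U) (μ : Fin (2 * k)) :
    dmat (fun y => f y * g y) μ x = dmat f μ x * g x + f x * dmat g μ x := by
  ext s t
  simp only [dmat, Matrix.of_apply, Matrix.mul_apply, Matrix.add_apply, ← Finset.sum_add_distrib]
  have hF := fun i => differentiableAt_of_contDiffOn (hf s i) hU hx
  have hG := fun i => differentiableAt_of_contDiffOn (hg i t) hU hx
  rw [pderiv_sum _ (fun i _ => (hF i).fun_mul (hG i))]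
  exact Finset.sum_congr rfl fun i _ => pderiv_mul (hF i) (hG i) μ

theorem dmat_smul [NormedRing R] [NormedAlgebra ℝ R] (hU : IsOpen U)
    {c : Coord k → R} {f : Coord k → Matrix m l R} (hc : ContDiffOn ℝ ∞ c U)
    (hf : SmoothMatOn f U) {x : Coord k} (hx : x ∈ U) (μ : Fin (2 * k)) :
    dmat (fun y => c y • f y) μ x = pderiv c μ x • f x + c x • dmat f μ x := by
  ext s t
  exact pderiv_mul (differentiableAt_of_contDiffOn hc hU hx)
    (differentiableAt_of_contDiffOn (hf s t) hU hx) μ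

end Dmat

end DiracGauge
end

noncomputable section
namespace DiracGauge

/-! ### Curvature identities and Schur's lemma for semi-Riemannian metrics. -/

section Metric

variable {k : ℕ}

/-- A smooth field of invertible symmetric matrices on an open set. -/
structure IsMetricOn (g : Coord k → Matrix (Fin (2 * k)) (Fin (2 * k)) ℝ)
    (U : Set (Coord k)) : Prop where
  isOpen : IsOpen U
  smooth : SmoothMatOn g U
  symm : ∀ x ∈ U, (g x)ᵀ = g x
  det_ne : ∀ x ∈ U, (g x).det ≠ 0

/-- The Christoffel symbols as matrices `(Γ_μ)^r_s`. -/
def chrMat (g : Coord k → Matrix (Fin (2 * k)) (Fin (2 * k)) ℝ) (μ : Fin (2 * k))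
    (x : Coord k) : Matrix (Fin (2 * k)) (Fin (2 * k)) ℝ :=
  Matrix.of fun r s => christoffel g r μ s x

/-- The curvature as a matrix-valued two-form `(R_{μν})^r_s`. -/
def rieMat (g : Coord k → Matrix (Fin (2 * k)) (Fin (2 * k)) ℝ) (μ ν : Fin (2 * k))
    (x : Coord k) : Matrix (Fin (2 * k)) (Fin (2 * k)) ℝ :=
  dmat (chrMat g ν) μ x - dmat (chrMat g μ) ν x
    + (chrMat g μ x * chrMat g ν x - chrMat g ν x * chrMat g μ x)

theorem riemann_eq (g : Coord k → Matrix (Fin (2 * k)) (Fin (2 * k)) ℝ)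
    (r s μ ν : Fin (2 * k)) (x : Coord k) : riemann g r s μ ν x = rieMat g μ ν x r s := by
  simp only [riemann, rieMat, Matrix.add_apply, Matrix.sub_apply, Matrix.mul_apply, dmat, chrMat,
    Matrix.of_apply, Finset.sum_sub_distrib]

theorem ricci_apply (g : Coord k → Matrix (Fin (2 * k)) (Fin (2 * k)) ℝ)
    (s ν : Fin (2 * k)) (x : Coord k) : ricci g x s ν = ∑ r, rieMat g r ν x r s := by
  simp only [ricci, Matrix.of_apply, riemann_eq]

theorem rieMat_antisymm (g : Coord k → Matrix (Fin (2 * k)) (Fin (2 * k)) ℝ) (μ ν : Fin (2 * k))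
    (x : Coord k) : rieMat g ν μ x = - rieMat g μ ν x := by
  simp only [rieMat]; abel

namespace IsMetricOn

variable {g : Coord k → Matrix (Fin (2 * k)) (Fin (2 * k)) ℝ} {U : Set (Coord k)}
  (hg : IsMetricOn g U)

include hg

theorem pderiv_symm {x : Coord k} (hx : x ∈ U) (μ r s : Fin (2 * k)) :
    pderiv (fun y => g y r s) μ x = pderiv (fun y => g y s r) μ x :=
  pderiv_congr_on hg.isOpen (fun y hy => congrFun (congrFun (hg.symm y hy) s) r) hx μ

theorem christoffel_symm {x : Coord k} (hx : x ∈ U) (l μ ν : Fin (2 * k)) :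
    christoffel g l μ ν x = christoffel g l ν μ x := by
  simp only [christoffel]
  congr 1
  refine Finset.sum_congr rfl fun r _ => ?_
  rw [hg.pderiv_symm hx r μ ν]
  ring

theorem chrMat_symm {x : Coord k} (hx : x ∈ U) (l μ ν : Fin (2 * k)) :
    chrMat g μ x l ν = chrMat g ν x l μ :=
  hg.christoffel_symm hx l μ ν

theorem inv_smooth : SmoothMatOn (fun y => (g y)⁻¹) U := hg.smooth.inv hg.det_ne

theorem chrMat_smooth (μ : Fin (2 * k)) : SmoothMatOn (chrMat g μ) U := by
  intro l ν
  change ContDiffOn ℝ ∞ (fun x => christoffel g l μ ν x) U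
  simp only [christoffel]
  refine contDiffOn_const.mul (ContDiffOn.sum fun r _ => (hg.inv_smooth l r).mul ?_)
  exact ((contDiffOn_pderiv hg.isOpen (hg.smooth _ _) _).add
    (contDiffOn_pderiv hg.isOpen (hg.smooth _ _) _)).sub
    (contDiffOn_pderiv hg.isOpen (hg.smooth _ _) _)

theorem rieMat_smooth (μ ν : Fin (2 * k)) : SmoothMatOn (rieMat g μ ν) U :=
  ((dmat_smooth hg.isOpen (hg.chrMat_smooth ν) μ).sub
    (dmat_smooth hg.isOpen (hg.chrMat_smooth μ) ν)).add
    (((hg.chrMat_smooth μ).mul (hg.chrMat_smooth ν)).sub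
      ((hg.chrMat_smooth ν).mul (hg.chrMat_smooth μ)))

theorem mul_inv {x : Coord k} (hx : x ∈ U) : g x * (g x)⁻¹ = 1 :=
  Matrix.mul_nonsing_inv _ (isUnit_iff_ne_zero.2 (hg.det_ne x hx))

theorem inv_mul {x : Coord k} (hx : x ∈ U) : (g x)⁻¹ * g x = 1 :=
  Matrix.nonsing_inv_mul _ (isUnit_iff_ne_zero.2 (hg.det_ne x hx))

theorem inv_symm {x : Coord k} (hx : x ∈ U) : ((g x)⁻¹)ᵀ = (g x)⁻¹ := by
  rw [Matrix.transpose_nonsing_inv, hg.symm x hx]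

theorem mul_chrMat {x : Coord k} (hx : x ∈ U) (μ r s : Fin (2 * k)) :
    (g x * chrMat g μ x) r s = 1 / 2 * (pderiv (fun y => g y r s) μ x
      + pderiv (fun y => g y r μ) s x - pderiv (fun y => g y μ s) r x) := by
  have h : chrMat g μ x = (g x)⁻¹ * Matrix.of fun r s => 1 / 2 * (pderiv (fun y => g y r s) μ x
      + pderiv (fun y => g y r μ) s x - pderiv (fun y => g y μ s) r x) := by
    ext l ν
    simp only [chrMat, Matrix.of_apply, christoffel, Matrix.mul_apply, Finset.mul_sum]
    exact Finset.sum_congr rfl fun r _ => by ring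
  rw [h, ← Matrix.mul_assoc, hg.mul_inv hx, Matrix.one_mul, Matrix.of_apply]

/-- Metric compatibility ∇g = 0. With its index lowered, the Christoffel symbol is half of ∂_μ g
plus a part skew in `r, s`, which cancels against the transpose. -/
theorem dmat_eq {x : Coord k} (hx : x ∈ U) (μ : Fin (2 * k)) :
    dmat g μ x = g x * chrMat g μ x + (g x * chrMat g μ x)ᵀ := by
  ext r s
  rw [Matrix.add_apply, Matrix.transpose_apply, hg.mul_chrMat hx, hg.mul_chrMat hx,
    hg.pderiv_symm hx μ s r, hg.pderiv_symm hx r s μ, hg.pderiv_symm hx s μ r]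
  simp only [dmat, Matrix.of_apply]
  ring

/-- ∇g⁻¹ = 0, obtained by differentiating g⁻¹ g = 1. -/
theorem dmat_inv {x : Coord k} (hx : x ∈ U) (μ : Fin (2 * k)) :
    dmat (fun y => (g y)⁻¹) μ x
      = - (chrMat g μ x * (g x)⁻¹ + (g x)⁻¹ * (chrMat g μ x)ᵀ) := by
  have h := dmat_mul hg.isOpen hg.inv_smooth hg.smooth hx μ
  rw [dmat_congr_on hg.isOpen (g := fun _ => 1) (fun y hy => hg.inv_mul hy) hx, dmat_const,
    hg.dmat_eq hx, Matrix.transpose_mul, hg.symm x hx] at h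
  have h2 := congrArg (· * (g x)⁻¹) h
  simp only [Matrix.zero_mul, Matrix.add_mul, Matrix.mul_add, Matrix.mul_assoc, hg.mul_inv hx,
    Matrix.mul_one] at h2
  rw [← Matrix.mul_assoc (g x)⁻¹ (g x), hg.inv_mul hx, Matrix.one_mul] at h2
  exact eq_neg_of_add_eq_zero_left h2.symm

/-- Metric connections have skew curvature. -/
theorem rieMat_mul_inv_skew {x : Coord k} (hx : x ∈ U) (μ ν : Fin (2 * k)) :
    (rieMat g μ ν x * (g x)⁻¹)ᵀ = - (rieMat g μ ν x * (g x)⁻¹) := by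
  -- ∇g⁻¹ = 0 expresses the second derivatives of g⁻¹ through Γ and its first derivatives. Their
  -- symmetry in μ, ν then says that the curvature annihilates g⁻¹.
  have key : ∀ μ ν, dmat (dmat (fun y => (g y)⁻¹) ν) μ x
      = - (dmat (chrMat g ν) μ x * (g x)⁻¹
        - chrMat g ν x * (chrMat g μ x * (g x)⁻¹ + (g x)⁻¹ * (chrMat g μ x)ᵀ)
        - (chrMat g μ x * (g x)⁻¹ + (g x)⁻¹ * (chrMat g μ x)ᵀ) * (chrMat g ν x)ᵀ
        + (g x)⁻¹ * (dmat (chrMat g ν) μ x)ᵀ) := by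
    intro μ ν
    have hΓ := hg.chrMat_smooth ν
    rw [dmat_congr_on hg.isOpen (fun y hy => hg.dmat_inv hy ν) hx, dmat_neg,
      dmat_add hg.isOpen (hΓ.mul hg.inv_smooth) (hg.inv_smooth.mul hΓ.transpose) hx,
      dmat_mul hg.isOpen hΓ hg.inv_smooth hx, dmat_mul hg.isOpen hg.inv_smooth hΓ.transpose hx,
      dmat_transpose, hg.dmat_inv hx]
    noncomm_ring
  have h := dmat_comm hg.isOpen hg.inv_smooth hx μ ν
  rw [key, key] at h
  rw [Matrix.transpose_mul, hg.inv_symm hx, rieMat]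
  simp only [Matrix.transpose_add, Matrix.transpose_sub, Matrix.transpose_mul]
  rw [eq_neg_iff_add_eq_zero, ← sub_eq_zero.2 h]
  noncomm_ring

/-- The trace of R is that of (R g⁻¹) g, a skew matrix against a symmetric one. -/
theorem trace_rieMat {x : Coord k} (hx : x ∈ U) (μ ν : Fin (2 * k)) :
    (rieMat g μ ν x).trace = 0 := by
  have h := congrArg (fun Z => (Z * g x).trace) (hg.rieMat_mul_inv_skew hx μ ν)
  simp only [Matrix.transpose_mul, hg.inv_symm hx, Matrix.neg_mul, Matrix.mul_assoc,
    hg.inv_mul hx, Matrix.mul_one, Matrix.trace_neg] at h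
  rw [Matrix.trace_mul_comm, Matrix.mul_assoc, hg.mul_inv hx, Matrix.mul_one,
    Matrix.trace_transpose] at h
  linarith

/-- Symmetry of Γ in its lower indices matches the derivative terms, and the quadratic terms, in
pairs that cancel in the cyclic sum. -/
theorem first_bianchi {x : Coord k} (hx : x ∈ U) (r s μ ν : Fin (2 * k)) :
    rieMat g μ ν x r s + rieMat g ν s x r μ + rieMat g s μ x r ν = 0 := by
  have hd : ∀ μ ν s, dmat (chrMat g ν) μ x r s = dmat (chrMat g s) μ x r ν := fun μ ν s =>
    pderiv_congr_on hg.isOpen (fun y hy => hg.chrMat_symm hy r ν s) hx μ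
  have hm : ∀ μ ν s, (chrMat g μ x * chrMat g ν x) r s = (chrMat g μ x * chrMat g s x) r ν := by
    intro μ ν s
    simp only [Matrix.mul_apply]
    exact Finset.sum_congr rfl fun l _ => by rw [hg.chrMat_symm hx l ν s]
  simp only [rieMat, Matrix.add_apply, Matrix.sub_apply]
  rw [hd μ ν s, hd ν μ s, hd s ν μ, hm μ ν s, hm ν μ s, hm s ν μ]
  ring

/-- Contracting `first_bianchi` leaves the difference of two Ricci components plus the trace of a
curvature matrix, which vanishes. -/
theorem ricci_symm {x : Coord k} (hx : x ∈ U) : (ricci g x)ᵀ = ricci g x := by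
  ext s ν
  rw [Matrix.transpose_apply, ricci_apply, ricci_apply]
  have h : ∑ r, (rieMat g r ν x r s + rieMat g ν s x r r + rieMat g s r x r ν) = 0 :=
    Finset.sum_eq_zero fun r _ => hg.first_bianchi hx r s r ν
  have h2 := hg.trace_rieMat hx ν s
  simp only [Matrix.trace, Matrix.diag_apply] at h2
  simp only [Finset.sum_add_distrib, h2, fun r => rieMat_antisymm g r s x, Matrix.neg_apply,
    Finset.sum_neg_distrib] at h
  linarith

/-- This is d_∇ R = 0: second derivatives of Γ commute, and all other terms cancel as noncommutative
polynomials. -/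
theorem second_bianchi {x : Coord k} (hx : x ∈ U) (l μ ν : Fin (2 * k)) :
    (dmat (rieMat g μ ν) l x
        + (chrMat g l x * rieMat g μ ν x - rieMat g μ ν x * chrMat g l x))
      + (dmat (rieMat g ν l) μ x
        + (chrMat g μ x * rieMat g ν l x - rieMat g ν l x * chrMat g μ x))
      + (dmat (rieMat g l μ) ν x
        + (chrMat g ν x * rieMat g l μ x - rieMat g l μ x * chrMat g ν x)) = 0 := by
  have hd : ∀ l μ ν, dmat (rieMat g μ ν) l x
      = dmat (dmat (chrMat g ν) μ) l x - dmat (dmat (chrMat g μ) ν) l x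
        + (dmat (chrMat g μ) l x * chrMat g ν x + chrMat g μ x * dmat (chrMat g ν) l x
          - (dmat (chrMat g ν) l x * chrMat g μ x + chrMat g ν x * dmat (chrMat g μ) l x)) := by
    intro l μ ν
    have hΓ := hg.chrMat_smooth
    have hO := hg.isOpen
    have h1 := fun μ ν => dmat_smooth hO (hΓ ν) μ
    have h2 := fun μ ν => (hΓ μ).mul (hΓ ν)
    unfold rieMat
    rw [dmat_add hO ((h1 _ _).sub (h1 _ _)) ((h2 _ _).sub (h2 _ _)) hx,
      dmat_sub hO (h1 _ _) (h1 _ _) hx, dmat_sub hO (h2 _ _) (h2 _ _) hx,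
      dmat_mul hO (hΓ _) (hΓ _) hx, dmat_mul hO (hΓ _) (hΓ _) hx]
  have hc := fun l μ ν => dmat_comm hg.isOpen (hg.chrMat_smooth l) hx μ ν
  simp only [hd]
  rw [hc ν μ l, hc l ν μ, hc μ ν l]
  simp only [rieMat]
  noncomm_ring

/-- Schur's lemma: if the Ricci tensor is a multiple of the metric, the factor has vanishing
derivative in dimension at least three. -/
theorem pderiv_eq_zero_of_ricci (hk : 2 ≤ k) {f : Coord k → ℝ} (hf : ContDiffOn ℝ ∞ f U)
    (hR : ∀ x ∈ U, ricci g x = f x • g x) {x : Coord k} (hx : x ∈ U) (l : Fin (2 * k)) :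
    pderiv f l x = 0 := by
  -- Raising an index makes `N μ ν` skew in its matrix indices as well as in μ, ν, so each
  -- contraction of a matrix index with a form index is ±f δ (`c1` to `c4`).
  set N : Fin (2 * k) → Fin (2 * k) → Coord k → Matrix (Fin (2 * k)) (Fin (2 * k)) ℝ :=
    fun μ ν y => rieMat g μ ν y * (g y)⁻¹ with hN
  have hNs : ∀ μ ν, SmoothMatOn (N μ ν) U := fun μ ν => (hg.rieMat_smooth μ ν).mul hg.inv_smooth
  have hNd : ∀ μ ν a b, DifferentiableAt ℝ (fun y => N μ ν y a b) x := fun μ ν a b =>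
    differentiableAt_of_contDiffOn (hNs μ ν a b) hg.isOpen hx
  have hfd := differentiableAt_of_contDiffOn hf hg.isOpen hx
  have skew1 : ∀ y ∈ U, ∀ μ ν a b, N μ ν y b a = - N μ ν y a b := fun y hy μ ν a b =>
    congrFun (congrFun (hg.rieMat_mul_inv_skew hy μ ν) a) b
  have skew2 : ∀ y μ ν a b, N ν μ y a b = - N μ ν y a b := by
    intro y μ ν a b
    simp only [hN, rieMat_antisymm g μ ν, Matrix.neg_mul, Matrix.neg_apply]
  have c1 : ∀ y ∈ U, ∀ ν s, ∑ r, N r ν y r s = f y * (1 : Matrix _ _ ℝ) ν s := by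
    intro y hy ν s
    have h1 : ∑ r, N r ν y r s = ((ricci g y)ᵀ * (g y)⁻¹) ν s := by
      simp only [hN, Matrix.mul_apply, Matrix.transpose_apply, ricci_apply, Finset.sum_mul]
      rw [Finset.sum_comm]
    rw [h1, hg.ricci_symm hy, hR y hy, Matrix.smul_mul, hg.mul_inv hy, Matrix.smul_apply,
      smul_eq_mul]
  have c2 : ∀ y ∈ U, ∀ ν s, ∑ r, N ν r y s r = f y * (1 : Matrix _ _ ℝ) ν s := by
    intro y hy ν s
    rw [← c1 y hy ν s]
    exact Finset.sum_congr rfl fun r _ => by rw [skew2 y r ν, skew1 y hy r ν r s, neg_neg]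
  have c3 : ∀ y ∈ U, ∀ ν s, ∑ r, N r ν y s r = - (f y * (1 : Matrix _ _ ℝ) ν s) := by
    intro y hy ν s
    rw [← c1 y hy ν s, ← Finset.sum_neg_distrib]
    exact Finset.sum_congr rfl fun r _ => by rw [skew1 y hy r ν r s]
  have c4 : ∀ y ∈ U, ∀ ν s, ∑ r, N ν r y r s = - (f y * (1 : Matrix _ _ ℝ) ν s) := by
    intro y hy ν s
    rw [← c1 y hy ν s, ← Finset.sum_neg_distrib]
    exact Finset.sum_congr rfl fun r _ => by rw [skew2 y r ν]
  -- Since g⁻¹ is parallel, the second Bianchi identity passes from R to `N`; the connection now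
  -- acts on both matrix indices.
  have hB : ∀ l μ ν, (dmat (N μ ν) l x + chrMat g l x * N μ ν x + N μ ν x * (chrMat g l x)ᵀ)
      + (dmat (N ν l) μ x + chrMat g μ x * N ν l x + N ν l x * (chrMat g μ x)ᵀ)
      + (dmat (N l μ) ν x + chrMat g ν x * N l μ x + N l μ x * (chrMat g ν x)ᵀ) = 0 := by
    intro l μ ν
    have h := congrArg (· * (g x)⁻¹) (hg.second_bianchi hx l μ ν)
    have hd : ∀ l μ ν, dmat (N μ ν) l x = dmat (rieMat g μ ν) l x * (g x)⁻¹
        - rieMat g μ ν x * (chrMat g l x * (g x)⁻¹ + (g x)⁻¹ * (chrMat g l x)ᵀ) := by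
      intro l μ ν
      rw [hN, dmat_mul hg.isOpen (hg.rieMat_smooth μ ν) hg.inv_smooth hx, hg.dmat_inv hx]
      noncomm_ring
    simp only [Matrix.zero_mul] at h
    rw [← h]
    simp only [hd]
    simp only [hN]
    noncomm_ring
  have hdN : ∀ (l : Fin (2 * k)) (F : Fin (2 * k) → Coord k → ℝ) (c : ℝ),
      (∀ r, DifferentiableAt ℝ (F r) x) → (∀ y ∈ U, ∑ r, F r y = f y * c) →
      ∑ r, pderiv (F r) l x = pderiv f l x * c := by
    intro l F c hF h
    rw [← pderiv_sum _ (fun r _ => hF r), pderiv_congr_on hg.isOpen h hx,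
      pderiv_mul hfd (differentiableAt_const c)]
    simp
  -- Double contraction. The derivative terms give 2k ∂_l f (`s1`) and twice −∂_l f (`s4`, `s7`).
  -- The connection terms cancel among `s2`, `s3`, `s5`, `s9`, or vanish as skew against symmetric
  -- (`s6`, `s8`). What is left is (n − 2) ∂_l f = 0.
  have hsum : ∑ μ, ∑ ν, ((dmat (N μ ν) l x + chrMat g l x * N μ ν x
        + N μ ν x * (chrMat g l x)ᵀ)
      + (dmat (N ν l) μ x + chrMat g μ x * N ν l x + N ν l x * (chrMat g μ x)ᵀ)
      + (dmat (N l μ) ν x + chrMat g ν x * N l μ x + N l μ x * (chrMat g ν x)ᵀ)) μ ν = 0 :=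
    Finset.sum_eq_zero fun μ _ => Finset.sum_eq_zero fun ν _ => by rw [hB]; rfl
  simp only [Matrix.add_apply, Finset.sum_add_distrib] at hsum
  have s1 : ∑ μ, ∑ ν, dmat (N μ ν) l x μ ν = (2 * k) * pderiv f l x := by
    rw [Finset.sum_comm]
    refine (Finset.sum_congr rfl fun ν _ => hdN l (fun μ y => N μ ν y μ ν) _
      (fun μ => hNd _ _ _ _) (fun y hy => c1 y hy ν ν)).trans ?_
    simp
  have s2 : ∑ μ, ∑ ν, (chrMat g l x * N μ ν x) μ ν = f x * (chrMat g l x).trace := by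
    simp only [Matrix.mul_apply, Matrix.trace, Matrix.diag_apply, Finset.mul_sum]
    refine Finset.sum_congr rfl fun μ _ => ?_
    rw [Finset.sum_comm]
    simp only [← Finset.mul_sum, c2 x hx, Matrix.one_apply]
    simp [mul_comm]
  have s3 : ∑ μ, ∑ ν, (N μ ν x * (chrMat g l x)ᵀ) μ ν = f x * (chrMat g l x).trace := by
    simp only [Matrix.mul_apply, Matrix.trace, Matrix.diag_apply, Finset.mul_sum,
      Matrix.transpose_apply]
    rw [Finset.sum_comm]
    refine Finset.sum_congr rfl fun ν _ => ?_
    rw [Finset.sum_comm]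
    simp only [← Finset.sum_mul, c1 x hx, Matrix.one_apply]
    simp
  have s4 : ∑ μ, ∑ ν, dmat (N ν l) μ x μ ν = - pderiv f l x := by
    refine (Finset.sum_congr rfl fun μ _ => hdN μ (fun ν y => N ν l y μ ν)
      (- (1 : Matrix _ _ ℝ) l μ) (fun ν => hNd _ _ _ _)
      (fun y hy => by rw [c3 y hy l μ]; ring)).trans ?_
    simp [Matrix.one_apply]
  have s5 : ∑ μ, ∑ ν, (chrMat g μ x * N ν l x) μ ν = - (f x * (chrMat g l x).trace) := by
    simp only [Matrix.mul_apply, Matrix.trace, Matrix.diag_apply, Finset.mul_sum]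
    rw [← Finset.sum_neg_distrib]
    refine Finset.sum_congr rfl fun μ _ => ?_
    rw [Finset.sum_comm]
    simp only [← Finset.mul_sum, c3 x hx, Matrix.one_apply]
    simp [mul_comm, hg.chrMat_symm hx μ l μ]
  have s9 : ∑ μ, ∑ ν, (N l μ x * (chrMat g ν x)ᵀ) μ ν = - (f x * (chrMat g l x).trace) := by
    simp only [Matrix.mul_apply, Matrix.trace, Matrix.diag_apply, Finset.mul_sum,
      Matrix.transpose_apply]
    rw [Finset.sum_comm, ← Finset.sum_neg_distrib]
    refine Finset.sum_congr rfl fun ν _ => ?_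
    rw [Finset.sum_comm]
    simp only [← Finset.sum_mul, c4 x hx, Matrix.one_apply]
    simp [hg.chrMat_symm hx ν l ν]
  have skew_zero : ∀ (A : Matrix (Fin (2 * k)) (Fin (2 * k)) ℝ) (B : Fin (2 * k) →
      Fin (2 * k) → ℝ), (∀ a b, A b a = - A a b) → (∀ a b, B a b = B b a) →
      ∑ a, ∑ b, A a b * B a b = 0 := by
    intro A B hA hB
    have h : ∑ a, ∑ b, A a b * B a b = - ∑ a, ∑ b, A a b * B a b := by
      conv_lhs => rw [Finset.sum_comm]
      simp only [← Finset.sum_neg_distrib]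
      exact Finset.sum_congr rfl fun a _ => Finset.sum_congr rfl fun b _ => by
        rw [hA a b, hB b a]; ring
    linarith
  have s6 : ∑ μ, ∑ ν, (N ν l x * (chrMat g μ x)ᵀ) μ ν = 0 := by
    rw [Finset.sum_comm]
    refine Finset.sum_eq_zero fun ν _ => ?_
    simp only [Matrix.mul_apply, Matrix.transpose_apply]
    exact skew_zero (N ν l x) (fun a b => chrMat g a x ν b) (skew1 x hx ν l)
      (fun a b => hg.chrMat_symm hx ν a b)
  have s7 : ∑ μ, ∑ ν, dmat (N l μ) ν x μ ν = - pderiv f l x := by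
    rw [Finset.sum_comm]
    refine (Finset.sum_congr rfl fun ν _ => hdN ν (fun μ y => N l μ y μ ν)
      (- (1 : Matrix _ _ ℝ) l ν) (fun μ => hNd _ _ _ _)
      (fun y hy => by rw [c4 y hy l ν]; ring)).trans ?_
    simp [Matrix.one_apply]
  have s8 : ∑ μ, ∑ ν, (chrMat g ν x * N l μ x) μ ν = 0 := by
    refine Finset.sum_eq_zero fun μ _ => ?_
    simp only [Matrix.mul_apply]
    rw [Finset.sum_comm]
    rw [← skew_zero (N l μ x) (fun a b => chrMat g b x μ a) (skew1 x hx l μ)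
      (fun a b => hg.chrMat_symm hx μ b a)]
    exact Finset.sum_congr rfl fun a _ => Finset.sum_congr rfl fun b _ => mul_comm _ _
  rw [s1, s2, s3, s4, s5, s6, s7, s8, s9] at hsum
  have hk' : (2 : ℝ) ≤ k := by exact_mod_cast hk
  have : (2 * (k : ℝ) - 2) * pderiv f l x = 0 := by linarith
  rcases mul_eq_zero.1 this with h | h
  · linarith
  · exact h

end IsMetricOn

end Metric

end DiracGauge
end

noncomputable section
namespace DiracGauge

/-! ### The γ-matrices: irreducibility and the grading involution. -/

section ListProducts

variable {m : Type*} [Fintype m] [DecidableEq m]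

theorem mul_prod_ofFn {n : ℕ} (c : Matrix m m ℂ) (f : Fin n → Matrix m m ℂ) (s : Fin n → ℂ)
    (h : ∀ b, c * f b = s b • (f b * c)) :
    c * (List.ofFn f).prod = (∏ b, s b) • ((List.ofFn f).prod * c) := by
  induction n with
  | zero => simp
  | succ n ih =>
    rw [List.ofFn_succ, List.prod_cons, Fin.prod_univ_succ, ← Matrix.mul_assoc, h 0,
      Matrix.smul_mul, Matrix.mul_assoc, ih _ _ fun b => h b.succ]
    simp only [Matrix.mul_smul, smul_smul, Matrix.mul_assoc]

/-- Pulling the first factor past the `n` others costs (−1)^n, so the exponents add up to 0 + 1 + …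
. -/
theorem prod_ofFn_sq {n : ℕ} (f : Fin n → Matrix m m ℂ) (q : Fin n → ℂ)
    (hq : ∀ a, f a * f a = q a • 1) (h : ∀ a b, a ≠ b → f a * f b = - (f b * f a)) :
    (List.ofFn f).prod * (List.ofFn f).prod
      = ((-1) ^ (∑ i ∈ Finset.range n, i) * ∏ a, q a) • 1 := by
  induction n with
  | zero => simp
  | succ n ih =>
    rw [List.ofFn_succ, List.prod_cons, Fin.prod_univ_succ]
    set P := (List.ofFn fun i : Fin n => f i.succ).prod with hP
    have h1 : f 0 * P = (∏ _b : Fin n, (-1 : ℂ)) • (P * f 0) :=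
      mul_prod_ofFn _ _ _ fun b => by rw [h 0 b.succ (Fin.succ_ne_zero b).symm]; simp
    have h2 := ih (fun i => f i.succ) (fun i => q i.succ) (fun a => hq _)
      (fun a b hab => h _ _ (fun hh => hab (Fin.succ_injective _ hh)))
    rw [← hP] at h2
    have hs : ((-1 : ℂ) ^ n) * (-1) ^ n = 1 := by rw [← mul_pow]; simp
    have h3 : P * f 0 = ((-1 : ℂ) ^ n) • (f 0 * P) := by
      rw [h1, smul_smul]; simp [hs]
    calc f 0 * P * (f 0 * P) = f 0 * (P * f 0) * P := by simp only [Matrix.mul_assoc]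
      _ = ((-1 : ℂ) ^ n) • ((f 0 * f 0) * (P * P)) := by
          rw [h3]; simp only [Matrix.mul_smul, Matrix.smul_mul, Matrix.mul_assoc]
      _ = _ := by
          rw [hq, h2, Finset.sum_range_succ, pow_add]
          simp only [Matrix.smul_mul, Matrix.one_mul, smul_smul]
          congr 1
          ring

end ListProducts

section PartialTrace

variable {k N : ℕ}

/-- The normalized partial trace over the spinor factor. -/
def spinorTrace (Z : EndFib k N) : Matrix (Fin N) (Fin N) ℂ :=
  Matrix.of fun a b => ((2 ^ k : ℂ))⁻¹ * ∑ s, Z (s, a) (s, b)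

theorem spinorTrace_one_kronecker (z : Matrix (Fin N) (Fin N) ℂ) :
    spinorTrace ((1 : Matrix (Fin (2 ^ k)) (Fin (2 ^ k)) ℂ) ⊗ₖ z) = z := by
  ext a b
  simp [spinorTrace, Matrix.kroneckerMap_apply]

end PartialTrace

namespace GammaMatrices

variable {k p : ℕ} (γ : GammaMatrices k p)

theorem sgn_mul_sgn : γ.sgn * γ.sgn = 1 := by
  rcases γ.sgn_eq with h | h <;> rw [h] <;> norm_num

theorem gam_mul_self (a : Fin (2 * k)) :
    γ.gam a * γ.gam a = ((γ.sgn * eta k p a : ℝ) : ℂ) • 1 := by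
  have h := γ.clifford a a
  rw [if_pos rfl, ← two_smul ℂ] at h
  have h2 := congrArg (fun Z => (2⁻¹ : ℂ) • Z) h
  simp only [smul_smul] at h2
  norm_num at h2
  rw [h2]
  congr 1
  push_cast
  ring

theorem gam_anticomm {a b : Fin (2 * k)} (hab : a ≠ b) :
    γ.gam a * γ.gam b = - (γ.gam b * γ.gam a) := by
  have h := γ.clifford a b
  rw [if_neg hab] at h
  exact eq_neg_of_add_eq_zero_left h

theorem gam_mem_unitaryGroup (a : Fin (2 * k)) :
    γ.gam a ∈ Matrix.unitaryGroup (Fin (2 ^ k)) ℂ :=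
  Matrix.mem_unitaryGroup_iff'.2 (γ.unitary a)

theorem gam_mul_conjTranspose (a : Fin (2 * k)) : γ.gam a * (γ.gam a)ᴴ = 1 :=
  mul_eq_one_comm.1 (γ.unitary a)

/-- The ordered product of the `γ`-matrices with index in `I`. -/
def gprod (I : Finset (Fin (2 * k))) : Matrix (Fin (2 ^ k)) (Fin (2 ^ k)) ℂ :=
  (List.ofFn fun a => if a ∈ I then γ.gam a else 1).prod

theorem gprod_empty : γ.gprod ∅ = 1 := by
  simp [gprod]

/-- γ^a commutes with itself and anticommutes with the other generators, so the sign counts the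
elements of `I` different from `a`. -/
theorem gam_mul_gprod (a : Fin (2 * k)) (I : Finset (Fin (2 * k))) :
    γ.gam a * γ.gprod I = ((-1 : ℂ) ^ (I.erase a).card) • (γ.gprod I * γ.gam a) := by
  have h := mul_prod_ofFn (γ.gam a) (fun b => if b ∈ I then γ.gam b else 1)
    (fun b => if b ∈ I.erase a then -1 else 1) (fun b => by
      by_cases hb : b ∈ I
      · by_cases hab : b = a
        · subst hab; simp
        · simp [hb, hab, γ.gam_anticomm (Ne.symm hab)]
      · simp [hb])
  rw [gprod, h, Finset.prod_ite_mem, Finset.univ_inter, Finset.prod_const]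

theorem gprod_unitary (I : Finset (Fin (2 * k))) : (γ.gprod I)ᴴ * γ.gprod I = 1 := by
  refine Matrix.mem_unitaryGroup_iff'.1 (Submonoid.list_prod_mem _ fun x hx => ?_)
  obtain ⟨a, rfl⟩ := (List.mem_ofFn' _ _).1 hx
  dsimp only
  split_ifs
  · exact γ.gam_mem_unitaryGroup a
  · exact one_mem _

/-- Conjugation by the unitary γ^a preserves the trace but multiplies Xᴴ Y by (−1)^(c+d) = −1. -/
theorem trace_conjTranspose_mul_eq_zero {a : Fin (2 * k)} {c d : ℕ}
    {X Y : Matrix (Fin (2 ^ k)) (Fin (2 ^ k)) ℂ}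
    (hX : γ.gam a * X = ((-1 : ℂ) ^ c) • (X * γ.gam a))
    (hY : γ.gam a * Y = ((-1 : ℂ) ^ d) • (Y * γ.gam a)) (hcd : Odd (c + d)) :
    (Xᴴ * Y).trace = 0 := by
  have h : (Xᴴ * Y).trace = - (Xᴴ * Y).trace := by
    calc (Xᴴ * Y).trace = ((γ.gam a * X)ᴴ * (γ.gam a * Y)).trace := by
          rw [Matrix.conjTranspose_mul, Matrix.mul_assoc, ← Matrix.mul_assoc _ (γ.gam a) Y,
            γ.unitary, Matrix.one_mul]
      _ = (-1 : ℂ) ^ (c + d) * ((γ.gam a)ᴴ * (Xᴴ * Y * γ.gam a)).trace := by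
          rw [hX, hY, Matrix.conjTranspose_smul, Matrix.conjTranspose_mul]
          simp only [Matrix.smul_mul, Matrix.mul_smul, smul_smul, Matrix.trace_smul,
            Matrix.mul_assoc, star_pow, star_neg, star_one, smul_eq_mul, pow_add]
          ring
      _ = - (Xᴴ * Y).trace := by
          rw [hcd.neg_one_pow, Matrix.trace_mul_comm, Matrix.mul_assoc,
            γ.gam_mul_conjTranspose, Matrix.mul_one]
          ring
  exact self_eq_neg.1 h

/-- If the sum were even for every `a`, membership in `I` and `J` would agree everywhere or differ
everywhere. In the second case J is the complement of I, so |I| + |J| = 2k is even, which puts one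
back in the first case. Evenness of the dimension is essential here. -/
theorem exists_odd_card_erase {I J : Finset (Fin (2 * k))} (hIJ : I ≠ J) :
    ∃ a, Odd ((I.erase a).card + (J.erase a).card) := by
  have key : ∀ (I : Finset (Fin (2 * k))) (a : Fin (2 * k)),
      (I.erase a).card + (if a ∈ I then 1 else 0) = I.card := by
    intro I a
    split_ifs with h
    · exact Finset.card_erase_add_one h
    · simp [Finset.erase_eq_of_notMem h]
  by_contra hcon
  push Not at hcon
  have hdiff : ∀ a, (Even (I.card + J.card) ↔ (a ∈ I ↔ a ∈ J)) := by
    intro a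
    have h1 := key I a
    have h2 := key J a
    have h3 := Nat.not_odd_iff_even.1 (hcon a)
    rw [← h1, ← h2]
    by_cases ha : a ∈ I <;> by_cases hb : a ∈ J <;> simp only [ha, hb, if_true, if_false] <;>
      grind
  by_cases he : Even (I.card + J.card)
  · exact hIJ (Finset.ext fun a => (hdiff a).1 he)
  · have hc : J = Iᶜ := by
      ext a
      have := hdiff a
      rw [Finset.mem_compl]
      tauto
    apply he
    rw [hc, Finset.card_add_card_compl, Fintype.card_fin]
    exact even_two_mul k

/-- The 2^(2k) ordered products are orthogonal for the Hilbert-Schmidt product, hence independent,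
and their number is the dimension of M_{2^k}(ℂ). -/
theorem span_gprod : Submodule.span ℂ (Set.range γ.gprod) = ⊤ := by
  have horth : ∀ I J, I ≠ J → ((γ.gprod I)ᴴ * γ.gprod J).trace = 0 := by
    intro I J hIJ
    obtain ⟨a, ha⟩ := exists_odd_card_erase hIJ
    exact γ.trace_conjTranspose_mul_eq_zero (γ.gam_mul_gprod a I) (γ.gam_mul_gprod a J) ha
  have hli : LinearIndependent ℂ γ.gprod := by
    rw [Fintype.linearIndependent_iff]
    intro c hc I
    have h := congrArg (fun Z => ((γ.gprod I)ᴴ * Z).trace) hc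
    simp only [Matrix.mul_sum, Matrix.trace_sum, Matrix.mul_smul, Matrix.trace_smul,
      Matrix.mul_zero, Matrix.trace_zero] at h
    rw [Finset.sum_eq_single I (fun J _ hJ => by rw [horth I J (Ne.symm hJ), smul_zero])
      (by simp), γ.gprod_unitary] at h
    simpa using h
  refine hli.span_eq_top_of_card_eq_finrank' ?_
  rw [Fintype.card_finset, Fintype.card_fin, Module.finrank_matrix]
  simp [← pow_add, two_mul]

open scoped ComplexOrder in
/-- The `γ`-matrices act irreducibly. -/
theorem eq_smul_one_of_commute {X : Matrix (Fin (2 ^ k)) (Fin (2 ^ k)) ℂ}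
    (hX : ∀ a, γ.gam a * X = X * γ.gam a) : X = ((2 ^ k : ℂ)⁻¹ * X.trace) • 1 := by
  -- The traceless part of `X` still commutes with all γ^a. It turns out to be orthogonal to every
  -- `gprod I`, so to every matrix, itself included.
  set Y := X - ((2 ^ k : ℂ)⁻¹ * X.trace) • (1 : Matrix (Fin (2 ^ k)) (Fin (2 ^ k)) ℂ) with hY
  have hYc : ∀ a, γ.gam a * Y = Y * γ.gam a := by
    intro a
    rw [hY, Matrix.mul_sub, Matrix.sub_mul, hX]
    simp
  have hYt : Y.trace = 0 := by
    rw [hY, Matrix.trace_sub, Matrix.trace_smul, Matrix.trace_one]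
    simp
    field_simp
    simp
  have horth : ∀ Z, (Yᴴ * Z).trace = 0 := by
    intro Z
    have hZ : Z ∈ Submodule.span ℂ (Set.range γ.gprod) := by rw [γ.span_gprod]; trivial
    induction hZ using Submodule.span_induction with
    | mem Z hZ =>
      obtain ⟨I, rfl⟩ := hZ
      -- For the empty product orthogonality is tracelessness; any other product anticommutes with
      -- some γ^a, while `Y` commutes with it.
      by_cases hI : I = ∅
      · rw [hI, γ.gprod_empty, Matrix.mul_one, Matrix.trace_conjTranspose, hYt, star_zero]
      · obtain ⟨a, ha⟩ := exists_odd_card_erase hI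
        refine γ.trace_conjTranspose_mul_eq_zero (a := a) (c := 0) (by simp [hYc])
          (γ.gam_mul_gprod a I) (by simpa using ha)
    | zero => simp
    | add Z W _ _ hZ hW => rw [Matrix.mul_add, Matrix.trace_add, hZ, hW, add_zero]
    | smul c Z _ hZ => rw [Matrix.mul_smul, Matrix.trace_smul, hZ, smul_zero]
  have h0 : Y = 0 := Matrix.trace_conjTranspose_mul_self_eq_zero_iff.1 (horth Y)
  exact sub_eq_zero.1 h0

theorem gammaM_eq : γ.gammaM = (Complex.I ^ (k + (2 * k - p))) • γ.gprod Finset.univ := by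
  simp [gammaM, gprod]

/-- Besides itself γ^a meets 2k − 1 factors, an odd number. -/
theorem gam_mul_gammaM (hk : 1 ≤ k) (a : Fin (2 * k)) :
    γ.gam a * γ.gammaM = - (γ.gammaM * γ.gam a) := by
  have h : Odd (2 * k - 1) := by grind
  rw [gammaM_eq, Matrix.mul_smul, gam_mul_gprod, Finset.card_erase_of_mem (Finset.mem_univ a)]
  simp [h.neg_one_pow]

theorem prod_eta (hp : p ≤ 2 * k) : ∏ a, eta k p a = (-1) ^ (2 * k - p) := by
  unfold eta
  rw [Fin.prod_univ_eq_prod_range (fun a => if a < p then (1 : ℝ) else -1)]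
  obtain ⟨q, hq⟩ := Nat.exists_eq_add_of_le hp
  rw [hq, Finset.prod_range_add, Nat.add_sub_cancel_left]
  rw [Finset.prod_congr rfl (g := fun _ => (1 : ℝ)) (fun a ha => by simp_all)]
  simp

/-- Three signs cancel: (−1)^(k(2k−1)) = (−1)^k from reordering, (−1)^q from the signature and
(−1)^(k+q) from the squared phase. The sign ε occurs to the even power 2k. -/
theorem gammaM_mul_self (hp : p ≤ 2 * k) : γ.gammaM * γ.gammaM = 1 := by
  have h := prod_ofFn_sq γ.gam (fun a => ((γ.sgn * eta k p a : ℝ) : ℂ)) γ.gam_mul_self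
    (fun a b => γ.gam_anticomm)
  rw [gammaM, Matrix.smul_mul, Matrix.mul_smul, h, smul_smul, smul_smul,
    ← Complex.ofReal_prod, Finset.prod_mul_distrib, prod_eta hp]
  have h1 : ∏ _a : Fin (2 * k), γ.sgn = 1 := by
    rw [Finset.prod_const, Finset.card_univ, Fintype.card_fin, pow_mul, pow_two, sgn_mul_sgn,
      one_pow]
  have h2 : ((-1 : ℂ)) ^ (∑ i ∈ Finset.range (2 * k), i) = (-1) ^ k := by
    have : ∑ i ∈ Finset.range (2 * k), i = k * (2 * k - 1) := by
      rw [Finset.sum_range_id, mul_assoc, Nat.mul_div_cancel_left _ (by norm_num)]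
    rw [this]
    rcases Nat.eq_zero_or_pos k with rfl | hk
    · simp
    · have ho : Odd (2 * k - 1) := by grind
      rw [mul_comm, pow_mul, ho.neg_one_pow]
  rw [h1, h2]
  have h3 : Complex.I ^ (k + (2 * k - p)) * (Complex.I ^ (k + (2 * k - p)) *
      ((-1) ^ k * ((1 * (-1) ^ (2 * k - p) : ℝ) : ℂ))) = 1 := by
    push_cast
    rw [← mul_assoc, ← mul_pow, Complex.I_mul_I, one_mul, ← pow_add, ← mul_pow]
    simp
  rw [mul_assoc, h3, one_smul]

theorem gammaM_unitary : γ.gammaMᴴ * γ.gammaM = 1 := by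
  rw [gammaM_eq, Matrix.conjTranspose_smul, Matrix.smul_mul, Matrix.mul_smul, gprod_unitary,
    smul_smul, star_pow, ← mul_pow]
  simp

theorem gammaM_hermitian (hp : p ≤ 2 * k) : γ.gammaMᴴ = γ.gammaM := by
  have h := congrArg (· * γ.gammaM) γ.gammaM_unitary
  simpa only [Matrix.mul_assoc, γ.gammaM_mul_self hp, Matrix.mul_one, Matrix.one_mul] using h

theorem slash_mul_gammaM (hk : 1 ≤ k) (v : Fin (2 * k) → ℝ) :
    γ.slash v * γ.gammaM = - (γ.gammaM * γ.slash v) := by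
  simp only [slash, Matrix.sum_mul, Matrix.mul_sum, Matrix.smul_mul, Matrix.mul_smul,
    γ.gam_mul_gammaM hk, smul_neg, Finset.sum_neg_distrib]

/-- The generators of the spin group are products of two vectors, each of which anticommutes with
γ_M. -/
theorem spin_mul_gammaM (hk : 1 ≤ k) {u : (Matrix (Fin (2 ^ k)) (Fin (2 ^ k)) ℂ)ˣ}
    (hu : u ∈ γ.spin) : (u : Matrix (Fin (2 ^ k)) (Fin (2 ^ k)) ℂ) * γ.gammaM = γ.gammaM * u := by
  change Commute (u : Matrix (Fin (2 ^ k)) (Fin (2 ^ k)) ℂ) γ.gammaM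
  induction hu using Subgroup.closure_induction with
  | mem u hu =>
    obtain ⟨v, w, -, -, h⟩ := hu
    change (u : Matrix (Fin (2 ^ k)) (Fin (2 ^ k)) ℂ) * γ.gammaM = γ.gammaM * u
    rw [h, Matrix.mul_assoc, γ.slash_mul_gammaM hk, Matrix.mul_neg, ← Matrix.mul_assoc,
      γ.slash_mul_gammaM hk, Matrix.neg_mul, neg_neg, Matrix.mul_assoc]
  | one => exact Commute.one_left _
  | mul u v _ _ hu hv => rw [Units.val_mul]; exact hu.mul_left hv
  | inv u _ hu => exact Commute.units_inv_left hu

section Fibre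

variable {N : ℕ}

/-- The action `γ^a ⊗ 1` of the `γ`-matrices on the typical fibre. -/
def gam1 (N : ℕ) (a : Fin (2 * k)) : EndFib k N := γ.gam a ⊗ₖ (1 : Matrix (Fin N) (Fin N) ℂ)

/-- Irreducibility is applied to each block of Ψ with fixed indices in ℂ^N: the block is scalar, and
the scalar is its normalized trace. -/
theorem eq_one_kronecker_of_commute {Ψ : EndFib k N}
    (h : ∀ a, γ.gam1 N a * Ψ = Ψ * γ.gam1 N a) :
    Ψ = (1 : Matrix (Fin (2 ^ k)) (Fin (2 ^ k)) ℂ) ⊗ₖ spinorTrace Ψ := by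
  ext ⟨s, a⟩ ⟨t, b⟩
  set X : Matrix (Fin (2 ^ k)) (Fin (2 ^ k)) ℂ := Matrix.of fun s t => Ψ (s, a) (t, b) with hX
  have hc : ∀ c, γ.gam c * X = X * γ.gam c := by
    intro c
    ext s t
    have h1 := congrFun (congrFun (h c) (s, a)) (t, b)
    simpa [gam1, Matrix.mul_apply, Fintype.sum_prod_type, Matrix.kroneckerMap_apply,
      Matrix.one_apply, hX] using h1
  have h2 := congrFun (congrFun (γ.eq_smul_one_of_commute hc) s) t
  simp only [hX, Matrix.of_apply, Matrix.smul_apply, Matrix.trace, Matrix.diag_apply,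
    smul_eq_mul] at h2
  rw [h2, Matrix.kroneckerMap_apply, spinorTrace, Matrix.of_apply, mul_comm]

/-- The factor `𝒟` of an operator `γ_M ⊗ 𝒟`. -/
def massPart (Φ : EndFib k N) : Matrix (Fin N) (Fin N) ℂ :=
  spinorTrace ((γ.gammaM ⊗ₖ (1 : Matrix (Fin N) (Fin N) ℂ)) * Φ)

theorem massPart_gammaM_kronecker (hp : p ≤ 2 * k) (z : Matrix (Fin N) (Fin N) ℂ) :
    γ.massPart (γ.gammaM ⊗ₖ z) = z := by
  rw [massPart, ← Matrix.mul_kronecker_mul, γ.gammaM_mul_self hp, Matrix.one_mul,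
    spinorTrace_one_kronecker]

/-- Multiplication by γ_M ⊗ 1 turns anticommuting into commuting, and γ_M² = 1 undoes it afterwards.
-/
theorem eq_gammaM_kronecker_of_anticommute (hk : 1 ≤ k) (hp : p ≤ 2 * k) {Φ : EndFib k N}
    (h : ∀ a, γ.gam1 N a * Φ = - (Φ * γ.gam1 N a)) : Φ = γ.gammaM ⊗ₖ γ.massPart Φ := by
  have h1 : ∀ a, γ.gam1 N a * ((γ.gammaM ⊗ₖ (1 : Matrix (Fin N) (Fin N) ℂ)) * Φ)
      = ((γ.gammaM ⊗ₖ (1 : Matrix (Fin N) (Fin N) ℂ)) * Φ) * γ.gam1 N a := by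
    intro a
    have h2 : γ.gam1 N a * (γ.gammaM ⊗ₖ (1 : Matrix (Fin N) (Fin N) ℂ))
        = - ((γ.gammaM ⊗ₖ (1 : Matrix (Fin N) (Fin N) ℂ)) * γ.gam1 N a) := by
      rw [gam1, ← Matrix.mul_kronecker_mul, ← Matrix.mul_kronecker_mul, γ.gam_mul_gammaM hk]
      ext s t
      simp [Matrix.kroneckerMap_apply]
    rw [← Matrix.mul_assoc, h2, Matrix.neg_mul, Matrix.mul_assoc, h, Matrix.mul_neg, neg_neg,
      Matrix.mul_assoc]
  have h3 := congrArg ((γ.gammaM ⊗ₖ (1 : Matrix (Fin N) (Fin N) ℂ)) * ·)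
    (γ.eq_one_kronecker_of_commute h1)
  simp only at h3
  rw [← Matrix.mul_assoc, ← Matrix.mul_kronecker_mul, γ.gammaM_mul_self hp, Matrix.one_mul,
    Matrix.one_kronecker_one, Matrix.one_mul, ← Matrix.mul_kronecker_mul, Matrix.mul_one,
    Matrix.one_mul] at h3
  exact h3

end Fibre

end GammaMatrices

end DiracGauge
end

noncomputable section
namespace DiracGauge

/-! ### The square of a Dirac operator with a Clifford connection. -/

section MulVec

variable {k : ℕ} {m l : Type*} [Fintype m] [Fintype l] {U : Set (Coord k)}

theorem contDiffOn_mulVec {f : Coord k → Matrix m l ℂ} {ψ : Coord k → l → ℂ}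
    (hf : SmoothMatOn f U) (hψ : ContDiffOn ℝ ∞ ψ U) :
    ContDiffOn ℝ ∞ (fun y => f y *ᵥ ψ y) U := by
  rw [contDiffOn_pi]
  intro i
  simp only [Matrix.mulVec, dotProduct]
  exact ContDiffOn.sum fun j _ => (hf i j).mul (contDiffOn_pi.1 hψ j)

theorem pderiv_mulVec (hU : IsOpen U) {f : Coord k → Matrix m l ℂ} {ψ : Coord k → l → ℂ}
    (hf : SmoothMatOn f U) (hψ : ContDiffOn ℝ ∞ ψ U) {x : Coord k} (hx : x ∈ U)
    (μ : Fin (2 * k)) :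
    pderiv (fun y => f y *ᵥ ψ y) μ x = dmat f μ x *ᵥ ψ x + f x *ᵥ pderiv ψ μ x := by
  have hd := differentiableAt_of_contDiffOn hψ hU hx
  have hψd := fun j => differentiableAt_of_contDiffOn (contDiffOn_pi.1 hψ j) hU hx
  have hfd := fun i j => differentiableAt_of_contDiffOn (hf i j) hU hx
  ext i
  rw [pderiv_pi (differentiableAt_of_contDiffOn (contDiffOn_mulVec hf hψ) hU hx)]
  simp only [Matrix.mulVec, dotProduct, Pi.add_apply, ← Finset.sum_add_distrib]
  rw [pderiv_sum _ fun j _ => (hfd i j).fun_mul (hψd j)]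
  refine Finset.sum_congr rfl fun j _ => ?_
  rw [pderiv_mul (hfd i j) (hψd j), pderiv_pi hd]
  rfl

end MulVec

section Frame

variable {k : ℕ} (p : ℕ) {e : Coord k → Matrix (Fin (2 * k)) (Fin (2 * k)) ℝ}
  {U : Set (Coord k)}

theorem eta_mul_self (a : Fin (2 * k)) : eta k p a * eta k p a = 1 := by
  unfold eta; split_ifs <;> norm_num

theorem det_frame_ne_zero {E : Matrix (Fin (2 * k)) (Fin (2 * k)) ℝ} (h : E.det ≠ 0) :
    (E * Matrix.diagonal (eta k p) * Eᵀ).det ≠ 0 := by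
  rw [Matrix.det_mul, Matrix.det_mul, Matrix.det_transpose, Matrix.det_diagonal]
  refine mul_ne_zero (mul_ne_zero h (Finset.prod_ne_zero_iff.2 fun a _ => ?_)) h
  exact left_ne_zero_of_mul_eq_one (eta_mul_self p a)

theorem metricOf_inv {x : Coord k} (h : (e x).det ≠ 0) :
    (metricOf p e x)⁻¹ = e x * Matrix.diagonal (eta k p) * (e x)ᵀ :=
  Matrix.nonsing_inv_nonsing_inv _ (isUnit_iff_ne_zero.2 (det_frame_ne_zero p h))

theorem frame_smooth {X : Type*} [NormedAddCommGroup X] [NormedSpace ℝ X]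
    {e : X → Matrix (Fin (2 * k)) (Fin (2 * k)) ℝ} {U : Set X} (he : SmoothMatOn e U) :
    SmoothMatOn (fun y => e y * Matrix.diagonal (eta k p) * (e y)ᵀ) U :=
  (he.mul (SmoothMatOn.const _)).mul he.transpose

theorem isMetricOn_metricOf (hU : IsOpen U) (he : SmoothMatOn e U)
    (h : ∀ x ∈ U, (e x).det ≠ 0) : IsMetricOn (metricOf p e) U where
  isOpen := hU
  smooth := (frame_smooth p he).inv fun x hx => det_frame_ne_zero p (h x hx)
  symm x _ := by
    rw [metricOf, Matrix.transpose_nonsing_inv]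
    simp [Matrix.mul_assoc]
  det_ne x hx := by
    rw [metricOf, Matrix.det_nonsing_inv, Ring.inverse_eq_inv']
    exact inv_ne_zero (det_frame_ne_zero p (h x hx))

end Frame

namespace GammaMatrices

variable {k p N : ℕ} (γ : GammaMatrices k p)

theorem symbol_eq (e : Coord k → Matrix (Fin (2 * k)) (Fin (2 * k)) ℝ) (μ : Fin (2 * k))
    (x : Coord k) : γ.symbol N e μ x = ∑ a, ((e x μ a : ℝ) : ℂ) • γ.gam1 N a := by
  ext s t
  simp [symbol, slash, gam1, Matrix.kroneckerMap_apply, Matrix.sum_apply, Finset.sum_mul,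
    mul_assoc]

theorem gam1_anticomm (a b : Fin (2 * k)) : γ.gam1 N a * γ.gam1 N b + γ.gam1 N b * γ.gam1 N a
    = ((2 * γ.sgn * Matrix.diagonal (eta k p) a b : ℝ) : ℂ) • 1 := by
  simp only [gam1]
  rw [← Matrix.mul_kronecker_mul, ← Matrix.mul_kronecker_mul, ← Matrix.add_kronecker,
    γ.clifford, Matrix.one_mul]
  split_ifs with h
  · subst h
    rw [Matrix.smul_kronecker, Matrix.one_kronecker_one, Matrix.diagonal_apply_eq]
  · rw [Matrix.zero_kronecker, Matrix.diagonal_apply_ne _ h]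
    simp

theorem symbol_smooth {e : Coord k → Matrix (Fin (2 * k)) (Fin (2 * k)) ℝ} {U : Set (Coord k)}
    (he : SmoothMatOn e U) (μ : Fin (2 * k)) : SmoothMatOn (γ.symbol N e μ) U := by
  rw [funext (γ.symbol_eq e μ)]
  exact SmoothMatOn.sum _ fun a _ =>
    (SmoothMatOn.smul (contDiffOn_ofReal (he μ a)) (SmoothMatOn.const _))

theorem symbol_anticomm (e : Coord k → Matrix (Fin (2 * k)) (Fin (2 * k)) ℝ)
    (x : Coord k) (μ ν : Fin (2 * k)) :
    γ.symbol N e μ x * γ.symbol N e ν x + γ.symbol N e ν x * γ.symbol N e μ x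
      = ((2 * γ.sgn * (e x * Matrix.diagonal (eta k p) * (e x)ᵀ) μ ν : ℝ) : ℂ) • 1 := by
  have h : γ.symbol N e μ x * γ.symbol N e ν x + γ.symbol N e ν x * γ.symbol N e μ x
      = ∑ a, ∑ b, ((e x μ a * e x ν b : ℝ) : ℂ) •
        (γ.gam1 N a * γ.gam1 N b + γ.gam1 N b * γ.gam1 N a) := by
    simp only [symbol_eq, Matrix.sum_mul, Matrix.mul_sum, Matrix.smul_mul, Matrix.mul_smul,
      Finset.smul_sum, smul_smul, smul_add, Finset.sum_add_distrib]
    congr 1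
    · rw [Finset.sum_comm]
      refine Finset.sum_congr rfl fun a _ => Finset.sum_congr rfl fun b _ => ?_
      push_cast
      rw [mul_comm]
    · refine Finset.sum_congr rfl fun a _ => Finset.sum_congr rfl fun b _ => ?_
      push_cast
      rfl
  rw [h]
  simp only [gam1_anticomm, smul_smul, ← Finset.sum_smul, ← Complex.ofReal_mul,
    ← Complex.ofReal_sum]
  congr 2
  rw [Matrix.mul_assoc]
  simp only [Matrix.mul_apply, Matrix.transpose_apply, Finset.mul_sum]
  exact Finset.sum_congr rfl fun a _ => Finset.sum_congr rfl fun b _ => by ring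

/-- A smooth frame together with a smooth Clifford connection on an open set. -/
structure IsCliffordData (γ : GammaMatrices k p) (U : Set (Coord k))
    (e : Coord k → Matrix (Fin (2 * k)) (Fin (2 * k)) ℝ)
    (B : Coord k → Fin (2 * k) → EndFib k N) : Prop where
  isOpen : IsOpen U
  frame_smooth : SmoothMatOn e U
  det_ne : ∀ x ∈ U, (e x).det ≠ 0
  conn_smooth : ∀ μ, SmoothMatOn (fun y => B y μ) U
  clifford : γ.IsCliffordOn U e B

/-- The curvature of the connection `d + B`. -/
def curv (B : Coord k → Fin (2 * k) → EndFib k N) (μ ν : Fin (2 * k)) (x : Coord k) :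
    EndFib k N :=
  dmat (fun y => B y ν) μ x - dmat (fun y => B y μ) ν x + (B x μ * B x ν - B x ν * B x μ)

/-- The covariant derivative of an endomorphism. -/
def covEnd (B : Coord k → Fin (2 * k) → EndFib k N) (Φ : Coord k → EndFib k N)
    (μ : Fin (2 * k)) (x : Coord k) : EndFib k N :=
  dmat Φ μ x + (B x μ * Φ x - Φ x * B x μ)

/-- The zero order part of the square of a Dirac operator. -/
def weitzenboeck (e : Coord k → Matrix (Fin (2 * k)) (Fin (2 * k)) ℝ)
    (B : Coord k → Fin (2 * k) → EndFib k N) (Φ : Coord k → EndFib k N) (x : Coord k) :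
    EndFib k N :=
  (2⁻¹ : ℂ) • (∑ μ, ∑ ν, γ.symbol N e μ x * γ.symbol N e ν x * curv B μ ν x)
    + ∑ μ, γ.symbol N e μ x * covEnd B Φ μ x + Φ x * Φ x

/-- Splitting off the connection turns the operator into the Clifford contraction of ∇ plus Φ, the
form in which it can be squared covariantly. -/
theorem localOp_eq (e : Coord k → Matrix (Fin (2 * k)) (Fin (2 * k)) ℝ)
    (B : Coord k → Fin (2 * k) → EndFib k N) (Φ : Coord k → EndFib k N)
    (ψ : Coord k → Fib k N) (x : Coord k) :
    γ.localOp e (fun y => γ.slashConn e B y + Φ y) ψ x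
      = ∑ μ, γ.symbol N e μ x *ᵥ covDeriv B ψ μ x + Φ x *ᵥ ψ x := by
  simp only [localOp, slashConn, covDeriv, Matrix.mulVec_add, Matrix.add_mulVec,
    Finset.sum_add_distrib, Matrix.sum_mulVec, Matrix.mulVec_mulVec]
  abel

theorem covDeriv_smooth {U : Set (Coord k)} (hU : IsOpen U)
    {B : Coord k → Fin (2 * k) → EndFib k N} (hB : ∀ μ, SmoothMatOn (fun y => B y μ) U)
    {ψ : Coord k → Fib k N} (hψ : ContDiffOn ℝ ∞ ψ U) (μ : Fin (2 * k)) :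
    ContDiffOn ℝ ∞ (covDeriv B ψ μ) U :=
  (contDiffOn_pderiv hU hψ μ).add (contDiffOn_mulVec (hB μ) hψ)

theorem covDeriv_mulVec {U : Set (Coord k)} (hU : IsOpen U)
    (B : Coord k → Fin (2 * k) → EndFib k N) {Z : Coord k → EndFib k N} (hZ : SmoothMatOn Z U)
    {ψ : Coord k → Fib k N} (hψ : ContDiffOn ℝ ∞ ψ U) {x : Coord k} (hx : x ∈ U)
    (μ : Fin (2 * k)) :
    covDeriv B (fun y => Z y *ᵥ ψ y) μ x
      = covEnd B Z μ x *ᵥ ψ x + Z x *ᵥ covDeriv B ψ μ x := by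
  simp only [covDeriv, covEnd, pderiv_mulVec hU hZ hψ hx, Matrix.add_mulVec, Matrix.sub_mulVec,
    Matrix.mulVec_add, Matrix.mulVec_mulVec]
  abel

theorem covDeriv_add {B : Coord k → Fin (2 * k) → EndFib k N} {ψ χ : Coord k → Fib k N}
    {x : Coord k} (hψ : DifferentiableAt ℝ ψ x) (hχ : DifferentiableAt ℝ χ x)
    (μ : Fin (2 * k)) :
    covDeriv B (fun y => ψ y + χ y) μ x = covDeriv B ψ μ x + covDeriv B χ μ x := by
  simp only [covDeriv, pderiv_add hψ hχ, Matrix.mulVec_add]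
  abel

theorem covDeriv_sum {B : Coord k → Fin (2 * k) → EndFib k N} {κ : Type*} (I : Finset κ)
    {ψ : κ → Coord k → Fib k N} {x : Coord k} (hψ : ∀ i ∈ I, DifferentiableAt ℝ (ψ i) x)
    (μ : Fin (2 * k)) :
    covDeriv B (fun y => ∑ i ∈ I, ψ i y) μ x = ∑ i ∈ I, covDeriv B (ψ i) μ x := by
  simp only [covDeriv, pderiv_sum I hψ, Matrix.mulVec_sum, Finset.sum_add_distrib]

theorem covDeriv_covDeriv {U : Set (Coord k)} (hU : IsOpen U)
    {B : Coord k → Fin (2 * k) → EndFib k N} (hB : ∀ μ, SmoothMatOn (fun y => B y μ) U)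
    {ψ : Coord k → Fib k N} (hψ : ContDiffOn ℝ ∞ ψ U) {x : Coord k} (hx : x ∈ U)
    (μ ν : Fin (2 * k)) :
    covDeriv B (covDeriv B ψ ν) μ x = pderiv (pderiv ψ ν) μ x
      + (dmat (fun y => B y ν) μ x *ᵥ ψ x + B x ν *ᵥ pderiv ψ μ x)
      + (B x μ *ᵥ pderiv ψ ν x + (B x μ * B x ν) *ᵥ ψ x) := by
  rw [covDeriv]
  change pderiv (fun y => pderiv ψ ν y + B y ν *ᵥ ψ y) μ x
    + B x μ *ᵥ (pderiv ψ ν x + B x ν *ᵥ ψ x) = _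
  rw [pderiv_add (differentiableAt_of_contDiffOn (contDiffOn_pderiv hU hψ ν) hU hx)
    (differentiableAt_of_contDiffOn (contDiffOn_mulVec (hB ν) hψ) hU hx),
    pderiv_mulVec hU (hB ν) hψ hx, Matrix.mulVec_add, Matrix.mulVec_mulVec]

/-- Second covariant derivatives commute up to curvature. -/
theorem covDeriv_covDeriv_sub {U : Set (Coord k)} (hU : IsOpen U)
    {B : Coord k → Fin (2 * k) → EndFib k N} (hB : ∀ μ, SmoothMatOn (fun y => B y μ) U)
    {ψ : Coord k → Fib k N} (hψ : ContDiffOn ℝ ∞ ψ U) {x : Coord k} (hx : x ∈ U)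
    (μ ν : Fin (2 * k)) :
    covDeriv B (covDeriv B ψ ν) μ x - covDeriv B (covDeriv B ψ μ) ν x
      = curv B μ ν x *ᵥ ψ x := by
  rw [covDeriv_covDeriv hU hB hψ hx, covDeriv_covDeriv hU hB hψ hx, pderiv_comm hU hψ hx ν μ,
    curv]
  simp only [Matrix.add_mulVec, Matrix.sub_mulVec]
  abel

namespace IsCliffordData

variable {γ} {U : Set (Coord k)} {e : Coord k → Matrix (Fin (2 * k)) (Fin (2 * k)) ℝ}
    {B : Coord k → Fin (2 * k) → EndFib k N} (h : γ.IsCliffordData U e B)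

include h

theorem isMetricOn : IsMetricOn (metricOf p e) U :=
  isMetricOn_metricOf p h.isOpen h.frame_smooth h.det_ne

theorem symbol_anticomm {x : Coord k} (hx : x ∈ U) (μ ν : Fin (2 * k)) :
    γ.symbol N e μ x * γ.symbol N e ν x + γ.symbol N e ν x * γ.symbol N e μ x
      = ((2 * γ.sgn * (metricOf p e x)⁻¹ μ ν : ℝ) : ℂ) • 1 := by
  rw [γ.symbol_anticomm, metricOf_inv p (h.det_ne x hx)]

theorem covEnd_symbol {x : Coord k} (hx : x ∈ U) (μ ν : Fin (2 * k)) :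
    covEnd B (γ.symbol N e ν) μ x
      = - ∑ l, ((chrMat (metricOf p e) μ x ν l : ℝ) : ℂ) • γ.symbol N e l x :=
  h.clifford x hx μ ν

/-- The square of a Dirac operator `γ ∘ (d + B) + Φ`. -/
theorem localOp_localOp {Φ : Coord k → EndFib k N} (hΦ : SmoothMatOn Φ U)
    {ψ : Coord k → Fib k N} (hψ : ContDiffOn ℝ ∞ ψ U) {x : Coord k} (hx : x ∈ U) :
    γ.localOp e (fun y => γ.slashConn e B y + Φ y)
        (γ.localOp e (fun y => γ.slashConn e B y + Φ y) ψ) x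
      = γ.bochnerLaplacian e B ψ x
        + ∑ μ, (γ.symbol N e μ x * Φ x + Φ x * γ.symbol N e μ x) *ᵥ covDeriv B ψ μ x
        + γ.weitzenboeck e B Φ x *ᵥ ψ x := by
  have hO := h.isOpen
  have hs : ∀ μ, SmoothMatOn (γ.symbol N e μ) U := γ.symbol_smooth h.frame_smooth
  have hc := covDeriv_smooth hO h.conn_smooth hψ
  have hd : ∀ ν, DifferentiableAt ℝ (fun y => γ.symbol N e ν y *ᵥ covDeriv B ψ ν y) x :=
    fun ν => differentiableAt_of_contDiffOn (contDiffOn_mulVec (hs ν) (hc ν)) hO hx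
  -- The covariant Hessian. Its Levi-Civita correction is symmetric in μ, ν, so its skew part is the
  -- curvature of `B`.
  set H : Fin (2 * k) → Fin (2 * k) → Fib k N := fun μ ν => covDeriv B (covDeriv B ψ ν) μ x
      - ∑ l, christoffel (metricOf p e) l μ ν x • covDeriv B ψ l x with hH
  have hHF : ∀ μ ν, H μ ν - H ν μ = curv B μ ν x *ᵥ ψ x := by
    intro μ ν
    rw [← covDeriv_covDeriv_sub hO h.conn_smooth hψ hx μ ν]
    simp only [hH, fun l => h.isMetricOn.christoffel_symm hx l ν μ]
    abel
  -- By the Clifford property the covariant derivative of the symbol produces Christoffel terms,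
  -- exactly those that complete second derivatives to `H`.
  have h1 : ∀ μ, covDeriv B (γ.localOp e (fun y => γ.slashConn e B y + Φ y) ψ) μ x
      = ∑ ν, γ.symbol N e ν x *ᵥ H μ ν + covEnd B Φ μ x *ᵥ ψ x
        + Φ x *ᵥ covDeriv B ψ μ x := by
    intro μ
    rw [funext (γ.localOp_eq e B Φ ψ), covDeriv_add (DifferentiableAt.fun_sum fun ν _ => hd ν)
      (differentiableAt_of_contDiffOn (contDiffOn_mulVec hΦ hψ) hO hx),
      covDeriv_sum _ fun ν _ => hd ν, covDeriv_mulVec hO B hΦ hψ hx, ← add_assoc]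
    congr 2
    rw [Finset.sum_congr rfl fun ν _ => covDeriv_mulVec hO B (hs ν) (hc ν) hx μ]
    simp only [h.covEnd_symbol hx, hH, Matrix.mulVec_sub, Finset.sum_add_distrib,
      Finset.sum_sub_distrib, Matrix.neg_mulVec, Finset.sum_neg_distrib, Matrix.sum_mulVec,
      Matrix.mulVec_sum]
    rw [Finset.sum_comm, neg_add_eq_sub]
    congr 1
    refine Finset.sum_congr rfl fun ν _ => Finset.sum_congr rfl fun l _ => ?_
    rw [Matrix.smul_mulVec, Matrix.mulVec_smul]
    rfl
  -- The symmetric part of γ^μ γ^ν is ε g^{μν} and gives the Bochner-Laplacian; the skew part sees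
  -- only the curvature.
  have h2 : ∑ μ, ∑ ν, (γ.symbol N e μ x * γ.symbol N e ν x) *ᵥ H μ ν
      = γ.bochnerLaplacian e B ψ x
        + ((2⁻¹ : ℂ) • ∑ μ, ∑ ν, γ.symbol N e μ x * γ.symbol N e ν x * curv B μ ν x) *ᵥ ψ x := by
    have h3 : ∑ μ, ∑ ν, (γ.symbol N e ν x * γ.symbol N e μ x) *ᵥ H μ ν
        = ∑ μ, ∑ ν, (γ.symbol N e μ x * γ.symbol N e ν x) *ᵥ H ν μ := Finset.sum_comm
    have h4 : γ.bochnerLaplacian e B ψ x = (2⁻¹ : ℂ) • ∑ μ, ∑ ν,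
        (γ.symbol N e μ x * γ.symbol N e ν x + γ.symbol N e ν x * γ.symbol N e μ x) *ᵥ H μ ν := by
      simp only [h.symbol_anticomm hx, bochnerLaplacian, Finset.smul_sum, Matrix.smul_mulVec,
        Matrix.one_mulVec]
      refine Finset.sum_congr rfl fun μ _ => Finset.sum_congr rfl fun ν _ => ?_
      rw [smul_smul, smul_smul]
      change (γ.sgn * (metricOf p e x)⁻¹ μ ν) • H μ ν = _
      rw [← Complex.coe_smul]
      congr 1
      push_cast
      ring
    have h5 : (∑ μ, ∑ ν, γ.symbol N e μ x * γ.symbol N e ν x * curv B μ ν x) *ᵥ ψ x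
        = ∑ μ, ∑ ν, (γ.symbol N e μ x * γ.symbol N e ν x) *ᵥ (H μ ν - H ν μ) := by
      simp only [Matrix.sum_mulVec, ← Matrix.mulVec_mulVec, hHF]
    rw [Matrix.smul_mulVec, h4, h5, ← smul_add]
    simp only [Matrix.add_mulVec, Matrix.mulVec_sub, Finset.sum_add_distrib,
      Finset.sum_sub_distrib, h3]
    rw [add_add_sub_cancel, ← two_smul ℂ, smul_smul]
    norm_num
  rw [γ.localOp_eq e B Φ, γ.localOp_eq e B Φ ψ x]
  simp only [h1, weitzenboeck, Matrix.mulVec_add, Matrix.add_mulVec, Matrix.mulVec_sum,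
    Matrix.sum_mulVec, Finset.sum_add_distrib, Matrix.mulVec_mulVec]
  rw [h2, Matrix.smul_mulVec]
  simp only [Matrix.sum_mulVec]
  abel

/-- The curvature of a Clifford connection acts on the Clifford action through the Riemannian
curvature. -/
theorem curv_commutator {x : Coord k} (hx : x ∈ U) (μ ν l : Fin (2 * k)) :
    curv B μ ν x * γ.symbol N e l x - γ.symbol N e l x * curv B μ ν x
      = - ∑ s, ((rieMat (metricOf p e) μ ν x l s : ℝ) : ℂ) • γ.symbol N e s x := by
  have hO := h.isOpen
  have hs : ∀ μ, SmoothMatOn (γ.symbol N e μ) U := γ.symbol_smooth h.frame_smooth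
  have hB := h.conn_smooth
  have hΓ := h.isMetricOn.chrMat_smooth
  set Γ := chrMat (metricOf p e) with hΓdef
  have hΓc : ∀ μ l a, ContDiffOn ℝ ∞ (fun y => ((Γ μ y l a : ℝ) : ℂ)) U :=
    fun μ l a => contDiffOn_ofReal (hΓ μ l a)
  have hd : ∀ y ∈ U, ∀ μ l, dmat (γ.symbol N e l) μ y
      = - (B y μ * γ.symbol N e l y - γ.symbol N e l y * B y μ)
        - ∑ a, ((Γ μ y l a : ℝ) : ℂ) • γ.symbol N e a y := by
    intro y hy μ l
    have := h.covEnd_symbol hy μ l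
    rw [covEnd] at this
    rw [eq_sub_of_add_eq this]
    abel
  set S : Matrix (Fin (2 * k)) (Fin (2 * k)) ℝ → Fin (2 * k) → EndFib k N :=
    fun A l => ∑ a, ((A l a : ℝ) : ℂ) • γ.symbol N e a x with hS
  have hSmul : ∀ (A C : Matrix (Fin (2 * k)) (Fin (2 * k)) ℝ) l,
      ∑ a, ((A l a : ℝ) : ℂ) • S C a = S (A * C) l := by
    intro A C l
    simp only [hS, Finset.smul_sum, smul_smul, Matrix.mul_apply]
    rw [Finset.sum_comm]
    refine Finset.sum_congr rfl fun b _ => ?_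
    rw [← Finset.sum_smul]
    push_cast
    rfl
  -- The symbol is parallel for `B` and Levi-Civita together, so its second derivatives are
  -- expressed through the connections and their first derivatives. Symmetry in μ, ν then balances
  -- the two curvatures.
  have hdd : ∀ μ ν, dmat (dmat (γ.symbol N e l) ν) μ x
      = - (dmat (fun y => B y ν) μ x * γ.symbol N e l x
          + B x ν * (- (B x μ * γ.symbol N e l x - γ.symbol N e l x * B x μ) - S (Γ μ x) l)
          - ((- (B x μ * γ.symbol N e l x - γ.symbol N e l x * B x μ) - S (Γ μ x) l) * B x ν
            + γ.symbol N e l x * dmat (fun y => B y ν) μ x))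
        - (S (dmat (Γ ν) μ x) l - (B x μ * S (Γ ν x) l - S (Γ ν x) l * B x μ)
          - S (Γ ν x * Γ μ x) l) := by
    intro μ ν
    rw [dmat_congr_on hO (fun y hy => hd y hy ν l) hx,
      dmat_sub hO (((hB ν).mul (hs l)).sub ((hs l).mul (hB ν))).neg
        (SmoothMatOn.sum _ fun a _ => SmoothMatOn.smul (hΓc ν l a) (hs a)) hx,
      dmat_neg, dmat_sub hO ((hB ν).mul (hs l)) ((hs l).mul (hB ν)) hx,
      dmat_mul hO (hB ν) (hs l) hx, dmat_mul hO (hs l) (hB ν) hx,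
      dmat_sum hO _ (fun a _ => SmoothMatOn.smul (hΓc ν l a) (hs a)) hx, hd x hx μ l]
    congr 1
    rw [Finset.sum_congr rfl fun a _ => dmat_smul hO (hΓc ν l a) (hs a) hx μ]
    simp only [hd x hx μ, smul_sub, smul_neg, Finset.sum_add_distrib, Finset.sum_sub_distrib,
      Finset.sum_neg_distrib]
    rw [show ∑ a, ((Γ ν x l a : ℝ) : ℂ) • ∑ b, ((Γ μ x a b : ℝ) : ℂ) • γ.symbol N e b x
      = S (Γ ν x * Γ μ x) l from hSmul _ _ _]
    simp only [hS, Matrix.mul_sum, Matrix.sum_mul, Matrix.mul_smul, Matrix.smul_mul]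
    have h6 : ∑ a, pderiv (fun y => ((Γ ν y l a : ℝ) : ℂ)) μ x • γ.symbol N e a x
        = ∑ a, ((dmat (Γ ν) μ x l a : ℝ) : ℂ) • γ.symbol N e a x :=
      Finset.sum_congr rfl fun a _ => by
        rw [pderiv_ofReal (differentiableAt_of_contDiffOn (hΓ ν l a) hO hx)]; rfl
    rw [h6]
    abel
  have hcomm := dmat_comm hO (hs l) hx ν μ
  rw [hdd, hdd] at hcomm
  have hR : ∑ s, ((rieMat (metricOf p e) μ ν x l s : ℝ) : ℂ) • γ.symbol N e s x
      = S (dmat (Γ ν) μ x) l - S (dmat (Γ μ) ν x) l + (S (Γ μ x * Γ ν x) l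
        - S (Γ ν x * Γ μ x) l) := by
    simp only [hS, rieMat, Matrix.add_apply, Matrix.sub_apply, ← hΓdef, Complex.ofReal_add,
      Complex.ofReal_sub, add_smul, sub_smul, Finset.sum_add_distrib, Finset.sum_sub_distrib]
  rw [hR, curv, eq_neg_iff_add_eq_zero, ← sub_eq_zero.2 hcomm.symm]
  noncomm_ring

end IsCliffordData

end GammaMatrices

end DiracGauge
end

noncomputable section
namespace DiracGauge

/-! ### Uniqueness of the Bochner connection and the Dirac potential. -/

section LinearTest

variable {k : ℕ} {V : Type*} [NormedAddCommGroup V] [NormedSpace ℝ V]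

/-- A vector-valued function vanishing at `x` whose only non-zero partial derivative is the one
in the direction `l`. -/
def linearTest (x : Coord k) (l : Fin (2 * k)) (v : V) (y : Coord k) : V := (y l - x l) • v

theorem linearTest_self (x : Coord k) (l : Fin (2 * k)) (v : V) : linearTest x l v x = 0 := by
  simp [linearTest]

theorem contDiff_linearTest (x : Coord k) (l : Fin (2 * k)) (v : V) :
    ContDiff ℝ ∞ (linearTest x l v) := by
  unfold linearTest
  fun_prop

theorem pderiv_linearTest (x : Coord k) (l : Fin (2 * k)) (v : V) (μ : Fin (2 * k)) :
    pderiv (linearTest x l v) μ = fun _ => if μ = l then v else 0 := by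
  funext y
  have h : HasFDerivAt (linearTest x l v)
      ((EuclideanSpace.proj l : Coord k →L[ℝ] ℝ).smulRight v) y :=
    ((EuclideanSpace.proj l : Coord k →L[ℝ] ℝ).hasFDerivAt.sub_const (x l)).smul_const v
  rw [pderiv, h.fderiv]
  simp [eq_comm]

end LinearTest

namespace GammaMatrices

variable {k p N : ℕ} (γ : GammaMatrices k p)

/-- Because the frame is invertible, (anti)commuting with the symbols amounts to (anti)commuting
with the fixed γ^a. The latter condition does not refer to the frame, which is what allows the frame
to be varied later with Φ fixed. -/
theorem gam1_eq {e : Coord k → Matrix (Fin (2 * k)) (Fin (2 * k)) ℝ} {x : Coord k}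
    (h : (e x).det ≠ 0) (a : Fin (2 * k)) :
    γ.gam1 N a = ∑ μ, (((e x)⁻¹ a μ : ℝ) : ℂ) • γ.symbol N e μ x := by
  simp only [symbol_eq, Finset.smul_sum, smul_smul, ← Complex.ofReal_mul]
  rw [Finset.sum_comm]
  simp only [← Finset.sum_smul, ← Complex.ofReal_sum, ← Matrix.mul_apply]
  rw [Matrix.nonsing_inv_mul _ (isUnit_iff_ne_zero.2 h)]
  simp [Matrix.one_apply]

theorem symbol_anticommute_of_gam1 {Φ : EndFib k N}
    (h : ∀ a, γ.gam1 N a * Φ = - (Φ * γ.gam1 N a))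
    (e : Coord k → Matrix (Fin (2 * k)) (Fin (2 * k)) ℝ) (x : Coord k) (μ : Fin (2 * k)) :
    γ.symbol N e μ x * Φ + Φ * γ.symbol N e μ x = 0 := by
  rw [symbol_eq, Matrix.sum_mul, Matrix.mul_sum, ← Finset.sum_add_distrib]
  exact Finset.sum_eq_zero fun a _ => by simp [h a]

theorem gam1_anticommute_of_symbol {e : Coord k → Matrix (Fin (2 * k)) (Fin (2 * k)) ℝ}
    {x : Coord k} (hd : (e x).det ≠ 0) {Φ : EndFib k N}
    (h : ∀ μ, γ.symbol N e μ x * Φ + Φ * γ.symbol N e μ x = 0) (a : Fin (2 * k)) :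
    γ.gam1 N a * Φ = - (Φ * γ.gam1 N a) := by
  rw [eq_neg_iff_add_eq_zero, γ.gam1_eq hd, Matrix.sum_mul, Matrix.mul_sum,
    ← Finset.sum_add_distrib]
  exact Finset.sum_eq_zero fun μ _ => by
    rw [Matrix.smul_mul, Matrix.mul_smul, ← smul_add, h, smul_zero]

theorem gam1_commute_of_symbol {e : Coord k → Matrix (Fin (2 * k)) (Fin (2 * k)) ℝ}
    {x : Coord k} (hd : (e x).det ≠ 0) {Ψ : EndFib k N}
    (h : ∀ μ, γ.symbol N e μ x * Ψ = Ψ * γ.symbol N e μ x) (a : Fin (2 * k)) :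
    γ.gam1 N a * Ψ = Ψ * γ.gam1 N a := by
  rw [γ.gam1_eq hd, Matrix.sum_mul, Matrix.mul_sum]
  exact Finset.sum_congr rfl fun μ _ => by rw [Matrix.smul_mul, Matrix.mul_smul, h]

theorem symbol_commute_of_gam1 {Ψ : EndFib k N}
    (h : ∀ a, γ.gam1 N a * Ψ = Ψ * γ.gam1 N a)
    (e : Coord k → Matrix (Fin (2 * k)) (Fin (2 * k)) ℝ) (x : Coord k) (μ : Fin (2 * k)) :
    γ.symbol N e μ x * Ψ = Ψ * γ.symbol N e μ x := by
  rw [symbol_eq, Matrix.sum_mul, Matrix.mul_sum]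
  exact Finset.sum_congr rfl fun a _ => by rw [Matrix.smul_mul, Matrix.mul_smul, h]

theorem covEnd_mul {U : Set (Coord k)} (hU : IsOpen U)
    (B : Coord k → Fin (2 * k) → EndFib k N) {Y Z : Coord k → EndFib k N}
    (hY : SmoothMatOn Y U) (hZ : SmoothMatOn Z U) {x : Coord k} (hx : x ∈ U)
    (μ : Fin (2 * k)) :
    covEnd B (fun y => Y y * Z y) μ x = covEnd B Y μ x * Z x + Y x * covEnd B Z μ x := by
  simp only [covEnd, dmat_mul hU hY hZ hx]
  noncomm_ring

theorem covEnd_add {U : Set (Coord k)} (hU : IsOpen U)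
    (B : Coord k → Fin (2 * k) → EndFib k N) {Y Z : Coord k → EndFib k N}
    (hY : SmoothMatOn Y U) (hZ : SmoothMatOn Z U) {x : Coord k} (hx : x ∈ U)
    (μ : Fin (2 * k)) :
    covEnd B (fun y => Y y + Z y) μ x = covEnd B Y μ x + covEnd B Z μ x := by
  simp only [covEnd, dmat_add hU hY hZ hx]
  noncomm_ring

/-- A test function vanishing at `x` isolates the first order part of the Laplacian, from which the
connection can be recovered. -/
theorem bochnerLaplacian_linearTest {U : Set (Coord k)} (hU : IsOpen U)
    {e : Coord k → Matrix (Fin (2 * k)) (Fin (2 * k)) ℝ}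
    {B : Coord k → Fin (2 * k) → EndFib k N} (hB : ∀ μ, SmoothMatOn (fun y => B y μ) U)
    {x : Coord k} (hx : x ∈ U) (hsymm : ((metricOf p e x)⁻¹)ᵀ = (metricOf p e x)⁻¹)
    (l : Fin (2 * k)) (v : Fib k N) :
    γ.bochnerLaplacian e B (linearTest x l v) x
      = γ.sgn • ((2 : ℝ) • ∑ ν, (metricOf p e x)⁻¹ l ν • (B x ν *ᵥ v)
        - ∑ μ, ∑ ν, ((metricOf p e x)⁻¹ μ ν * christoffel (metricOf p e) l μ ν x) • v) := by
  have hψ : ContDiffOn ℝ ∞ (linearTest x l v) U := (contDiff_linearTest x l v).contDiffOn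
  simp only [bochnerLaplacian]
  congr 1
  simp only [covDeriv_covDeriv hU hB hψ hx]
  simp only [covDeriv, linearTest_self, Matrix.mulVec_zero,
    pderiv_linearTest, pderiv_const, zero_add, add_zero, smul_sub, smul_add,
    Finset.sum_sub_distrib, Finset.sum_add_distrib]
  congr 1
  · rw [two_smul]
    congr 1
    · rw [Finset.sum_eq_single l]
      · simp
      · intro μ _ hμ; simp [hμ]
      · simp
    · refine Finset.sum_congr rfl fun μ _ => ?_
      rw [Finset.sum_eq_single l]
      · simp only [if_true]
        rw [← Matrix.transpose_apply (metricOf p e x)⁻¹, hsymm]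
      · intro ν _ hν; simp [hν]
      · simp
  · refine Finset.sum_congr rfl fun μ _ => Finset.sum_congr rfl fun ν _ => ?_
    rw [Finset.sum_eq_single l]
    · simp [smul_smul]
    · intro a _ ha; simp [ha]
    · simp

/-- The connection and the zero order part in the decomposition `D² = Δ_B + Q` are unique. -/
theorem IsLichnerowicz.unique {U : Set (Coord k)}
    {e : Coord k → Matrix (Fin (2 * k)) (Fin (2 * k)) ℝ} (hg : IsMetricOn (metricOf p e) U)
    {b : Coord k → EndFib k N}
    {B B' : Coord k → Fin (2 * k) → EndFib k N} {Q Q' : Coord k → EndFib k N}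
    (hB : ∀ μ, SmoothMatOn (fun y => B y μ) U) (hB' : ∀ μ, SmoothMatOn (fun y => B' y μ) U)
    (h : γ.IsLichnerowicz U e b B Q) (h' : γ.IsLichnerowicz U e b B' Q') {x : Coord k}
    (hx : x ∈ U) : Q x = Q' x := by
  have hU := hg.isOpen
  have hs0 : γ.sgn ≠ 0 := left_ne_zero_of_mul_eq_one γ.sgn_mul_sgn
  have hBB : ∀ y ∈ U, B y = B' y := by
    intro y hy
    have h1 : ∀ l (v : Fib k N), ∑ ν, (metricOf p e y)⁻¹ l ν • (B y ν *ᵥ v - B' y ν *ᵥ v) = 0 := by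
      intro l v
      have h2 := h _ (contDiff_linearTest y l v).contDiffOn y hy
      rw [h' _ (contDiff_linearTest y l v).contDiffOn y hy, linearTest_self, Matrix.mulVec_zero,
        Matrix.mulVec_zero, add_zero, add_zero,
        γ.bochnerLaplacian_linearTest hU hB hy (hg.inv_symm hy),
        γ.bochnerLaplacian_linearTest hU hB' hy (hg.inv_symm hy)] at h2
      have h3 := smul_right_injective _ (two_ne_zero' ℝ)
        (sub_left_injective (smul_right_injective _ hs0 h2))
      simp only [smul_sub, Finset.sum_sub_distrib]
      exact sub_eq_zero.2 h3.symm
    funext κ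
    refine Matrix.ext_of_mulVec_single fun j => ?_
    set v : Fib k N := Pi.single j 1
    -- Contraction with g undoes g⁻¹ and isolates the component κ of `B - B'`.
    have h4 : ∑ l, metricOf p e y κ l •
        ∑ ν, (metricOf p e y)⁻¹ l ν • (B y ν *ᵥ v - B' y ν *ᵥ v) = 0 :=
      Finset.sum_eq_zero fun l _ => by rw [h1, smul_zero]
    simp only [Finset.smul_sum, smul_smul] at h4
    rw [Finset.sum_comm] at h4
    simp only [← Finset.sum_smul, ← Matrix.mul_apply, hg.mul_inv hy, Matrix.one_apply, ite_smul,
      one_smul, zero_smul, Finset.sum_ite_eq, Finset.mem_univ, if_true] at h4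
    exact sub_eq_zero.1 h4
  refine Matrix.ext_of_mulVec_single fun j => ?_
  set v : Fib k N := Pi.single j 1
  -- The connections agree on all of `U`, hence so do their derivatives, and a constant function now
  -- compares the zero order parts.
  have hv : ContDiffOn ℝ ∞ (fun _ : Coord k => v) U := contDiffOn_const
  have h2 := h _ hv x hx
  rw [h' _ hv x hx] at h2
  have h3 : γ.bochnerLaplacian e B' (fun _ => v) x = γ.bochnerLaplacian e B (fun _ => v) x := by
    simp only [bochnerLaplacian, covDeriv_covDeriv hU hB hv hx, covDeriv_covDeriv hU hB' hv hx]
    simp only [covDeriv, hBB x hx, fun ν μ => dmat_congr_on hU (f := fun y => B y ν)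
        (g := fun y => B' y ν) (fun y hy => by rw [hBB y hy]) hx μ]
  rw [h3] at h2
  exact (add_left_cancel h2).symm

namespace IsCliffordData

variable {γ} {U : Set (Coord k)} {e : Coord k → Matrix (Fin (2 * k)) (Fin (2 * k)) ℝ}
    {B : Coord k → Fin (2 * k) → EndFib k N} (h : γ.IsCliffordData U e B)

include h

/-- If the connection of the Bochner-Laplacian of `γ ∘ (d + B) + Φ` is `B`, then `Φ`
anticommutes with the Clifford action. -/
theorem anticommute_of_isLichnerowicz {Φ Q : Coord k → EndFib k N} (hΦ : SmoothMatOn Φ U)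
    (hL : γ.IsLichnerowicz U e (fun y => γ.slashConn e B y + Φ y) B Q) {x : Coord k}
    (hx : x ∈ U) (a : Fin (2 * k)) : γ.gam1 N a * Φ x = - (Φ x * γ.gam1 N a) := by
  refine γ.gam1_anticommute_of_symbol (h.det_ne x hx) (fun l => ?_) a
  refine Matrix.ext_of_mulVec_single fun j => ?_
  set v : Fib k N := Pi.single j 1
  have hψ : ContDiffOn ℝ ∞ (linearTest x l v) U := (contDiff_linearTest x l v).contDiffOn
  -- At a zero of the test function the zero order terms drop out and the Laplacians cancel; only
  -- (γ^l Φ + Φ γ^l) v survives.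
  have h1 := hL _ hψ x hx
  rw [h.localOp_localOp hΦ hψ hx, linearTest_self, Matrix.mulVec_zero, Matrix.mulVec_zero,
    add_zero, add_zero, add_eq_left] at h1
  simp only [covDeriv, linearTest_self, Matrix.mulVec_zero, add_zero, pderiv_linearTest] at h1
  rw [Finset.sum_eq_single l (fun μ _ hμ => by simp [hμ]) (by simp), if_pos rfl] at h1
  rw [h1, Matrix.zero_mulVec]

theorem isLichnerowicz {Φ : Coord k → EndFib k N} (hΦ : SmoothMatOn Φ U)
    (hanti : ∀ x ∈ U, ∀ a, γ.gam1 N a * Φ x = - (Φ x * γ.gam1 N a)) :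
    γ.IsLichnerowicz U e (fun y => γ.slashConn e B y + Φ y) B (γ.weitzenboeck e B Φ) := by
  intro ψ hψ x hx
  rw [h.localOp_localOp hΦ hψ hx]
  simp only [γ.symbol_anticommute_of_gam1 (hanti x hx), Matrix.zero_mulVec, Finset.sum_const_zero,
    add_zero]

theorem trace_symbol_mul {x : Coord k} (hx : x ∈ U) (μ ν : Fin (2 * k)) :
    (γ.symbol N e μ x * γ.symbol N e ν x).trace
      = ((γ.sgn * (metricOf p e x)⁻¹ μ ν * (2 ^ k * N) : ℝ) : ℂ) := by
  have h1 := congrArg Matrix.trace (h.symbol_anticomm hx μ ν)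
  rw [Matrix.trace_add, Matrix.trace_mul_comm (γ.symbol N e ν x), Matrix.trace_smul,
    Matrix.trace_one, Fintype.card_prod, Fintype.card_fin, Fintype.card_fin, ← two_mul] at h1
  have h2 : (2 : ℂ) * (γ.symbol N e μ x * γ.symbol N e ν x).trace
      = 2 * ((γ.sgn * (metricOf p e x)⁻¹ μ ν * (2 ^ k * N) : ℝ) : ℂ) := by
    rw [h1]; push_cast; simp only [smul_eq_mul]; ring
  exact mul_left_cancel₀ two_ne_zero h2

/-- The trace of the Clifford-contracted curvature is the scalar curvature. -/
theorem trace_symbol_symbol_curv {x : Coord k} (hx : x ∈ U) :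
    2 * ∑ μ, ∑ ν, (γ.symbol N e μ x * γ.symbol N e ν x * curv B μ ν x).trace
      = ((- (γ.sgn * (2 ^ k * N) * scalarCurvature (metricOf p e) x) : ℝ) : ℂ) := by
  have hc : ∀ μ ν, curv B ν μ x = - curv B μ ν x := fun μ ν => by simp only [curv]; abel
  set T := ∑ μ, ∑ ν, (γ.symbol N e μ x * γ.symbol N e ν x * curv B μ ν x).trace with hT
  -- One symbol is moved past the curvature and around the trace. The commutator leaves a Riemann
  -- term, and the rest is −T by skewness in μ, ν.
  have h1 : T = ∑ μ, ∑ ν, (γ.symbol N e ν x * γ.symbol N e μ x * curv B μ ν x).trace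
      + ∑ μ, ∑ ν, ∑ s, ((rieMat (metricOf p e) μ ν x ν s : ℝ) : ℂ)
        * (γ.symbol N e μ x * γ.symbol N e s x).trace := by
    rw [hT, ← Finset.sum_add_distrib]
    refine Finset.sum_congr rfl fun μ _ => ?_
    rw [← Finset.sum_add_distrib]
    refine Finset.sum_congr rfl fun ν _ => ?_
    have h2 := h.curv_commutator hx μ ν ν
    have h3 : γ.symbol N e ν x * curv B μ ν x = curv B μ ν x * γ.symbol N e ν x
        + ∑ s, ((rieMat (metricOf p e) μ ν x ν s : ℝ) : ℂ) • γ.symbol N e s x := by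
      rw [← sub_eq_iff_eq_add', ← neg_inj, neg_sub, h2]
    rw [Matrix.mul_assoc, h3, Matrix.mul_add, Matrix.trace_add, ← Matrix.mul_assoc,
      Matrix.trace_mul_comm, ← Matrix.mul_assoc, Matrix.mul_sum, Matrix.trace_sum]
    simp only [Matrix.mul_smul, Matrix.trace_smul, smul_eq_mul]
  have h2 : ∑ μ, ∑ ν, (γ.symbol N e ν x * γ.symbol N e μ x * curv B μ ν x).trace = - T := by
    rw [Finset.sum_comm, hT, ← Finset.sum_neg_distrib]
    refine Finset.sum_congr rfl fun μ _ => ?_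
    rw [← Finset.sum_neg_distrib]
    exact Finset.sum_congr rfl fun ν _ => by rw [hc μ ν, Matrix.mul_neg, Matrix.trace_neg]
  have h3 : ∑ μ, ∑ ν, ∑ s, ((rieMat (metricOf p e) μ ν x ν s : ℝ) : ℂ)
        * (γ.symbol N e μ x * γ.symbol N e s x).trace
      = ((- (γ.sgn * (2 ^ k * N) * scalarCurvature (metricOf p e) x) : ℝ) : ℂ) := by
    simp only [h.trace_symbol_mul hx, ← Complex.ofReal_mul, ← Complex.ofReal_sum]
    congr 1
    have hsw : scalarCurvature (metricOf p e) x
        = ∑ ν, ∑ s, (metricOf p e x)⁻¹ s ν * ricci (metricOf p e) x s ν := Finset.sum_comm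
    rw [hsw, Finset.mul_sum, ← Finset.sum_neg_distrib]
    refine Finset.sum_congr rfl fun μ _ => ?_
    rw [Finset.sum_comm, Finset.mul_sum, ← Finset.sum_neg_distrib]
    refine Finset.sum_congr rfl fun s _ => ?_
    rw [← Finset.sum_mul, ricci_apply, ← Matrix.transpose_apply (metricOf p e x)⁻¹,
      h.isMetricOn.inv_symm hx]
    simp only [fun ν => rieMat_antisymm (metricOf p e) ν μ x, Matrix.neg_apply,
      Finset.sum_neg_distrib]
    ring
  rw [h2, h3] at h1
  rw [two_mul]
  nth_rewrite 2 [h1]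
  ring

/-- Differentiate γ^μ Φ + Φ γ^μ = 0 covariantly. As ∇γ^μ is a combination of symbols, which
anticommute with Φ, the symbol also anticommutes with ∇Φ, and the product is traceless. -/
theorem trace_symbol_covEnd {Φ : Coord k → EndFib k N} (hΦ : SmoothMatOn Φ U)
    (hanti : ∀ x ∈ U, ∀ a, γ.gam1 N a * Φ x = - (Φ x * γ.gam1 N a)) {x : Coord k} (hx : x ∈ U)
    (μ : Fin (2 * k)) : (γ.symbol N e μ x * covEnd B Φ μ x).trace = 0 := by
  have hs := γ.symbol_smooth (N := N) h.frame_smooth μ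
  have h1 : covEnd B (fun y => γ.symbol N e μ y * Φ y + Φ y * γ.symbol N e μ y) μ x = 0 := by
    rw [covEnd, dmat_congr_on h.isOpen (g := fun _ => 0)
      (fun y hy => γ.symbol_anticommute_of_gam1 (hanti y hy) e y μ) hx, dmat_const,
      γ.symbol_anticommute_of_gam1 (hanti x hx) e x μ]
    simp
  rw [covEnd_add h.isOpen B (hs.mul hΦ) (hΦ.mul hs) hx, covEnd_mul h.isOpen B hs hΦ hx,
    covEnd_mul h.isOpen B hΦ hs hx, h.covEnd_symbol hx] at h1
  have h2 : (-∑ l, ((chrMat (metricOf p e) μ x μ l : ℝ) : ℂ) • γ.symbol N e l x) * Φ x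
      + Φ x * (-∑ l, ((chrMat (metricOf p e) μ x μ l : ℝ) : ℂ) • γ.symbol N e l x) = 0 := by
    rw [Matrix.neg_mul, Matrix.mul_neg, ← neg_add, Matrix.sum_mul, Matrix.mul_sum,
      ← Finset.sum_add_distrib, neg_eq_zero]
    exact Finset.sum_eq_zero fun l _ => by
      rw [Matrix.smul_mul, Matrix.mul_smul, ← smul_add,
        γ.symbol_anticommute_of_gam1 (hanti x hx), smul_zero]
  have h3 : γ.symbol N e μ x * covEnd B Φ μ x + covEnd B Φ μ x * γ.symbol N e μ x = 0 := by
    rw [← sub_eq_zero.2 (h1.trans h2.symm)]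
    abel
  have h4 := congrArg Matrix.trace h3
  rw [Matrix.trace_add, Matrix.trace_mul_comm (covEnd B Φ μ x), Matrix.trace_zero,
    ← two_mul] at h4
  exact (mul_eq_zero.1 h4).resolve_left two_ne_zero

/-- The Dirac potential of `γ ∘ (d + B) + Φ`. -/
theorem diracPotential_eq {Φ : Coord k → EndFib k N} (hΦ : SmoothMatOn Φ U)
    (hanti : ∀ x ∈ U, ∀ a, γ.gam1 N a * Φ x = - (Φ x * γ.gam1 N a)) {x : Coord k}
    (hx : x ∈ U) :
    γ.diracPotential U e (fun y => γ.slashConn e B y + Φ y) x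
      = ((- (γ.sgn * (2 ^ k * N) / 4 * scalarCurvature (metricOf p e) x) : ℝ) : ℂ)
        + (Φ x * Φ x).trace := by
  have hex : ∃ Q : Coord k → EndFib k N, ∃ B' : Coord k → Fin (2 * k) → EndFib k N,
      (∀ μ, SmoothMatOn (fun y => B' y μ) U)
        ∧ γ.IsLichnerowicz U e (fun y => γ.slashConn e B y + Φ y) B' Q :=
    ⟨_, B, h.conn_smooth, h.isLichnerowicz hΦ hanti⟩
  rw [diracPotential, dif_pos hex]
  -- The potential is defined by an arbitrarily chosen decomposition; uniqueness identifies its zero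
  -- order part with `weitzenboeck`.
  obtain ⟨B', hB', hL⟩ := hex.choose_spec
  rw [IsLichnerowicz.unique γ h.isMetricOn hB' h.conn_smooth hL (h.isLichnerowicz hΦ hanti) hx,
    weitzenboeck, Matrix.trace_add, Matrix.trace_add, Matrix.trace_smul]
  simp only [Matrix.trace_sum, h.trace_symbol_covEnd hΦ hanti hx, Finset.sum_const_zero, add_zero]
  congr 1
  -- The factor 1/4 is the 1/2 in `weitzenboeck` times the 1/2 from this doubled sum.
  have h1 := h.trace_symbol_symbol_curv hx
  rw [← mul_right_inj' (two_ne_zero' ℂ), smul_eq_mul, ← mul_assoc, mul_inv_cancel₀ two_ne_zero,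
    one_mul, ← mul_right_inj' (two_ne_zero' ℂ), h1]
  push_cast
  ring

end IsCliffordData

end GammaMatrices

end DiracGauge
end

noncomputable section
namespace DiracGauge

/-! ### Volume density and spin connection of a frame. -/

section Determinant

variable {n : Type*} [Fintype n] [DecidableEq n]

theorem hasDerivAt_det_one_add_smul (m : Matrix n n ℝ) :
    HasDerivAt (fun s : ℝ => (1 + s • m).det) m.trace 0 := by
  rw [funext fun s : ℝ => Matrix.det_one_add_smul s m]
  have h := ((hasDerivAt_const (0 : ℝ) (1 : ℝ)).add
    ((hasDerivAt_id (0 : ℝ)).const_mul m.trace)).add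
    (((Polynomial.hasDerivAt (((1 : Matrix n n (Polynomial ℝ))
      + (Polynomial.X : Polynomial ℝ) • m.map Polynomial.C).det.divX.divX) (0 : ℝ)).mul
      (hasDerivAt_pow 2 (0 : ℝ))))
  exact h.congr_deriv (by simp)

/-- Jacobi's formula for the derivative of the determinant. -/
theorem pderiv_det {k : ℕ} {U : Set (Coord k)} (hU : IsOpen U) {e : Coord k → Matrix n n ℝ}
    (he : SmoothMatOn e U) {x : Coord k} (hx : x ∈ U) (h : (e x).det ≠ 0) (μ : Fin (2 * k)) :
    pderiv (fun y => (e y).det) μ x = (e x).det * ((e x)⁻¹ * dmat e μ x).trace := by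
  set F : (n → n → ℝ) → ℝ := fun Z => (Matrix.of Z).det with hF
  have hFd : Differentiable ℝ F := by
    simp only [hF, Matrix.det_apply, Matrix.of_apply]
    fun_prop
  set I : n → n → ℝ := fun i j => (1 : Matrix n n ℝ) i j with hI
  have hF1 : ∀ Y : n → n → ℝ, fderiv ℝ F I Y = (Matrix.of Y).trace := by
    intro Y
    have h1 : HasDerivAt (fun s : ℝ => I + s • Y) Y 0 := by
      have := ((hasDerivAt_id (0 : ℝ)).smul_const Y).const_add I
      simpa using this
    have h2 : HasFDerivAt F (fderiv ℝ F I) (I + (0 : ℝ) • Y) := by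
      rw [zero_smul, add_zero]
      exact (hFd _).hasFDerivAt
    exact (h2.comp_hasDerivAt (0 : ℝ) h1).unique (hasDerivAt_det_one_add_smul (Matrix.of Y))
  -- Factoring out e(x) moves the computation to the identity matrix, where the derivative of the
  -- determinant is the trace.
  set A : Coord k → n → n → ℝ := fun y => (e x)⁻¹ * e y with hA
  have hAs : SmoothMatOn (fun y => (e x)⁻¹ * e y) U := (SmoothMatOn.const _).mul he
  have hAd : DifferentiableAt ℝ A x := by
    rw [differentiableAt_pi]
    intro i
    rw [differentiableAt_pi]
    intro j
    exact differentiableAt_of_contDiffOn (hAs i j) hU hx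
  have hA1 : A x = I := Matrix.nonsing_inv_mul _ (isUnit_iff_ne_zero.2 h)
  have hdet : ∀ y, (e y).det = (e x).det * F (A y) := by
    intro y
    change _ = (e x).det * ((e x)⁻¹ * e y).det
    rw [← Matrix.det_mul, ← Matrix.mul_assoc, Matrix.mul_nonsing_inv _ (isUnit_iff_ne_zero.2 h),
      Matrix.one_mul]
  have hcomp : pderiv (fun y => F (A y)) μ x = (Matrix.of (pderiv A μ x)).trace := by
    rw [← hF1, ← hA1]
    have := (hFd (A x)).hasFDerivAt.comp x hAd.hasFDerivAt
    rw [pderiv, show (fun y => F (A y)) = F ∘ A from rfl, this.fderiv]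
    rfl
  have hdA : Matrix.of (pderiv A μ x) = (e x)⁻¹ * dmat e μ x := by
    have h3 := dmat_mul hU (SmoothMatOn.const (e x)⁻¹) he hx μ
    rw [dmat_const, Matrix.zero_mul, zero_add] at h3
    rw [← h3]
    ext i j
    rw [Matrix.of_apply, pderiv_pi hAd, pderiv_pi (differentiableAt_pi.1 hAd i)]
    rfl
  rw [funext hdet, pderiv_mul (differentiableAt_const _) (g := fun y => F (A y))
    ((hFd _).comp x hAd), pderiv_const,
    zero_mul, zero_add, hcomp, hdA]

end Determinant

section SpinConnection

variable {k : ℕ} (p : ℕ)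

/-- The connection coefficients of the Levi-Civita connection in the frame `e`. -/
def frameConn (e : Coord k → Matrix (Fin (2 * k)) (Fin (2 * k)) ℝ) (μ : Fin (2 * k))
    (x : Coord k) : Matrix (Fin (2 * k)) (Fin (2 * k)) ℝ :=
  - ((e x)⁻¹ * (dmat e μ x + chrMat (metricOf p e) μ x * e x))

section

variable {p} {e : Coord k → Matrix (Fin (2 * k)) (Fin (2 * k)) ℝ} {U : Set (Coord k)}
  (hU : IsOpen U) (he : SmoothMatOn e U) (hdet : ∀ x ∈ U, (e x).det ≠ 0)

theorem mul_frameConn {x : Coord k} (h : (e x).det ≠ 0) (μ : Fin (2 * k)) :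
    e x * frameConn p e μ x = - (dmat e μ x + chrMat (metricOf p e) μ x * e x) := by
  rw [frameConn, Matrix.mul_neg, ← Matrix.mul_assoc,
    Matrix.mul_nonsing_inv _ (isUnit_iff_ne_zero.2 h), Matrix.one_mul]

include hU he hdet

/-- Differentiating g⁻¹ = e η eᵀ and using ∇g⁻¹ = 0 puts the frame connection in the Lie algebra of
O(p,q). -/
theorem frameConn_skew {x : Coord k} (hx : x ∈ U) (μ : Fin (2 * k)) :
    frameConn p e μ x * Matrix.diagonal (eta k p)
      + Matrix.diagonal (eta k p) * (frameConn p e μ x)ᵀ = 0 := by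
  have hg := isMetricOn_metricOf p hU he hdet
  have hinv : ∀ y ∈ U, (metricOf p e y)⁻¹ = e y * Matrix.diagonal (eta k p) * (e y)ᵀ :=
    fun y hy => metricOf_inv p (hdet y hy)
  have h1 := hg.dmat_inv hx μ
  rw [dmat_congr_on hU hinv hx,
    dmat_mul hU (he.mul (SmoothMatOn.const _)) he.transpose hx,
    dmat_mul hU he (SmoothMatOn.const _) hx, dmat_const, dmat_transpose, Matrix.mul_zero,
    add_zero, hinv x hx] at h1
  have hu : IsUnit (e x).det := isUnit_iff_ne_zero.2 (hdet x hx)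
  have h2 : e x * (frameConn p e μ x * Matrix.diagonal (eta k p)
      + Matrix.diagonal (eta k p) * (frameConn p e μ x)ᵀ) * (e x)ᵀ = 0 := by
    have h3 : e x * (frameConn p e μ x * Matrix.diagonal (eta k p)
        + Matrix.diagonal (eta k p) * (frameConn p e μ x)ᵀ) * (e x)ᵀ
        = (e x * frameConn p e μ x) * Matrix.diagonal (eta k p) * (e x)ᵀ
          + e x * Matrix.diagonal (eta k p) * (e x * frameConn p e μ x)ᵀ := by
      rw [Matrix.transpose_mul]
      noncomm_ring
    rw [h3, mul_frameConn (hdet x hx), Matrix.transpose_neg, Matrix.transpose_add,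
      Matrix.transpose_mul, ← sub_eq_zero.2 h1.symm]
    noncomm_ring
  have h4 := congrArg (fun Z => (e x)⁻¹ * Z * ((e x)ᵀ)⁻¹) h2
  simp only [Matrix.mul_zero, Matrix.zero_mul] at h4
  rw [← h4, Matrix.mul_assoc (e x), ← Matrix.mul_assoc (e x)⁻¹, Matrix.nonsing_inv_mul _ hu,
    Matrix.one_mul, Matrix.mul_assoc,
    Matrix.mul_nonsing_inv _ (by rwa [Matrix.det_transpose]), Matrix.mul_one]

theorem trace_frameConn {x : Coord k} (hx : x ∈ U) (μ : Fin (2 * k)) :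
    (frameConn p e μ x).trace = 0 := by
  have h := congrArg (fun Z => (Z * Matrix.diagonal (eta k p)).trace)
    (frameConn_skew (p := p) hU he hdet hx μ)
  have hη : Matrix.diagonal (eta k p) * Matrix.diagonal (eta k p) = 1 := by
    rw [Matrix.diagonal_mul_diagonal]
    simp [eta_mul_self]
  simp only [Matrix.add_mul, Matrix.trace_add, Matrix.zero_mul, Matrix.trace_zero] at h
  rw [Matrix.mul_assoc, hη, Matrix.mul_one, Matrix.trace_mul_comm, ← Matrix.mul_assoc, hη,
    Matrix.one_mul, Matrix.trace_transpose] at h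
  linarith

/-- The derivative of the volume density. -/
theorem pderiv_abs_det_inv {x : Coord k} (hx : x ∈ U) (μ : Fin (2 * k)) :
    pderiv (fun y => |(e y).det|⁻¹) μ x
      = |(e x).det|⁻¹ * (chrMat (metricOf p e) μ x).trace := by
  have hd := differentiableAt_of_contDiffOn he.det hU hx
  have h0 := hdet x hx
  -- Tracelessness of the frame connection trades the logarithmic derivative of `e` for the trace of
  -- Γ.
  have htr : ((e x)⁻¹ * dmat e μ x).trace = - (chrMat (metricOf p e) μ x).trace := by
    have h1 := trace_frameConn (p := p) hU he hdet hx μ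
    rw [frameConn, Matrix.trace_neg, Matrix.mul_add, Matrix.trace_add, Matrix.trace_mul_comm _
      (_ * e x), Matrix.mul_assoc, Matrix.mul_nonsing_inv _ (isUnit_iff_ne_zero.2 h0),
      Matrix.mul_one] at h1
    linarith
  have hJ := pderiv_det hU he hx h0 μ
  rw [htr] at hJ
  have hinv : pderiv (fun y => ((e y).det)⁻¹) μ x
      = ((e x).det)⁻¹ * (chrMat (metricOf p e) μ x).trace := by
    have h2 : HasFDerivAt (fun y => ((e y).det)⁻¹) _ x :=
      (hasDerivAt_inv h0).comp_hasFDerivAt x hd.hasFDerivAt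
    rw [pderiv, h2.fderiv]
    change (-((e x).det ^ 2)⁻¹) * pderiv (fun y => (e y).det) μ x = _
    rw [hJ]
    field_simp
  rcases lt_or_gt_of_ne h0 with hneg | hpos
  · have hev : (fun y => |(e y).det|⁻¹) =ᶠ[𝓝 x] fun y => - ((e y).det)⁻¹ := by
      filter_upwards [hd.continuousAt.eventually (gt_mem_nhds hneg)] with y hy
      rw [abs_of_neg hy, inv_neg]
    rw [pderiv_congr hev, pderiv_neg, hinv, abs_of_neg hneg, inv_neg]
    ring
  · have hev : (fun y => |(e y).det|⁻¹) =ᶠ[𝓝 x] fun y => ((e y).det)⁻¹ := by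
      filter_upwards [hd.continuousAt.eventually (lt_mem_nhds hpos)] with y hy
      rw [abs_of_pos hy]
    rw [pderiv_congr hev, hinv, abs_of_pos hpos]

end

variable {p}

namespace GammaMatrices

variable {N : ℕ} (γ : GammaMatrices k p)

/-- The spin connection of the frame `e`. -/
def spinConn (N : ℕ) (e : Coord k → Matrix (Fin (2 * k)) (Fin (2 * k)) ℝ) (x : Coord k)
    (μ : Fin (2 * k)) : EndFib k N :=
  ∑ a, ∑ b, ((γ.sgn / 4 * (eta k p b * frameConn p e μ x b a) : ℝ) : ℂ) •
    (γ.gam1 N a * γ.gam1 N b)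

/-- [γ^a γ^b, γ^c] = 2ε(η^{bc} γ^a − η^{ac} γ^b), and by skewness both terms contribute equally;
this fixes the factor ε/4 in `spinConn`. -/
theorem spinConn_commutator {e : Coord k → Matrix (Fin (2 * k)) (Fin (2 * k)) ℝ}
    {U : Set (Coord k)} (hU : IsOpen U) (he : SmoothMatOn e U)
    (hdet : ∀ x ∈ U, (e x).det ≠ 0) {x : Coord k} (hx : x ∈ U) (μ c : Fin (2 * k)) :
    γ.spinConn N e x μ * γ.gam1 N c - γ.gam1 N c * γ.spinConn N e x μ
      = ∑ a, ((frameConn p e μ x c a : ℝ) : ℂ) • γ.gam1 N a := by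
  set u : Fin (2 * k) → Fin (2 * k) → ℝ := fun b a => eta k p b * frameConn p e μ x b a with hu
  have hskew : ∀ a b, u a b = - u b a := by
    intro a b
    have h := congrFun (congrFun (frameConn_skew (p := p) hU he hdet hx μ) a) b
    simp only [Matrix.add_apply, Matrix.mul_diagonal, Matrix.diagonal_mul,
      Matrix.transpose_apply, Matrix.zero_apply] at h
    simp only [hu]
    have ha := eta_mul_self (k := k) p a
    have hb := eta_mul_self (k := k) p b
    linear_combination (eta k p a * eta k p b) * h
      - (eta k p a * frameConn p e μ x a b) * hb - (eta k p b * frameConn p e μ x b a) * ha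
  have hc : ∀ a b, γ.gam1 N a * γ.gam1 N b * γ.gam1 N c - γ.gam1 N c * (γ.gam1 N a * γ.gam1 N b)
      = ((2 * γ.sgn * Matrix.diagonal (eta k p) b c : ℝ) : ℂ) • γ.gam1 N a
        - ((2 * γ.sgn * Matrix.diagonal (eta k p) a c : ℝ) : ℂ) • γ.gam1 N b := by
    intro a b
    have h1 : γ.gam1 N a * γ.gam1 N b * γ.gam1 N c - γ.gam1 N c * (γ.gam1 N a * γ.gam1 N b)
        = γ.gam1 N a * (γ.gam1 N b * γ.gam1 N c + γ.gam1 N c * γ.gam1 N b)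
          - (γ.gam1 N a * γ.gam1 N c + γ.gam1 N c * γ.gam1 N a) * γ.gam1 N b := by
      noncomm_ring
    rw [h1, γ.gam1_anticomm, γ.gam1_anticomm]
    simp
  have hexp : γ.spinConn N e x μ * γ.gam1 N c - γ.gam1 N c * γ.spinConn N e x μ
      = ∑ a, ∑ b, ((γ.sgn / 4 * u b a : ℝ) : ℂ) •
        (((2 * γ.sgn * Matrix.diagonal (eta k p) b c : ℝ) : ℂ) • γ.gam1 N a
        - ((2 * γ.sgn * Matrix.diagonal (eta k p) a c : ℝ) : ℂ) • γ.gam1 N b) := by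
    simp only [spinConn, Matrix.sum_mul, Matrix.mul_sum, Matrix.smul_mul, Matrix.mul_smul,
      ← Finset.sum_sub_distrib, ← smul_sub, hc]
    rfl
  rw [hexp]
  simp only [smul_sub, smul_smul, ← Complex.ofReal_mul, Finset.sum_sub_distrib]
  rw [Finset.sum_comm (f := fun a b => ((γ.sgn / 4 * u b a *
    (2 * γ.sgn * Matrix.diagonal (eta k p) a c) : ℝ) : ℂ) • γ.gam1 N b)]
  simp only [← Finset.sum_smul, ← Complex.ofReal_sum, ← Finset.sum_sub_distrib, ← sub_smul,
    ← Complex.ofReal_sub]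
  refine Finset.sum_congr rfl fun a _ => ?_
  congr 2
  rw [Finset.sum_eq_single c (fun b _ hb => by simp [Matrix.diagonal_apply_ne _ hb,
    hskew a b]) (by simp), Matrix.diagonal_apply_eq, hskew a c]
  simp only [hu]
  have h1 := γ.sgn_mul_sgn
  have h2 := eta_mul_self (k := k) p c
  linear_combination (frameConn p e μ x c a * (eta k p c * eta k p c)) * h1
    + frameConn p e μ x c a * h2

/-- The commutator yields e ω = −(∂e + Γe), whose first term cancels the derivative of the symbol.
Hence every frame, in particular a varied one, carries a Clifford connection. -/
theorem isCliffordOn_spinConn {e : Coord k → Matrix (Fin (2 * k)) (Fin (2 * k)) ℝ}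
    {U : Set (Coord k)} (hU : IsOpen U) (he : SmoothMatOn e U)
    (hdet : ∀ x ∈ U, (e x).det ≠ 0) : γ.IsCliffordOn U e (γ.spinConn N e) := by
  intro x hx μ ν
  have h1 : matDeriv (γ.symbol N e ν) μ x
      = ∑ a, ((dmat e μ x ν a : ℝ) : ℂ) • γ.gam1 N a := by
    change dmat (γ.symbol N e ν) μ x = _
    rw [funext (γ.symbol_eq e ν), dmat_sum hU _ (fun a _ =>
      SmoothMatOn.smul (contDiffOn_ofReal (he ν a)) (SmoothMatOn.const _)) hx]
    refine Finset.sum_congr rfl fun a _ => ?_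
    rw [dmat_smul hU (contDiffOn_ofReal (he ν a)) (SmoothMatOn.const _) hx, dmat_const,
      smul_zero, add_zero, pderiv_ofReal (differentiableAt_of_contDiffOn (he ν a) hU hx)]
    rfl
  have h2 : γ.spinConn N e x μ * γ.symbol N e ν x - γ.symbol N e ν x * γ.spinConn N e x μ
      = ∑ a, (((e x * frameConn p e μ x) ν a : ℝ) : ℂ) • γ.gam1 N a := by
    simp only [symbol_eq, Matrix.mul_sum, Matrix.sum_mul, Matrix.mul_smul, Matrix.smul_mul,
      ← Finset.sum_sub_distrib, ← smul_sub, γ.spinConn_commutator hU he hdet hx,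
      Finset.smul_sum, smul_smul, ← Complex.ofReal_mul]
    rw [Finset.sum_comm]
    simp only [← Finset.sum_smul, ← Complex.ofReal_sum, ← Matrix.mul_apply]
  rw [h1, h2, ← Finset.sum_add_distrib]
  simp only [symbol_eq, Finset.smul_sum, smul_smul, ← Complex.ofReal_mul]
  rw [Finset.sum_comm]
  simp only [← Finset.sum_smul, ← Complex.ofReal_sum, ← add_smul, ← Complex.ofReal_add]
  rw [← Finset.sum_neg_distrib]
  refine Finset.sum_congr rfl fun a _ => ?_
  rw [← neg_smul, ← Complex.ofReal_neg]
  congr 2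
  rw [mul_frameConn (hdet x hx), Matrix.neg_apply, Matrix.add_apply, Matrix.mul_apply]
  simp [chrMat]

theorem spinConn_mul_gammaM (hk : 1 ≤ k) (e : Coord k → Matrix (Fin (2 * k)) (Fin (2 * k)) ℝ)
    (x : Coord k) (μ : Fin (2 * k)) :
    γ.spinConn N e x μ * (γ.gammaM ⊗ₖ (1 : Matrix (Fin N) (Fin N) ℂ))
      = (γ.gammaM ⊗ₖ (1 : Matrix (Fin N) (Fin N) ℂ)) * γ.spinConn N e x μ := by
  simp only [spinConn, Matrix.sum_mul, Matrix.mul_sum, Matrix.smul_mul, Matrix.mul_smul, gam1,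
    ← Matrix.mul_kronecker_mul, Matrix.one_mul]
  refine Finset.sum_congr rfl fun a _ => Finset.sum_congr rfl fun b _ => ?_
  rw [Matrix.mul_assoc, γ.gam_mul_gammaM hk, Matrix.mul_neg, ← Matrix.mul_assoc,
    γ.gam_mul_gammaM hk, Matrix.neg_mul, neg_neg, Matrix.mul_assoc]

end GammaMatrices

end SpinConnection

end DiracGauge
end

noncomputable section
namespace DiracGauge

/-! ### First variation of the curvature and the Palatini identity. -/

section MatDeriv

variable {m l r : Type*}

/-- Entrywise derivative of a curve of matrices. -/
def HasMatDerivAt (f : ℝ → Matrix m l ℝ) (f' : Matrix m l ℝ) (t : ℝ) : Prop :=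
  ∀ i j, HasDerivAt (fun s => f s i j) (f' i j) t

theorem HasMatDerivAt.add {f g : ℝ → Matrix m l ℝ} {f' g' : Matrix m l ℝ} {t : ℝ}
    (hf : HasMatDerivAt f f' t) (hg : HasMatDerivAt g g' t) :
    HasMatDerivAt (fun s => f s + g s) (f' + g') t :=
  fun i j => (hf i j).add (hg i j)

theorem HasMatDerivAt.sub {f g : ℝ → Matrix m l ℝ} {f' g' : Matrix m l ℝ} {t : ℝ}
    (hf : HasMatDerivAt f f' t) (hg : HasMatDerivAt g g' t) :
    HasMatDerivAt (fun s => f s - g s) (f' - g') t :=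
  fun i j => (hf i j).sub (hg i j)

theorem HasMatDerivAt.const (A : Matrix m l ℝ) (t : ℝ) : HasMatDerivAt (fun _ => A) 0 t :=
  fun i j => hasDerivAt_const t (A i j)

theorem HasMatDerivAt.transpose {f : ℝ → Matrix m l ℝ} {f' : Matrix m l ℝ} {t : ℝ}
    (hf : HasMatDerivAt f f' t) : HasMatDerivAt (fun s => (f s)ᵀ) f'ᵀ t :=
  fun i j => hf j i

theorem HasMatDerivAt.mul [Fintype l] {f : ℝ → Matrix m l ℝ} {g : ℝ → Matrix l r ℝ}
    {f' : Matrix m l ℝ} {g' : Matrix l r ℝ} {t : ℝ} (hf : HasMatDerivAt f f' t)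
    (hg : HasMatDerivAt g g' t) :
    HasMatDerivAt (fun s => f s * g s) (f' * g t + f t * g') t := by
  intro i j
  simp only [Matrix.mul_apply, Matrix.add_apply, ← Finset.sum_add_distrib]
  exact HasDerivAt.fun_sum fun a _ => (hf i a).mul (hg a j)

end MatDeriv

section Family

variable {k : ℕ} (p : ℕ) {e : ℝ → Coord k → Matrix (Fin (2 * k)) (Fin (2 * k)) ℝ}
  {Ω : Set (ℝ × Coord k)} (hΩ : IsOpen Ω) (he : SmoothMatOn (fun z : ℝ × Coord k => e z.1 z.2) Ω)
  (hdet : ∀ z ∈ Ω, (e z.1 z.2).det ≠ 0)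

include he hdet

theorem metricOf_family_smooth :
    SmoothMatOn (fun z : ℝ × Coord k => metricOf p (e z.1) z.2) Ω :=
  (frame_smooth p he).inv fun z hz => det_frame_ne_zero p (hdet z hz)

theorem metricOf_inv_family_smooth :
    SmoothMatOn (fun z : ℝ × Coord k => (metricOf p (e z.1) z.2)⁻¹) Ω :=
  (frame_smooth p he).congr fun z hz => metricOf_inv p (hdet z hz)

include hΩ

theorem chrMat_family_smooth (μ : Fin (2 * k)) :
    SmoothMatOn (fun z : ℝ × Coord k => chrMat (metricOf p (e z.1)) μ z.2) Ω := by
  intro l ν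
  have hg := metricOf_family_smooth p he hdet
  change ContDiffOn ℝ ∞ (fun z : ℝ × Coord k => christoffel (metricOf p (e z.1)) l μ ν z.2) Ω
  simp only [christoffel]
  refine contDiffOn_const.mul (ContDiffOn.sum fun r _ =>
    (metricOf_inv_family_smooth p he hdet l r).mul ?_)
  exact ((contDiffOn_pderiv_param hΩ (hg r ν) μ).add (contDiffOn_pderiv_param hΩ (hg r μ) ν)).sub
    (contDiffOn_pderiv_param hΩ (hg μ ν) r)

theorem rieMat_family_smooth (μ ν : Fin (2 * k)) :
    SmoothMatOn (fun z : ℝ × Coord k => rieMat (metricOf p (e z.1)) μ ν z.2) Ω := by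
  have h := chrMat_family_smooth p hΩ he hdet
  have hd : ∀ μ ν, SmoothMatOn
      (fun z : ℝ × Coord k => dmat (chrMat (metricOf p (e z.1)) ν) μ z.2) Ω :=
    fun μ ν r s => contDiffOn_pderiv_param hΩ (h ν r s) μ
  exact ((hd μ ν).sub (hd ν μ)).add (((h μ).mul (h ν)).sub ((h ν).mul (h μ)))

theorem scalarCurvature_family_smooth :
    ContDiffOn ℝ ∞ (fun z : ℝ × Coord k => scalarCurvature (metricOf p (e z.1)) z.2) Ω := by
  simp only [scalarCurvature, ricci_apply]
  exact ContDiffOn.sum fun s _ => ContDiffOn.sum fun ν _ =>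
    (metricOf_inv_family_smooth p he hdet s ν).mul
      (ContDiffOn.sum fun r _ => rieMat_family_smooth p hΩ he hdet r ν r s)

theorem spinConn_family_smooth {p : ℕ} (γ : GammaMatrices k p) (N : ℕ) (μ : Fin (2 * k)) :
    SmoothMatOn (fun z : ℝ × Coord k => γ.spinConn N (e z.1) z.2 μ) Ω := by
  have hw : SmoothMatOn (fun z : ℝ × Coord k => frameConn p (e z.1) μ z.2) Ω := by
    refine ((he.inv hdet).mul (SmoothMatOn.add ?_
      ((chrMat_family_smooth p hΩ he hdet μ).mul he))).neg
    exact fun r s => contDiffOn_pderiv_param hΩ (he r s) μ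
  refine SmoothMatOn.sum _ fun a _ => SmoothMatOn.sum _ fun b _ => ?_
  exact SmoothMatOn.smul (contDiffOn_ofReal (contDiffOn_const.mul
    (contDiffOn_const.mul (hw b a)))) (SmoothMatOn.const _)

/-- The derivative of the Christoffel symbols of a family of frames at parameter `0`. -/
def chrDot (e : ℝ → Coord k → Matrix (Fin (2 * k)) (Fin (2 * k)) ℝ) (μ : Fin (2 * k))
    (x : Coord k) : Matrix (Fin (2 * k)) (Fin (2 * k)) ℝ :=
  Matrix.of fun r s => deriv (fun t => chrMat (metricOf p (e t)) μ x r s) 0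

theorem hasMatDerivAt_chrMat {x : Coord k} (hx : (0, x) ∈ Ω) (μ : Fin (2 * k)) :
    HasMatDerivAt (fun t => chrMat (metricOf p (e t)) μ x) (chrDot p e μ x) 0 := fun r s =>
  (hasDerivAt_slice (differentiableAt_of_contDiffOn (chrMat_family_smooth p hΩ he hdet μ r s) hΩ
    hx)).differentiableAt.hasDerivAt

/-- Parameter and coordinate derivatives commute (`hasDerivAt_pderiv`), so the variation of R is the
covariant exterior derivative of the variation of Γ. -/
theorem hasMatDerivAt_rieMat {x : Coord k} (hx : (0, x) ∈ Ω) (μ ν : Fin (2 * k)) :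
    HasMatDerivAt (fun t => rieMat (metricOf p (e t)) μ ν x)
      (dmat (chrDot p e ν) μ x - dmat (chrDot p e μ) ν x
        + ((chrDot p e μ x * chrMat (metricOf p (e 0)) ν x
            + chrMat (metricOf p (e 0)) μ x * chrDot p e ν x)
          - (chrDot p e ν x * chrMat (metricOf p (e 0)) μ x
            + chrMat (metricOf p (e 0)) ν x * chrDot p e μ x))) 0 := by
  have h := hasMatDerivAt_chrMat p hΩ he hdet hx
  have hd : ∀ μ ν, HasMatDerivAt (fun t => dmat (chrMat (metricOf p (e t)) ν) μ x)
      (dmat (chrDot p e ν) μ x) 0 := fun μ ν r s =>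
    hasDerivAt_pderiv hΩ (chrMat_family_smooth p hΩ he hdet ν r s) hx μ
  exact ((hd μ ν).sub (hd ν μ)).add (((h μ).mul (h ν)).sub ((h ν).mul (h μ)))

end Family

section Palatini

variable {k : ℕ}

theorem scalarCurvature_eq (g : Coord k → Matrix (Fin (2 * k)) (Fin (2 * k)) ℝ) (x : Coord k) :
    scalarCurvature g x = ∑ r, ∑ ν, (rieMat g r ν x * (g x)⁻¹) r ν := by
  simp only [scalarCurvature, ricci_apply, Matrix.mul_apply, Finset.mul_sum]
  rw [Finset.sum_congr rfl fun s _ => Finset.sum_comm, Finset.sum_comm]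
  refine Finset.sum_congr rfl fun r _ => ?_
  rw [Finset.sum_comm]
  exact Finset.sum_congr rfl fun ν _ => Finset.sum_congr rfl fun s _ => mul_comm _ _

/-- The vector density whose divergence is the second derivative part of the variation of the
scalar curvature. -/
def palatiniFlux (C : Fin (2 * k) → Coord k → Matrix (Fin (2 * k)) (Fin (2 * k)) ℝ)
    (d : Coord k → Matrix (Fin (2 * k)) (Fin (2 * k)) ℝ) (r : Fin (2 * k)) (x : Coord k) : ℝ :=
  ∑ ν, ((C ν x * d x) r ν - (C ν x * d x) ν r)

/-- The Palatini identity. -/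
theorem palatini {U : Set (Coord k)} (hU : IsOpen U)
    {C : Fin (2 * k) → Coord k → Matrix (Fin (2 * k)) (Fin (2 * k)) ℝ}
    {d : Coord k → Matrix (Fin (2 * k)) (Fin (2 * k)) ℝ}
    {Γ : Fin (2 * k) → Matrix (Fin (2 * k)) (Fin (2 * k)) ℝ}
    (hC : ∀ μ, SmoothMatOn (C μ) U) (hd : SmoothMatOn d U) {x : Coord k} (hx : x ∈ U)
    (hΓ : ∀ l μ ν, Γ μ l ν = Γ ν l μ)
    (hdΓ : ∀ μ, dmat d μ x = (Γ μ).trace • d x - Γ μ * d x - d x * (Γ μ)ᵀ) :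
    ∑ r, ∑ ν, ((dmat (C ν) r x - dmat (C r) ν x
        + ((C r x * Γ ν + Γ r * C ν x) - (C ν x * Γ r + Γ ν * C r x))) * d x) r ν
      = ∑ r, pderiv (palatiniFlux C d r) r x := by
  set H : Fin (2 * k) → Coord k → Matrix (Fin (2 * k)) (Fin (2 * k)) ℝ :=
    fun ν y => C ν y * d y with hH
  have hHs : ∀ ν, SmoothMatOn (H ν) U := fun ν => (hC ν).mul hd
  have hHd : ∀ ν a b, DifferentiableAt ℝ (fun y => H ν y a b) x := fun ν a b =>
    differentiableAt_of_contDiffOn (hHs ν a b) hU hx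
  -- `hdΓ` says that `d` is a parallel tensor density, so it moves inside the derivatives at the
  -- cost of Γ terms acting on `H`.
  have h1 : ∀ r ν, (dmat (C ν) r x - dmat (C r) ν x
        + ((C r x * Γ ν + Γ r * C ν x) - (C ν x * Γ r + Γ ν * C r x))) * d x
      = dmat (H ν) r x - dmat (H r) ν x + ((Γ ν).trace • H r x - H r x * (Γ ν)ᵀ)
        - ((Γ r).trace • H ν x - Γ r * H ν x) + (H ν x * (Γ r)ᵀ - Γ ν * H r x) := by
    intro r ν
    simp only [hH, dmat_mul hU (hC _) hd hx, hdΓ, Matrix.mul_sub, Matrix.mul_smul]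
    noncomm_ring
  have h2 : ∀ r, pderiv (palatiniFlux C d r) r x
      = ∑ ν, (dmat (H ν) r x r ν - dmat (H ν) r x ν r) := by
    intro r
    have : palatiniFlux C d r = fun y => ∑ ν, (H ν y r ν - H ν y ν r) := rfl
    rw [this, pderiv_sum _ fun ν _ => (hHd ν r ν).fun_sub (hHd ν ν r)]
    exact Finset.sum_congr rfl fun ν _ => pderiv_sub (hHd ν r ν) (hHd ν ν r) r
  simp only [h1, h2, Matrix.add_apply, Matrix.sub_apply, Finset.sum_add_distrib,
    Finset.sum_sub_distrib]
  -- The derivative terms form the divergence; symmetry of Γ pairs off the remaining terms (`s2` to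
  -- `s4`).
  have s1 : ∑ r, ∑ ν, dmat (H r) ν x r ν = ∑ r, ∑ ν, dmat (H ν) r x ν r := Finset.sum_comm
  have s2 : ∑ r, ∑ ν, ((Γ ν).trace • H r x) r ν = ∑ r, ∑ ν, (H r x * (Γ ν)ᵀ) r ν := by
    refine Finset.sum_congr rfl fun r _ => ?_
    simp only [Matrix.smul_apply, smul_eq_mul, Matrix.mul_apply, Matrix.transpose_apply,
      Matrix.trace, Matrix.diag_apply, Finset.sum_mul]
    rw [Finset.sum_comm]
    exact Finset.sum_congr rfl fun a _ => Finset.sum_congr rfl fun b _ => by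
      rw [hΓ a b a, mul_comm]
  have s3 : ∑ r, ∑ ν, ((Γ r).trace • H ν x) r ν = ∑ r, ∑ ν, (Γ r * H ν x) r ν := by
    rw [Finset.sum_comm, Finset.sum_comm (f := fun r ν => (Γ r * H ν x) r ν)]
    refine Finset.sum_congr rfl fun ν _ => ?_
    simp only [Matrix.smul_apply, smul_eq_mul, Matrix.mul_apply,
      Matrix.trace, Matrix.diag_apply, Finset.sum_mul]
    rw [Finset.sum_comm]
    exact Finset.sum_congr rfl fun a _ => Finset.sum_congr rfl fun b _ => by rw [hΓ a b a]
  have s4 : ∑ r, ∑ ν, (H ν x * (Γ r)ᵀ) r ν = ∑ r, ∑ ν, (Γ ν * H r x) r ν := by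
    simp only [Matrix.mul_apply, Matrix.transpose_apply]
    rw [Finset.sum_comm]
    refine Finset.sum_congr rfl fun a _ => ?_
    rw [Finset.sum_comm]
    exact Finset.sum_congr rfl fun b _ => Finset.sum_congr rfl fun r _ => by
      rw [hΓ a r b, mul_comm]
  rw [s1, s2, s3, s4]
  ring

end Palatini

end DiracGauge
end

noncomputable section
namespace DiracGauge

/-! ### The divergence theorem and differentiation under the integral. -/

section Integration

variable {k : ℕ}

/-- Vanishing off K ⊆ U makes `V` smooth with compact support on the whole space; integrate by parts
against the constant 1. -/
theorem setIntegral_pderiv_eq_zero {U K : Set (Coord k)} (hU : IsOpen U) (hK : IsCompact K)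
    (hKU : K ⊆ U) {V : Coord k → ℝ} (hV : ContDiffOn ℝ ∞ V U) (h0 : ∀ y ∉ K, V y = 0)
    (μ : Fin (2 * k)) : ∫ x in K, pderiv V μ x = 0 := by
  have hev : ∀ y ∉ K, V =ᶠ[𝓝 y] fun _ => 0 := fun y hy =>
    Filter.eventuallyEq_of_mem (hK.isClosed.isOpen_compl.mem_nhds hy) fun z hz => h0 z hz
  have hsm : ContDiff ℝ ∞ V := by
    rw [contDiff_iff_contDiffAt]
    intro y
    by_cases hy : y ∈ K
    · exact hV.contDiffAt (hU.mem_nhds (hKU hy))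
    · exact contDiffAt_const.congr_of_eventuallyEq (hev y hy)
  have hc : HasCompactSupport V := HasCompactSupport.intro hK h0
  have hpc : Continuous (pderiv V μ) :=
    (hsm.continuous_fderiv (by simp)).clm_apply continuous_const
  have hp0 : ∀ y ∉ K, pderiv V μ y = 0 := fun y hy => by
    rw [pderiv_congr (hev y hy), pderiv_const]
  have hpi : MeasureTheory.Integrable (pderiv V μ) :=
    hpc.integrable_of_hasCompactSupport (HasCompactSupport.intro hK hp0)
  rw [MeasureTheory.setIntegral_eq_integral_of_forall_compl_eq_zero hp0]
  have h := integral_mul_fderiv_eq_neg_fderiv_mul_of_integrable (μ := MeasureTheory.volume)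
    (𝕜 := ℝ) (f := fun _ : Coord k => (1 : ℝ)) (g := V) (v := EuclideanSpace.single μ 1)
    (by simp) (by simp only [one_mul]; exact hpi)
    (by simpa using hsm.continuous.integrable_of_hasCompactSupport hc)
    (fun x _ => differentiableAt_const _)
    (fun x _ => hsm.differentiable (by simp) x)
  simpa [pderiv] using h

theorem hasDerivAt_setIntegral {U K : Set (Coord k)} (hU : IsOpen U) (hK : IsCompact K)
    (hKU : K ⊆ U) {δ : ℝ} (hδ : 0 < δ) {L : ℝ × Coord k → ℝ}
    (hL : ContDiffOn ℝ ∞ L (Set.Ioo (-δ) δ ×ˢ U)) :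
    HasDerivAt (fun t => ∫ x in K, L (t, x)) (∫ x in K, deriv (fun t => L (t, x)) 0) 0 := by
  set Ω := Set.Ioo (-δ) δ ×ˢ U
  have hΩ : IsOpen Ω := isOpen_Ioo.prod hU
  set I := Set.Icc (-(δ / 2)) (δ / 2)
  have hI : ∀ t ∈ I, t ∈ Set.Ioo (-δ) δ := fun t ht => ⟨by linarith [ht.1], by linarith [ht.2]⟩
  have hd : ∀ t ∈ I, ∀ x ∈ K, HasDerivAt (fun s => L (s, x)) (fderiv ℝ L (t, x) (1, 0)) t :=
    fun t ht x hx => hasDerivAt_slice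
      (differentiableAt_of_contDiffOn hL hΩ (Set.mk_mem_prod (hI t ht) (hKU hx)))
  have hc : ContinuousOn (fun z => fderiv ℝ L z (1, 0)) Ω :=
    (contDiffOn_fderiv_apply hΩ hL (1, 0)).continuousOn
  have hslice : ∀ {f : ℝ × Coord k → ℝ}, ContinuousOn f Ω → ∀ t ∈ I,
      ContinuousOn (fun x => f (t, x)) K := fun hf t ht =>
    hf.comp (by fun_prop) fun x hx => Set.mk_mem_prod (hI t ht) (hKU hx)
  -- The parameter derivative is bounded on the compact set [−δ/2, δ/2] × K, and this constant is
  -- the dominating function.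
  obtain ⟨c, hcb⟩ := ((isCompact_Icc (a := -(δ / 2)) (b := δ / 2)).prod hK).exists_bound_of_continuousOn
    (hc.mono fun z hz => Set.mk_mem_prod (hI _ hz.1) (hKU hz.2))
  have h0 : (0 : ℝ) ∈ I := ⟨by linarith, by linarith⟩
  have hIn : I ∈ 𝓝 (0 : ℝ) := Icc_mem_nhds (by linarith) (by linarith)
  have hKm := hK.measurableSet
  have key := hasDerivAt_integral_of_dominated_loc_of_deriv_le
    (μ := MeasureTheory.volume.restrict K) (F := fun t x => L (t, x))
    (F' := fun t x => fderiv ℝ L (t, x) (1, 0)) (bound := fun _ => c) (x₀ := (0 : ℝ)) hIn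
    (Filter.eventually_of_mem hIn fun t ht =>
      (hslice hL.continuousOn t ht).aestronglyMeasurable hKm)
    ((hslice hL.continuousOn 0 h0).integrableOn_compact hK)
    ((hslice hc 0 h0).aestronglyMeasurable hKm)
    ((MeasureTheory.ae_restrict_iff' hKm).2 (Filter.Eventually.of_forall fun x hx t ht =>
      hcb (t, x) (Set.mk_mem_prod ht hx)))
    (MeasureTheory.integrableOn_const (hs := hK.measure_lt_top.ne))
    ((MeasureTheory.ae_restrict_iff' hKm).2 (Filter.Eventually.of_forall fun x hx t ht =>
      hd t ht x hx))
  refine key.2.congr_deriv ?_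
  exact MeasureTheory.setIntegral_congr_fun hKm fun x hx => ((hd 0 h0 x hx).deriv).symm

end Integration

/-! ### Compactly supported variations of the frame. -/

section Variation

variable {k p : ℕ}

/-- The variation of a frame by a constant matrix times a cut-off function. -/
def varFrame (e : Coord k → Matrix (Fin (2 * k)) (Fin (2 * k)) ℝ) (φ : Coord k → ℝ)
    (m : Matrix (Fin (2 * k)) (Fin (2 * k)) ℝ) (t : ℝ) (x : Coord k) :
    Matrix (Fin (2 * k)) (Fin (2 * k)) ℝ :=
  (1 + (t * φ x) • m) * e x

theorem varFrame_zero (e : Coord k → Matrix (Fin (2 * k)) (Fin (2 * k)) ℝ) (φ : Coord k → ℝ)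
    (m : Matrix (Fin (2 * k)) (Fin (2 * k)) ℝ) : varFrame e φ m 0 = e := by
  funext x
  simp [varFrame]

theorem varFrame_eventuallyEq (e : Coord k → Matrix (Fin (2 * k)) (Fin (2 * k)) ℝ)
    (φ : Coord k → ℝ) (m : Matrix (Fin (2 * k)) (Fin (2 * k)) ℝ) (t : ℝ) {x : Coord k}
    (hx : x ∉ tsupport φ) : varFrame e φ m t =ᶠ[𝓝 x] e := by
  filter_upwards [(isClosed_tsupport φ).isOpen_compl.mem_nhds hx] with y hy
  simp [varFrame, image_eq_zero_of_notMem_tsupport hy]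

/-- Dependence on the germ of the frame only: outside the support of the cut-off the Levi-Civita and
spin connections do not vary. -/
theorem chrMat_congr {e e' : Coord k → Matrix (Fin (2 * k)) (Fin (2 * k)) ℝ} {x : Coord k}
    (h : e =ᶠ[𝓝 x] e') (μ : Fin (2 * k)) :
    chrMat (metricOf p e) μ x = chrMat (metricOf p e') μ x := by
  have hg : metricOf p e =ᶠ[𝓝 x] metricOf p e' := h.mono fun y hy => by simp only [metricOf, hy]
  have hd : ∀ a b μ, pderiv (fun y => metricOf p e y a b) μ x
      = pderiv (fun y => metricOf p e' y a b) μ x := fun a b μ =>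
    pderiv_congr (hg.mono fun y hy => by rw [hy]) μ
  ext r s
  simp only [chrMat, Matrix.of_apply, christoffel, hd, hg.self_of_nhds]

theorem GammaMatrices.spinConn_congr (γ : GammaMatrices k p) {N : ℕ}
    {e e' : Coord k → Matrix (Fin (2 * k)) (Fin (2 * k)) ℝ} {x : Coord k} (h : e =ᶠ[𝓝 x] e')
    (μ : Fin (2 * k)) : γ.spinConn N e x μ = γ.spinConn N e' x μ := by
  have hd : dmat e μ x = dmat e' μ x := by
    ext a b
    exact pderiv_congr (h.mono fun y hy => by rw [hy]) μ
  simp only [spinConn, frameConn, chrMat_congr h, hd, h.self_of_nhds]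

/-- The determinant of g⁻¹ = e η eᵀ is ±(det e)². -/
theorem sqrt_abs_det_metricOf (e : Coord k → Matrix (Fin (2 * k)) (Fin (2 * k)) ℝ)
    (x : Coord k) : Real.sqrt |(metricOf p e x).det| = |(e x).det|⁻¹ := by
  have hη : |∏ a, eta k p a| = 1 := by
    rw [Finset.abs_prod]
    exact Finset.prod_eq_one fun a _ => by unfold eta; split_ifs <;> simp
  rw [metricOf, Matrix.det_nonsing_inv, Ring.inverse_eq_inv', Matrix.det_mul, Matrix.det_mul,
    Matrix.det_transpose, Matrix.det_diagonal, abs_inv, abs_mul, abs_mul, hη, mul_one,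
    Real.sqrt_inv, Real.sqrt_mul_self (abs_nonneg _)]

theorem varFrame_smooth {e : Coord k → Matrix (Fin (2 * k)) (Fin (2 * k)) ℝ}
    {U : Set (Coord k)} (he : SmoothMatOn e U) {φ : Coord k → ℝ} (hφ : ContDiff ℝ ∞ φ)
    (m : Matrix (Fin (2 * k)) (Fin (2 * k)) ℝ) (I : Set ℝ) :
    SmoothMatOn (fun z : ℝ × Coord k => varFrame e φ m z.1 z.2) (I ×ˢ U) := by
  refine SmoothMatOn.mul (SmoothMatOn.add (SmoothMatOn.const _)
    (SmoothMatOn.smul ?_ (SmoothMatOn.const _))) ?_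
  · exact (contDiff_fst.mul (hφ.comp contDiff_snd)).contDiffOn
  · intro a b
    exact (he a b).comp contDiff_snd.contDiffOn fun z hz => hz.2

/-- The factor 1 + tφm stands to the left of `e`, so g⁻¹ = e η eᵀ changes by a congruence. -/
theorem hasMatDerivAt_varFrame_inv {e : Coord k → Matrix (Fin (2 * k)) (Fin (2 * k)) ℝ}
    (φ : Coord k → ℝ) (m : Matrix (Fin (2 * k)) (Fin (2 * k)) ℝ) {x : Coord k}
    (hdet : ∀ᶠ t in 𝓝 (0 : ℝ), (varFrame e φ m t x).det ≠ 0) :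
    HasMatDerivAt (fun t => (metricOf p (varFrame e φ m t) x)⁻¹)
      (φ x • (m * (metricOf p e x)⁻¹ + (metricOf p e x)⁻¹ * mᵀ)) 0 := by
  have hG : (metricOf p e x)⁻¹ = e x * Matrix.diagonal (eta k p) * (e x)ᵀ := by
    have := metricOf_inv p hdet.self_of_nhds
    rwa [varFrame_zero] at this
  have h1 : HasMatDerivAt (fun t : ℝ => 1 + (t * φ x) • m) (φ x • m) 0 := by
    intro i j
    simp only [Matrix.add_apply, Matrix.smul_apply, smul_eq_mul]
    have := (((hasDerivAt_id (0 : ℝ)).mul_const (φ x)).mul_const (m i j)).const_add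
      ((1 : Matrix (Fin (2 * k)) (Fin (2 * k)) ℝ) i j)
    simpa using this
  have h2 := (h1.mul (HasMatDerivAt.const (metricOf p e x)⁻¹ 0)).mul h1.transpose
  have hev : ∀ᶠ t in 𝓝 (0 : ℝ), (metricOf p (varFrame e φ m t) x)⁻¹
      = (1 + (t * φ x) • m) * (metricOf p e x)⁻¹ * (1 + (t * φ x) • m)ᵀ := by
    filter_upwards [hdet] with t ht
    rw [metricOf_inv p ht, hG]
    simp only [varFrame, Matrix.transpose_mul, Matrix.mul_assoc]
  intro i j
  refine ((h2 i j).congr_of_eventuallyEq (hev.mono fun t ht => ?_)).congr_deriv ?_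
  · simp only [ht]
  · simp
    ring

/-- The determinant factors, and det(1 + tφm) is positive for small t, so the absolute value does no
harm. -/
theorem hasDerivAt_varFrame_abs_det_inv {e : Coord k → Matrix (Fin (2 * k)) (Fin (2 * k)) ℝ}
    (φ : Coord k → ℝ) (m : Matrix (Fin (2 * k)) (Fin (2 * k)) ℝ) (x : Coord k) :
    HasDerivAt (fun t => |(varFrame e φ m t x).det|⁻¹)
      (- (φ x * m.trace * |(e x).det|⁻¹)) 0 := by
  have h1 : HasDerivAt (fun t : ℝ => (1 + (t * φ x) • m).det) (φ x * m.trace) 0 := by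
    have h := hasDerivAt_det_one_add_smul (φ x • m)
    rw [Matrix.trace_smul, smul_eq_mul] at h
    refine h.congr_of_eventuallyEq (Filter.Eventually.of_forall fun t => ?_)
    simp only [smul_smul]
  have h2 := h1.inv (by simp)
  have h3 : ∀ᶠ t in 𝓝 (0 : ℝ), 0 < (1 + (t * φ x) • m).det :=
    h1.continuousAt.eventually (lt_mem_nhds (by simp))
  refine ((h2.mul_const |(e x).det|⁻¹).congr_of_eventuallyEq ?_).congr_deriv (by simp)
  filter_upwards [h3] with t ht
  rw [varFrame, Matrix.det_mul, abs_mul, abs_of_pos ht, mul_inv]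
  rfl

end Variation

end DiracGauge
end

noncomputable section
namespace DiracGauge

/-! ### The Euler-Lagrange equations as Einstein equations. -/

section EinsteinEquation

variable {k p : ℕ}

/-- The Einstein tensor density, with cosmological term `β`, contracted with a matrix. -/
def einsteinDensity (p : ℕ) (α : ℝ) (β : Coord k → ℝ)
    (e : Coord k → Matrix (Fin (2 * k)) (Fin (2 * k)) ℝ)
    (m : Matrix (Fin (2 * k)) (Fin (2 * k)) ℝ) (x : Coord k) : ℝ :=
  (2 * α * (m * ((metricOf p e x)⁻¹ * ricci (metricOf p e) x)).trace
    - (α * scalarCurvature (metricOf p e) x + β x) * m.trace) * |(e x).det|⁻¹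

theorem abs_det_inv_smooth {e : Coord k → Matrix (Fin (2 * k)) (Fin (2 * k)) ℝ}
    {U : Set (Coord k)} (he : SmoothMatOn e U) (hdet : ∀ x ∈ U, (e x).det ≠ 0) :
    ContDiffOn ℝ ∞ (fun y => |(e y).det|⁻¹) U :=
  (he.det.abs hdet).inv fun x hx => abs_ne_zero.2 (hdet x hx)

section

variable {e : Coord k → Matrix (Fin (2 * k)) (Fin (2 * k)) ℝ} {U : Set (Coord k)}
  (hU : IsOpen U) (he : SmoothMatOn e U) (hdet : ∀ x ∈ U, (e x).det ≠ 0)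

include hU he hdet

/-- The inverse metric density. -/
theorem dmat_metric_density {x : Coord k} (hx : x ∈ U) (μ : Fin (2 * k)) :
    dmat (fun y => |(e y).det|⁻¹ • (metricOf p e y)⁻¹) μ x
      = (chrMat (metricOf p e) μ x).trace • (|(e x).det|⁻¹ • (metricOf p e x)⁻¹)
        - chrMat (metricOf p e) μ x * (|(e x).det|⁻¹ • (metricOf p e x)⁻¹)
        - (|(e x).det|⁻¹ • (metricOf p e x)⁻¹) * (chrMat (metricOf p e) μ x)ᵀ := by
  have hg := isMetricOn_metricOf p hU he hdet
  rw [dmat_smul hU (abs_det_inv_smooth he hdet) hg.inv_smooth hx, hg.dmat_inv hx,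
    pderiv_abs_det_inv (p := p) hU he hdet hx, smul_smul, Matrix.mul_smul, Matrix.smul_mul,
    smul_neg, smul_add, mul_comm |(e x).det|⁻¹ (chrMat _ _ _).trace]
  abel

/-- The first variation of the Lagrangian density `(α r + β) √g`. -/
theorem hasDerivAt_lagrangian {φ : Coord k → ℝ} (hφ : ContDiff ℝ ∞ φ)
    (m : Matrix (Fin (2 * k)) (Fin (2 * k)) ℝ) {δ : ℝ} (hδ : 0 < δ)
    (hvar : ∀ t ∈ Set.Ioo (-δ) δ, ∀ x ∈ U, (varFrame e φ m t x).det ≠ 0) (α : ℝ)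
    (β : Coord k → ℝ) {x : Coord k} (hx : x ∈ U) :
    HasDerivAt (fun t => (α * scalarCurvature (metricOf p (varFrame e φ m t)) x + β x)
        * |(varFrame e φ m t x).det|⁻¹)
      (φ x * einsteinDensity p α β e m x + α * ∑ r, pderiv (palatiniFlux
        (chrDot p (varFrame e φ m)) (fun y => |(e y).det|⁻¹ • (metricOf p e y)⁻¹) r) r x) 0 := by
  set Ω := Set.Ioo (-δ) δ ×ˢ U
  have hΩ : IsOpen Ω := isOpen_Ioo.prod hU
  have h0δ : (0 : ℝ) ∈ Set.Ioo (-δ) δ := ⟨by linarith, hδ⟩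
  have hsm := varFrame_smooth he hφ m (Set.Ioo (-δ) δ)
  have hdt : ∀ z ∈ Ω, (varFrame e φ m z.1 z.2).det ≠ 0 := fun z hz => hvar _ hz.1 _ hz.2
  have hmem : ∀ y ∈ U, ((0 : ℝ), y) ∈ Ω := fun y hy => Set.mk_mem_prod h0δ hy
  have hg := isMetricOn_metricOf p hU he hdet
  have hC : ∀ μ, SmoothMatOn (chrDot p (varFrame e φ m) μ) U := by
    intro μ r s
    have h1 := chrMat_family_smooth p hΩ hsm hdt μ r s
    have h2 := (contDiffOn_fderiv_apply hΩ h1 (1, 0)).comp (s := U) (f := fun y => ((0 : ℝ), y))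
      (by fun_prop) hmem
    exact h2.congr fun y hy =>
      (hasDerivAt_slice (differentiableAt_of_contDiffOn h1 hΩ (hmem y hy))).deriv
  have hd : SmoothMatOn (fun y => |(e y).det|⁻¹ • (metricOf p e y)⁻¹) U :=
    SmoothMatOn.smul (abs_det_inv_smooth he hdet) hg.inv_smooth
  -- The inverse metric density is parallel, so the part of the variation that comes from δΓ is a
  -- divergence.
  have hpal := palatini hU hC hd hx (Γ := fun μ => chrMat (metricOf p e) μ x)
    (fun l μ ν => hg.chrMat_symm hx l μ ν) (dmat_metric_density hU he hdet hx)
  have hR := hasMatDerivAt_rieMat p hΩ hsm hdt (hmem x hx)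
  have hG := hasMatDerivAt_varFrame_inv (p := p) φ m
    (Filter.eventually_of_mem (Ioo_mem_nhds h0δ.1 h0δ.2) fun t ht => hvar t ht x hx)
  have hw := hasDerivAt_varFrame_abs_det_inv (e := e) φ m x
  have hr := HasDerivAt.fun_sum (u := Finset.univ) fun r (_ : r ∈ Finset.univ) =>
    HasDerivAt.fun_sum (u := Finset.univ) fun ν (_ : ν ∈ Finset.univ) => ((hR r ν).mul hG) r ν
  simp only [scalarCurvature_eq]
  refine (((hr.const_mul α).add_const (β x)).mul hw).congr_deriv ?_
  simp only [varFrame_zero, Matrix.add_apply _ (rieMat _ _ _ _ * _), Finset.sum_add_distrib]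
  -- The two terms of δg⁻¹ contribute equally because Ric and g⁻¹ are symmetric.
  have hRic : ∑ r, ∑ ν, (rieMat (metricOf p e) r ν x
        * (φ x • (m * (metricOf p e x)⁻¹ + (metricOf p e x)⁻¹ * mᵀ))) r ν
      = φ x * (2 * (m * ((metricOf p e x)⁻¹ * ricci (metricOf p e) x)).trace) := by
    have h1 : ∀ Z : Matrix (Fin (2 * k)) (Fin (2 * k)) ℝ,
        ∑ r, ∑ ν, (rieMat (metricOf p e) r ν x * Z) r ν = (ricci (metricOf p e) x * Z).trace := by
      intro Z
      rw [← hg.ricci_symm hx]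
      simp only [Matrix.trace, Matrix.diag_apply, Matrix.mul_apply, Matrix.transpose_apply,
        ricci_apply, Finset.sum_mul]
      rw [Finset.sum_comm]
      exact Finset.sum_congr rfl fun ν _ => Finset.sum_comm
    rw [h1, Matrix.mul_smul, Matrix.trace_smul, smul_eq_mul, Matrix.mul_add, Matrix.trace_add,
      two_mul (m * ((metricOf p e x)⁻¹ * ricci (metricOf p e) x)).trace]
    congr 2
    · rw [Matrix.trace_mul_comm, Matrix.mul_assoc]
    · rw [← Matrix.trace_transpose, Matrix.transpose_mul, Matrix.transpose_mul,
        Matrix.transpose_transpose, hg.inv_symm hx, hg.ricci_symm hx, Matrix.mul_assoc]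
  have hP : (∑ r, ∑ ν, ((dmat (chrDot p (varFrame e φ m) ν) r x
        - dmat (chrDot p (varFrame e φ m) r) ν x
        + ((chrDot p (varFrame e φ m) r x * chrMat (metricOf p e) ν x
            + chrMat (metricOf p e) r x * chrDot p (varFrame e φ m) ν x)
          - (chrDot p (varFrame e φ m) ν x * chrMat (metricOf p e) r x
            + chrMat (metricOf p e) ν x * chrDot p (varFrame e φ m) r x)))
        * (metricOf p e x)⁻¹) r ν) * |(e x).det|⁻¹
      = ∑ r, pderiv (palatiniFlux (chrDot p (varFrame e φ m))
        (fun y => |(e y).det|⁻¹ • (metricOf p e y)⁻¹) r) r x := by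
    rw [← hpal]
    simp only [Matrix.mul_smul, Matrix.smul_apply, smul_eq_mul, Finset.sum_mul]
    exact Finset.sum_congr rfl fun r _ => Finset.sum_congr rfl fun ν _ => mul_comm _ _
  rw [hRic, ← hP, einsteinDensity, scalarCurvature_eq]
  ring

end

namespace GammaMatrices

variable {N : ℕ} (γ : GammaMatrices k p)

/-- The action is stationary at `(e₀, B₀)` under variations with compact support in `U` of the
frame and the Clifford connection, with `Φ` kept fixed. -/
def IsStationary (U : Set (Coord k)) (e₀ : Coord k → Matrix (Fin (2 * k)) (Fin (2 * k)) ℝ)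
    (B₀ : Coord k → Fin (2 * k) → EndFib k N) (Φ : Coord k → EndFib k N) : Prop :=
  ∀ (K : Set (Coord k)), IsCompact K → K ⊆ U →
  ∀ (δ : ℝ), 0 < δ →
  ∀ (e : ℝ → Coord k → Matrix (Fin (2 * k)) (Fin (2 * k)) ℝ)
    (B : ℝ → Coord k → Fin (2 * k) → EndFib k N),
    SmoothMatOn (fun z : ℝ × Coord k => e z.1 z.2) (Set.Ioo (-δ) δ ×ˢ U) →
    (∀ μ, SmoothMatOn (fun z : ℝ × Coord k => B z.1 z.2 μ) (Set.Ioo (-δ) δ ×ˢ U)) →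
    (∀ t ∈ Set.Ioo (-δ) δ, ∀ x ∈ U, (e t x).det ≠ 0) →
    (∀ t ∈ Set.Ioo (-δ) δ, γ.IsCliffordOn U (e t) (B t)) →
    (∀ x ∈ U, e 0 x = e₀ x ∧ B 0 x = B₀ x) →
    (∀ t ∈ Set.Ioo (-δ) δ, ∀ x ∈ U \ K, e t x = e₀ x ∧ B t x = B₀ x) →
    HasDerivAt (fun t => γ.action U K (e t) (fun x => γ.slashConn (e t) (B t) x + Φ x)) 0 0

variable {γ}

/-- Both connections satisfy the Clifford condition for the same symbol, so their commutators with
it agree. -/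
theorem IsCliffordData.commute_sub_spinConn {U : Set (Coord k)}
    {e : Coord k → Matrix (Fin (2 * k)) (Fin (2 * k)) ℝ}
    {B : Coord k → Fin (2 * k) → EndFib k N} (h : γ.IsCliffordData U e B) {x : Coord k}
    (hx : x ∈ U) (μ a : Fin (2 * k)) :
    γ.gam1 N a * (B x μ - γ.spinConn N e x μ) = (B x μ - γ.spinConn N e x μ) * γ.gam1 N a := by
  refine γ.gam1_commute_of_symbol (h.det_ne x hx) (fun ν => ?_) a
  have h1 := h.clifford x hx μ ν
  rw [← γ.isCliffordOn_spinConn (N := N) h.isOpen h.frame_smooth h.det_ne x hx μ ν] at h1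
  have h2 := add_left_cancel h1
  rw [← sub_eq_zero, ← sub_eq_zero.2 h2.symm]
  noncomm_ring

/-- The added term commutes with the fixed γ^a, hence with the symbol of any frame; it can be
carried along unchanged when the frame varies. -/
theorem IsCliffordOn.add_commute {U : Set (Coord k)}
    {e : Coord k → Matrix (Fin (2 * k)) (Fin (2 * k)) ℝ}
    {B C : Coord k → Fin (2 * k) → EndFib k N} (h : γ.IsCliffordOn U e B)
    (hC : ∀ x ∈ U, ∀ μ a, γ.gam1 N a * C x μ = C x μ * γ.gam1 N a) :
    γ.IsCliffordOn U e (fun x μ => C x μ + B x μ) := by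
  intro x hx μ ν
  rw [← h x hx μ ν, Matrix.add_mul, Matrix.mul_add,
    γ.symbol_commute_of_gam1 (hC x hx μ) e x ν]
  abel

/-- The Euler-Lagrange equations of the Dirac-Lagrangian. -/
theorem IsCliffordData.einstein_equation {U : Set (Coord k)}
    {e : Coord k → Matrix (Fin (2 * k)) (Fin (2 * k)) ℝ}
    {B : Coord k → Fin (2 * k) → EndFib k N} (h : γ.IsCliffordData U e B)
    {Φ : Coord k → EndFib k N} (hΦ : SmoothMatOn Φ U)
    (hanti : ∀ x ∈ U, ∀ a, γ.gam1 N a * Φ x = - (Φ x * γ.gam1 N a)) {β : Coord k → ℝ}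
    (hβ : ContDiffOn ℝ ∞ β U) (hβΦ : ∀ x ∈ U, (Φ x * Φ x).trace = ((β x : ℝ) : ℂ))
    (hst : γ.IsStationary U e B Φ) (m : Matrix (Fin (2 * k)) (Fin (2 * k)) ℝ) {x : Coord k}
    (hx : x ∈ U) :
    einsteinDensity p (- (γ.sgn * (2 ^ k * N) / 4)) β e m x = 0 := by
  set α : ℝ := - (γ.sgn * (2 ^ k * N) / 4) with hα
  have hU := h.isOpen
  have hg := h.isMetricOn
  have hEc : ContinuousOn (einsteinDensity p α β e m) U := by
    have hr : ContDiffOn ℝ ∞ (fun y => scalarCurvature (metricOf p e) y) U := by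
      simp only [scalarCurvature, ricci_apply]
      exact ContDiffOn.sum fun s _ => ContDiffOn.sum fun ν _ =>
        (hg.inv_smooth s ν).mul (ContDiffOn.sum fun r _ => hg.rieMat_smooth r ν r s)
    have hRic : SmoothMatOn (ricci (metricOf p e)) U := by
      intro s ν
      simp only [ricci_apply]
      exact ContDiffOn.sum fun r _ => hg.rieMat_smooth r ν r s
    have htr : ContDiffOn ℝ ∞
        (fun y => (m * ((metricOf p e y)⁻¹ * ricci (metricOf p e) y)).trace) U := by
      simp only [Matrix.trace, Matrix.diag_apply]
      exact ContDiffOn.sum fun i _ =>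
        ((SmoothMatOn.const m).mul (hg.inv_smooth.mul hRic)) i i
    exact (((contDiffOn_const.mul htr).sub (((contDiffOn_const.mul hr).add hβ).mul
      contDiffOn_const)).mul (abs_det_inv_smooth h.frame_smooth h.det_ne)).continuousOn
  -- Fundamental lemma of the calculus of variations: by continuity it suffices to test against
  -- smooth φ with compact support in `U`, and each φ serves as the cut-off of a variation.
  refine MeasureTheory.Measure.eqOn_open_of_ae_eq (μ := MeasureTheory.volume)
    (f := einsteinDensity p α β e m) (g := fun _ => 0) ?_ hU hEc continuousOn_const hx
  rw [Filter.EventuallyEq, MeasureTheory.ae_restrict_iff' hU.measurableSet]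
  refine hU.ae_eq_zero_of_integral_contDiff_smul_eq_zero
    (hEc.locallyIntegrableOn hU.measurableSet) fun φ hφ hφc hφU => ?_
  set K := tsupport φ with hK
  have hKc : IsCompact K := hφc
  obtain ⟨c, hc⟩ := hφ.continuous.bounded_above_of_compact_support hφc
  obtain ⟨ε, hε, hεdet⟩ : ∃ ε > 0, ∀ s : ℝ, |s| < ε → (1 + s • m).det ≠ 0 := by
    have h1 := (hasDerivAt_det_one_add_smul m).continuousAt.eventually_ne
      (y := 0) (by simp)
    obtain ⟨ε, hε, hb⟩ := Metric.eventually_nhds_iff.1 h1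
    exact ⟨ε, hε, fun s hs => hb (by simpa using hs)⟩
  have hc0 : 0 ≤ c := (norm_nonneg _).trans (hc 0)
  -- For |t| < δ one has |tφ| < ε; the + 1 covers c = 0.
  set δ := ε / (c + 1) with hδdef
  have hδ : 0 < δ := by positivity
  have hsmall : ∀ t ∈ Set.Ioo (-δ) δ, ∀ y, (1 + (t * φ y) • m).det ≠ 0 := by
    intro t ht y
    refine hεdet _ ?_
    have ht' : |t| < δ := abs_lt.2 ht
    have hy : |φ y| ≤ c := hc y
    rw [abs_mul]
    calc |t| * |φ y| ≤ |t| * (c + 1) := by gcongr; linarith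
      _ < δ * (c + 1) := by gcongr
      _ = ε := by rw [hδdef]; field_simp
  set E := varFrame e φ m with hE
  have hvar : ∀ t ∈ Set.Ioo (-δ) δ, ∀ y ∈ U, (E t y).det ≠ 0 := by
    intro t ht y hy
    rw [hE, varFrame, Matrix.det_mul]
    exact mul_ne_zero (hsmall t ht y) (h.det_ne y hy)
  have hEs : SmoothMatOn (fun z : ℝ × Coord k => E z.1 z.2) (Set.Ioo (-δ) δ ×ˢ U) :=
    varFrame_smooth h.frame_smooth hφ m _
  have hΩ : IsOpen (Set.Ioo (-δ) δ ×ˢ U) := isOpen_Ioo.prod hU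
  have hdt : ∀ z ∈ Set.Ioo (-δ) δ ×ˢ U, (E z.1 z.2).det ≠ 0 :=
    fun z hz => hvar _ hz.1 _ hz.2
  have hslice : ∀ {V m l : Type} [NormedAddCommGroup V] [NormedSpace ℝ V]
      {f : ℝ × Coord k → Matrix m l V}, SmoothMatOn f (Set.Ioo (-δ) δ ×ˢ U) →
      ∀ t ∈ Set.Ioo (-δ) δ, SmoothMatOn (fun y => f (t, y)) U := fun hf t ht a b =>
    (hf a b).comp (by fun_prop) fun y hy => Set.mk_mem_prod ht hy
  -- The spin connection follows the frame, and the rest of `B`, which commutes with the γ^a, is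
  -- kept. So `B' t` is Clifford for `E t` and equals `B` at t = 0.
  set B' : ℝ → Coord k → Fin (2 * k) → EndFib k N := fun t y μ =>
    (B y μ - γ.spinConn N e y μ) + γ.spinConn N (E t) y μ with hB'
  have h0δ : (0 : ℝ) ∈ Set.Ioo (-δ) δ := ⟨by linarith, hδ⟩
  have hspin := spinConn_family_smooth hΩ hEs hdt γ N
  have hB's : ∀ μ, SmoothMatOn (fun z : ℝ × Coord k => B' z.1 z.2 μ) (Set.Ioo (-δ) δ ×ˢ U) := by
    intro μ
    refine SmoothMatOn.add (SmoothMatOn.sub ?_ ?_) (hspin μ)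
    · exact fun a b => (h.conn_smooth μ a b).comp contDiff_snd.contDiffOn fun z hz => hz.2
    · have h1 : SmoothMatOn (fun y => γ.spinConn N (E 0) y μ) U := hslice (hspin μ) 0 h0δ
      rw [hE, varFrame_zero] at h1
      exact fun a b => (h1 a b).comp contDiff_snd.contDiffOn fun z hz => hz.2
  have hcl : ∀ t ∈ Set.Ioo (-δ) δ, γ.IsCliffordOn U (E t) (B' t) := fun t ht =>
    IsCliffordOn.add_commute (γ.isCliffordOn_spinConn hU (hslice hEs t ht) (hvar t ht))
      fun y hy μ a => h.commute_sub_spinConn hy μ a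
  have hdata : ∀ t ∈ Set.Ioo (-δ) δ, γ.IsCliffordData U (E t) (B' t) := fun t ht =>
    ⟨hU, hslice hEs t ht, hvar t ht, fun μ => hslice (hB's μ) t ht, hcl t ht⟩
  have hE0 : E 0 = e := varFrame_zero e φ m
  have hstat := hst K hKc hφU δ hδ E B' hEs hB's hvar hcl
    (fun y _ => ⟨by rw [hE0], by funext μ; simp only [hB', hE0]; abel⟩)
    (fun t _ y hy => ⟨(varFrame_eventuallyEq e φ m t hy.2).self_of_nhds, by
      funext μ
      simp only [hB', hE, γ.spinConn_congr (varFrame_eventuallyEq e φ m t hy.2)]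
      abel⟩)
  set L : ℝ × Coord k → ℝ := fun z => (α * scalarCurvature (metricOf p (E z.1)) z.2 + β z.2)
    * |(E z.1 z.2).det|⁻¹ with hL
  have hLs : ContDiffOn ℝ ∞ L (Set.Ioo (-δ) δ ×ˢ U) :=
    ((contDiffOn_const.mul (scalarCurvature_family_smooth p hΩ hEs hdt)).add
      (hβ.comp contDiff_snd.contDiffOn fun z hz => hz.2)).mul
      ((hEs.det.abs hdt).inv fun z hz => abs_ne_zero.2 (hdt z hz))
  -- Anticommutation of Φ with the γ^a does not involve the frame, so the formula for the potential
  -- holds for every t with the same Φ.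
  have hact : ∀ t ∈ Set.Ioo (-δ) δ, γ.action U K (E t)
      (fun y => γ.slashConn (E t) (B' t) y + Φ y) = ((∫ y in K, L (t, y) : ℝ) : ℂ) := by
    intro t ht
    rw [action, ← integral_complex_ofReal]
    refine MeasureTheory.setIntegral_congr_fun hKc.measurableSet fun y hy => ?_
    rw [(hdata t ht).diracPotential_eq hΦ hanti (hφU hy), hβΦ y (hφU hy),
      sqrt_abs_det_metricOf, hL, hα]
    push_cast
    ring
  have hJ := hasDerivAt_setIntegral hU hKc hφU hδ hLs
  have hJ0 : (∫ y in K, deriv (fun t => L (t, y)) 0) = 0 := by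
    have h1 : HasDerivAt (fun t => ((∫ y in K, L (t, y) : ℝ) : ℂ))
        ((∫ y in K, deriv (fun t => L (t, y)) 0 : ℝ) : ℂ) 0 := hJ.ofReal_comp
    have h2 := hstat.congr_of_eventuallyEq (Filter.eventuallyEq_of_mem
      (Ioo_mem_nhds h0δ.1 h0δ.2) fun t ht => (hact t ht).symm)
    exact_mod_cast h1.unique h2
  set W := palatiniFlux (chrDot p E) (fun y => |(e y).det|⁻¹ • (metricOf p e y)⁻¹) with hW
  have hWs : ∀ r, ContDiffOn ℝ ∞ (W r) U := by
    intro r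
    have hC : ∀ μ, SmoothMatOn (chrDot p E μ) U := by
      intro μ a b
      have h1 := chrMat_family_smooth p hΩ hEs hdt μ a b
      have h2 := (contDiffOn_fderiv_apply hΩ h1 (1, 0)).comp (s := U)
        (f := fun y => ((0 : ℝ), y)) (by fun_prop) fun y hy => Set.mk_mem_prod h0δ hy
      exact h2.congr fun y hy => (hasDerivAt_slice (differentiableAt_of_contDiffOn h1 hΩ
        (Set.mk_mem_prod h0δ hy))).deriv
    have hd : SmoothMatOn (fun y => |(e y).det|⁻¹ • (metricOf p e y)⁻¹) U :=
      SmoothMatOn.smul (abs_det_inv_smooth h.frame_smooth h.det_ne) hg.inv_smooth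
    exact ContDiffOn.sum fun ν _ => (((hC ν).mul hd) r ν).sub (((hC ν).mul hd) ν r)
  -- Off the support of φ the Christoffel symbols are constant in t, so the flux vanishes.
  have hW0 : ∀ r, ∀ y ∉ K, W r y = 0 := by
    intro r y hy
    have hC0 : ∀ μ, chrDot p E μ y = 0 := by
      intro μ
      ext a b
      simp only [chrDot, hE, Matrix.of_apply,
        fun t => chrMat_congr (p := p) (varFrame_eventuallyEq e φ m t hy) μ]
      exact deriv_const _ _
    simp [hW, palatiniFlux, hC0]
  have hderiv : ∀ y ∈ K, deriv (fun t => L (t, y)) 0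
      = φ y * einsteinDensity p α β e m y + α * ∑ r, pderiv (W r) r y := fun y hy =>
    (hasDerivAt_lagrangian hU h.frame_smooth h.det_ne hφ m hδ hvar α β (hφU hy)).deriv
  rw [MeasureTheory.setIntegral_congr_fun hKc.measurableSet hderiv] at hJ0
  have hpi : ∀ r, MeasureTheory.IntegrableOn (pderiv (W r) r) K := fun r =>
    ((contDiffOn_pderiv hU (hWs r) r).continuousOn.mono hφU).integrableOn_compact hKc
  have hφE : MeasureTheory.IntegrableOn (fun y => φ y * einsteinDensity p α β e m y) K :=
    (hφ.continuous.continuousOn.mul (hEc.mono hφU)).integrableOn_compact hKc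
  rw [MeasureTheory.integral_add hφE
    ((MeasureTheory.integrable_finsetSum _ fun r _ => hpi r).const_mul α),
    MeasureTheory.integral_const_mul, MeasureTheory.integral_finsetSum _ fun r _ => hpi r,
    Finset.sum_eq_zero fun r _ => setIntegral_pderiv_eq_zero hU hKc hφU (hWs r) (hW0 r) r,
    mul_zero, add_zero, MeasureTheory.setIntegral_eq_integral_of_forall_compl_eq_zero
    fun y hy => by rw [image_eq_zero_of_notMem_tsupport hy, zero_mul]] at hJ0
  exact hJ0

/-- The Einstein equation with the trace of `Φ²` as cosmological term. -/
theorem IsCliffordData.ricci_eq (hk : 2 ≤ k) (hN : 1 ≤ N) {U : Set (Coord k)}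
    {e : Coord k → Matrix (Fin (2 * k)) (Fin (2 * k)) ℝ}
    {B : Coord k → Fin (2 * k) → EndFib k N} (h : γ.IsCliffordData U e B)
    {Φ : Coord k → EndFib k N} (hΦ : SmoothMatOn Φ U)
    (hanti : ∀ x ∈ U, ∀ a, γ.gam1 N a * Φ x = - (Φ x * γ.gam1 N a)) {β : Coord k → ℝ}
    (hβ : ContDiffOn ℝ ∞ β U) (hβΦ : ∀ x ∈ U, (Φ x * Φ x).trace = ((β x : ℝ) : ℂ))
    (hst : γ.IsStationary U e B Φ) {x : Coord k} (hx : x ∈ U) :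
    scalarCurvature (metricOf p e) x
        = 4 * (2 * k) * γ.sgn / ((2 * k - 2) * (2 ^ k * N)) * β x
      ∧ ricci (metricOf p e) x
        = (4 * γ.sgn / ((2 * k - 2) * (2 ^ k * N)) * β x) • metricOf p e x := by
  have hg := h.isMetricOn
  set α : ℝ := - (γ.sgn * (2 ^ k * N) / 4) with hα
  set r := scalarCurvature (metricOf p e) x with hr
  have hk' : (2 : ℝ) ≤ k := by exact_mod_cast hk
  have hN' : (1 : ℝ) ≤ N := by exact_mod_cast hN
  have h2k : (0 : ℝ) < 2 ^ k := by positivity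
  have hs := γ.sgn_mul_sgn
  have hs0 : γ.sgn ≠ 0 := left_ne_zero_of_mul_eq_one hs
  have hw : |(e x).det|⁻¹ ≠ 0 := inv_ne_zero (abs_ne_zero.2 (h.det_ne x hx))
  have h1 : ∀ m : Matrix (Fin (2 * k)) (Fin (2 * k)) ℝ,
      2 * α * (m * ((metricOf p e x)⁻¹ * ricci (metricOf p e) x)).trace
        = (α * r + β x) * m.trace := fun m =>
    sub_eq_zero.1 ((mul_eq_zero.1 (h.einstein_equation hΦ hanti hβ hβΦ hst m hx)).resolve_right hw)
  have hrt : ((metricOf p e x)⁻¹ * ricci (metricOf p e) x).trace = r := by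
    rw [hr, scalarCurvature]
    simp only [Matrix.trace, Matrix.diag_apply, Matrix.mul_apply]
    refine Finset.sum_congr rfl fun s _ => Finset.sum_congr rfl fun ν _ => ?_
    rw [← Matrix.transpose_apply (ricci (metricOf p e) x), hg.ricci_symm hx]
  -- m = 1 gives the trace equation 2αr = n(αr + β), solvable for r because n > 2.
  have h2 := h1 1
  rw [Matrix.one_mul, hrt, Matrix.trace_one, Fintype.card_fin] at h2
  push_cast at h2
  have hden : (2 * (k : ℝ) - 2) * (2 ^ k * N) ≠ 0 := by
    have : 0 < (2 * (k : ℝ) - 2) * (2 ^ k * N) := by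
      apply mul_pos <;> nlinarith
    exact this.ne'
  have hrβ : r = 4 * (2 * k) * γ.sgn / ((2 * k - 2) * (2 ^ k * N)) * β x := by
    rw [div_mul_eq_mul_div, eq_div_iff hden]
    rw [hα] at h2
    linear_combination (4 * γ.sgn) * h2 - ((2 * (k : ℝ) - 2) * (2 ^ k * N) * r) * hs
  refine ⟨hrβ, ?_⟩
  have hα0 : α ≠ 0 := by
    rw [hα]
    have : (2 : ℝ) ^ k * N ≠ 0 := right_ne_zero_of_mul hden
    exact neg_ne_zero.2 (div_ne_zero (mul_ne_zero hs0 this) (by norm_num))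
  have hc : α * r + β x = 2 * α * (4 * γ.sgn / ((2 * k - 2) * (2 ^ k * N)) * β x) := by
    have hk0 : (2 * (k : ℝ)) ≠ 0 := by linarith
    apply mul_right_cancel₀ hk0
    rw [← h2, hrβ]
    ring
  have h3 : (metricOf p e x)⁻¹ * ricci (metricOf p e) x
      = (4 * γ.sgn / ((2 * k - 2) * (2 ^ k * N)) * β x) • 1 := by
    ext i j
    -- Elementary matrices read off the entries of g⁻¹ Ric.
    have h4 := h1 (Matrix.single j i 1)
    rw [Matrix.trace_single_mul, hc, mul_assoc (2 * α)] at h4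
    have h5 := mul_left_cancel₀ (mul_ne_zero two_ne_zero hα0) h4
    rw [one_smul] at h5
    rw [h5, Matrix.smul_apply, smul_eq_mul]
    congr 1
    by_cases hij : i = j
    · subst hij; simp
    · rw [Matrix.one_apply_ne hij]
      exact Matrix.trace_single_eq_of_ne j i 1 (Ne.symm hij)
  have h6 : metricOf p e x * _ = metricOf p e x * _ := congrArg (metricOf p e x * ·) h3
  rwa [← Matrix.mul_assoc, hg.mul_inv hx, Matrix.one_mul, Matrix.mul_smul, Matrix.mul_one] at h6

end GammaMatrices

end EinsteinEquation

end DiracGauge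
end

noncomputable section
namespace DiracGauge

/-! ### Smooth local lifts through orbit maps of compact Lie groups. -/

section Lift

/-- A map of constant rank has a smooth local section over its image. -/
theorem exists_contDiffOn_section {E V : Type*} [NormedAddCommGroup E] [NormedSpace ℝ E]
    [FiniteDimensional ℝ E] [NormedAddCommGroup V] [NormedSpace ℝ V] [FiniteDimensional ℝ V]
    {f : E → V} {Ω : Set E} (hΩ : IsOpen Ω) (hf : ContDiffOn ℝ ∞ f Ω) {a : E} (ha : a ∈ Ω)
    (hrank : ∀ u ∈ Ω, Module.finrank ℝ (LinearMap.range (fderiv ℝ f u).toLinearMap)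
      ≤ Module.finrank ℝ (LinearMap.range (fderiv ℝ f a).toLinearMap)) :
    ∃ O ∈ 𝓝 a, ∃ W ∈ 𝓝 (f a), ∃ s : V → E, ContDiffOn ℝ ∞ s W ∧ Set.MapsTo s W Ω ∧
      ∀ u ∈ O, f u ∈ W → f (s (f u)) = f u := by
  have : CompleteSpace E := FiniteDimensional.complete ℝ E
  have hfd : ∀ u ∈ Ω, HasFDerivAt f (fderiv ℝ f u) u := fun u hu =>
    ((hf.contDiffAt (hΩ.mem_nhds hu)).differentiableAt (by simp)).hasFDerivAt
  set T := LinearMap.range (fderiv ℝ f a).toLinearMap with hT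
  set K := LinearMap.ker (fderiv ℝ f a).toLinearMap with hK
  obtain ⟨q₀, hq₀⟩ := T.subtype.exists_leftInverse_of_injective T.ker_subtype
  obtain ⟨P₀, hP₀⟩ := K.subtype.exists_leftInverse_of_injective K.ker_subtype
  set q : V →L[ℝ] T := LinearMap.toContinuousLinearMap q₀
  set P : E →L[ℝ] K := LinearMap.toContinuousLinearMap P₀
  have hq : ∀ y : T, q y = y := fun y => LinearMap.congr_fun hq₀ y
  have hP : ∀ y : K, P y = y := fun y => LinearMap.congr_fun hP₀ y
  -- As in the constant rank theorem: the component of `f` along the range `T` of df(a), together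
  -- with a coordinate along the kernel `K`, is a local diffeomorphism at `a`.
  set Ψ : E → T × K := fun u => (q (f u), P (u - a)) with hΨ
  set L : E → E →L[ℝ] T × K := fun u => (q.comp (fderiv ℝ f u)).prod P with hL
  have hΨd : ∀ u ∈ Ω, HasFDerivAt Ψ (L u) u := fun u hu =>
    (q.hasFDerivAt.comp u (hfd u hu)).prodMk
      (P.hasFDerivAt.comp u ((hasFDerivAt_id u).sub_const a))
  have hΨs : ContDiffOn ℝ ∞ Ψ Ω :=
    (q.contDiff.comp_contDiffOn hf).prodMk
      (P.contDiff.comp_contDiffOn (contDiffOn_id.sub contDiffOn_const))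
  have hinj : Function.Injective (L a) := by
    refine (injective_iff_map_eq_zero (L a)).2 fun u hu => ?_
    have h1 : q (fderiv ℝ f a u) = 0 := congrArg Prod.fst hu
    have h2 : P u = 0 := congrArg Prod.snd hu
    have h3 := hq ⟨fderiv ℝ f a u, LinearMap.mem_range_self (fderiv ℝ f a).toLinearMap u⟩
    have h4 : fderiv ℝ f a u = 0 := by
      rw [h1] at h3
      exact (congrArg Subtype.val h3).symm
    have h5 := hP ⟨u, h4⟩
    rw [h2] at h5
    exact (congrArg Subtype.val h5).symm
  have hdim : Module.finrank ℝ E = Module.finrank ℝ (T × K) := by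
    rw [Module.finrank_prod]
    exact ((fderiv ℝ f a).toLinearMap.finrank_range_add_finrank_ker).symm
  set A : E ≃L[ℝ] T × K :=
    ((L a).toLinearMap.linearEquivOfInjective hinj hdim).toContinuousLinearEquiv with hA
  have hAL : (A : E →L[ℝ] T × K) = L a := by ext1 u; rfl
  have hΨa : ContDiffAt ℝ ∞ Ψ a := hΨs.contDiffAt (hΩ.mem_nhds ha)
  have hΨA : HasFDerivAt Ψ (A : E →L[ℝ] T × K) a := by rw [hAL]; exact hΨd a ha
  set e := hΨa.toOpenPartialHomeomorph Ψ hΨA (by simp) with he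
  have hea : a ∈ e.source := hΨa.mem_toOpenPartialHomeomorph_source hΨA (by simp)
  have heΨ : ∀ u, e u = Ψ u := fun u => rfl
  have hLc : ContinuousAt L a := by
    refine ((hΨs.continuousOn_fderiv_of_isOpen hΩ (by simp)).continuousAt
      (hΩ.mem_nhds ha)).congr ?_
    filter_upwards [hΩ.mem_nhds ha] with u hu using (hΨd u hu).fderiv
  have hS : {u | u ∈ Ω ∧ L u ∈ Set.range ((↑) : (E ≃L[ℝ] T × K) → E →L[ℝ] T × K)} ∈ 𝓝 a :=
    Filter.inter_mem (hΩ.mem_nhds ha) (hLc (by rw [← hAL]; exact A.nhds))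
  have hS' : e.symm ⁻¹' {u | u ∈ Ω ∧
      L u ∈ Set.range ((↑) : (E ≃L[ℝ] T × K) → E →L[ℝ] T × K)} ∩ e.target ∈ 𝓝 (Ψ a) := by
    refine Filter.inter_mem ?_ (e.open_target.mem_nhds (e.map_source hea))
    refine (e.continuousAt_symm (e.map_source hea)) ?_
    rwa [e.left_inv hea]
  obtain ⟨r, hr, hball⟩ := Metric.mem_nhds_iff.1 hS'
  have hΨa0 : Ψ a = (q (f a), 0) := by simp [hΨ]
  rw [hΨa0] at hball
  have hsd : ∀ v ∈ Metric.ball (q (f a), (0 : K)) r, ContDiffAt ℝ ∞ e.symm v := by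
    intro v hv
    obtain ⟨⟨hu, A', hA'⟩, ht⟩ := hball hv
    refine e.contDiffAt_symm (f₀' := A') ht ?_ (hΨs.contDiffAt (hΩ.mem_nhds hu))
    rw [hA']
    exact hΨd _ hu
  -- Near `a` the projection q maps the range of df(u) onto T, and the rank is at most dim T, so q
  -- is injective on that range. A direction moving only the kernel coordinate is killed by q ∘ df,
  -- hence by df.
  have hzero : ∀ v ∈ Metric.ball (q (f a), (0 : K)) r, ∀ c : K, ∃ M : T × K →L[ℝ] V,
      HasFDerivAt (fun v => f (e.symm v)) M v ∧ M (0, c) = 0 := by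
    intro v hv c
    obtain ⟨⟨hu, A', hA'⟩, ht⟩ := hball hv
    have h1 : HasFDerivAt e.symm (A'.symm : T × K →L[ℝ] E) v := by
      refine e.hasFDerivAt_symm ht ?_
      rw [hA']
      exact hΨd _ hu
    refine ⟨_, (hfd _ hu).comp v h1, ?_⟩
    set u := e.symm v
    have hsurj : Function.Surjective
        (q.toLinearMap.domRestrict (LinearMap.range (fderiv ℝ f u).toLinearMap)) := by
      intro y
      refine ⟨⟨fderiv ℝ f u (A'.symm (y, 0)), LinearMap.mem_range_self _ _⟩, ?_⟩
      have h2 : (A' : E →L[ℝ] T × K) (A'.symm (y, 0)) = (y, 0) := A'.apply_symm_apply _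
      rw [hA'] at h2
      exact congrArg Prod.fst h2
    have hinj' := (LinearMap.injective_iff_surjective_of_finrank_eq_finrank
      (le_antisymm (hrank u hu) (LinearMap.finrank_le_finrank_of_surjective hsurj))).2 hsurj
    have h3 : (A' : E →L[ℝ] T × K) (A'.symm (0, c)) = (0, c) := A'.apply_symm_apply _
    rw [hA'] at h3
    have h4 : q (fderiv ℝ f u (A'.symm (0, c))) = 0 := congrArg Prod.fst h3
    exact congrArg Subtype.val ((injective_iff_map_eq_zero _).1 hinj'
      ⟨fderiv ℝ f u (A'.symm (0, c)), LinearMap.mem_range_self _ _⟩ h4)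
  -- So f does not depend on the kernel coordinate near `a`, and setting that coordinate to 0
  -- defines the section.
  have hconst : ∀ w ∈ Metric.ball (q (f a)) r, ∀ c ∈ Metric.ball (0 : K) r,
      f (e.symm (w, c)) = f (e.symm (w, 0)) := by
    intro w hw c hc
    have hmem : ∀ c ∈ Metric.ball (0 : K) r, (w, c) ∈ Metric.ball (q (f a), (0 : K)) r := by
      intro c hc
      rw [← ball_prod_same]
      exact ⟨hw, hc⟩
    have hin : ∀ c : K, HasFDerivAt (fun c : K => (w, c)) (ContinuousLinearMap.inr ℝ T K) c :=
      fun c => hasFDerivAt_prodMk_right w c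
    refine (convex_ball (0 : K) r).is_const_of_fderivWithin_eq_zero (𝕜 := ℝ)
      (f := fun c => f (e.symm (w, c))) ?_ ?_ hc (Metric.mem_ball_self hr)
    · intro c hc
      obtain ⟨M, hM, -⟩ := hzero _ (hmem c hc) c
      exact (hM.comp c (hin c)).differentiableAt.differentiableWithinAt
    · intro c hc
      rw [fderivWithin_of_isOpen Metric.isOpen_ball hc]
      ext d
      obtain ⟨M, hM, h0⟩ := hzero _ (hmem c hc) d
      have := (hM.comp c (hin c)).fderiv
      rw [Function.comp_def] at this
      rw [this]
      exact h0
  have hqs : ∀ y ∈ q ⁻¹' Metric.ball (q (f a)) r,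
      (q y, (0 : K)) ∈ Metric.ball (q (f a), (0 : K)) r := by
    intro y hy
    rw [← ball_prod_same]
    exact ⟨hy, Metric.mem_ball_self hr⟩
  refine ⟨e.source ∩ Ψ ⁻¹' Metric.ball (q (f a), (0 : K)) r, ?_, q ⁻¹' Metric.ball (q (f a)) r,
    q.continuous.continuousAt (Metric.ball_mem_nhds _ hr), fun y => e.symm (q y, 0), ?_,
    fun y hy => (hball (hqs y hy)).1.1, ?_⟩
  · refine Filter.inter_mem (e.open_source.mem_nhds hea) (hΨa.continuousAt ?_)
    rw [hΨa0]
    exact Metric.ball_mem_nhds _ hr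
  · intro y hy
    exact ((hsd _ (hqs y hy)).comp y
      (q.contDiff.prodMk contDiff_const).contDiffAt).contDiffWithinAt
  · rintro u ⟨hu, hub⟩ -
    have h1 : Ψ u ∈ Metric.ball (q (f a)) r ×ˢ Metric.ball (0 : K) r := by
      rw [ball_prod_same]; exact hub
    have h2 := hconst _ h1.1 _ h1.2
    have h3 : e.symm ((Ψ u).1, (Ψ u).2) = u := e.left_inv hu
    rw [h3] at h2
    exact h2.symm

variable {EG : Type*} [NormedAddCommGroup EG] [NormedSpace ℝ EG] [FiniteDimensional ℝ EG]
  {G : Type*} [TopologicalSpace G] [ChartedSpace EG G] [Group G]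
  [LieGroup 𝓘(ℝ, EG) ∞ G] [CompactSpace G]
  {V : Type*} [NormedAddCommGroup V] [NormedSpace ℝ V] [FiniteDimensional ℝ V]

/-- Smooth local sections of an orbit map of a compact Lie group. -/
theorem exists_contMDiffOn_orbit_section (τ : G →* Module.End ℝ V) (z : V)
    (hτ : ContMDiff 𝓘(ℝ, EG) 𝓘(ℝ, V) ∞ fun g => τ g z) :
    ∃ W ∈ 𝓝 z, ∃ s : V → G, ContMDiffOn 𝓘(ℝ, V) 𝓘(ℝ, EG) ∞ s W ∧
      ∀ g, τ g z ∈ W → τ (s (τ g z)) z = τ g z := by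
  have hIM : IsManifold 𝓘(ℝ, EG) ∞ G := inferInstance
  set c := chartAt EG (1 : G) with hc
  have h1c : (1 : G) ∈ c.source := mem_chart_source EG 1
  have hcs : ContMDiffOn 𝓘(ℝ, EG) 𝓘(ℝ, EG) ∞ c c.source := contMDiffOn_chart
  have hci : ContMDiffOn 𝓘(ℝ, EG) 𝓘(ℝ, EG) ∞ c.symm c.target := contMDiffOn_chart_symm
  set f : EG → V := fun u => τ (c.symm u) z with hf
  have hfs : ContDiffOn ℝ ∞ f c.target :=
    contMDiffOn_iff_contDiffOn.1 (hτ.comp_contMDiffOn hci)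
  have hfa : f (c 1) = z := by simp [hf, c.left_inv h1c]
  -- Equivariance: near `u` the orbit map is τ(g) ∘ f ∘ t with t the left translation by g⁻¹ in the
  -- chart, so its rank at `u` is at most its rank at the identity.
  have hrank : ∀ u ∈ c.target, Module.finrank ℝ (LinearMap.range (fderiv ℝ f u).toLinearMap)
      ≤ Module.finrank ℝ (LinearMap.range (fderiv ℝ f (c 1)).toLinearMap) := by
    intro u hu
    set g := c.symm u with hg
    set t : EG → EG := fun u' => c (g⁻¹ * c.symm u') with ht
    have hsymm : ContMDiffAt 𝓘(ℝ, EG) 𝓘(ℝ, EG) ∞ c.symm u :=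
      (hci u hu).contMDiffAt (c.open_target.mem_nhds hu)
    have hmul : ContMDiffAt 𝓘(ℝ, EG) 𝓘(ℝ, EG) ∞ (fun u' => g⁻¹ * c.symm u') u :=
      (contMDiff_mul_left (I := 𝓘(ℝ, EG)) (n := ∞) (a := g⁻¹)).contMDiffAt.comp u hsymm
    have h1 : g⁻¹ * c.symm u = 1 := by rw [← hg]; simp
    have hts : ContDiffAt ℝ ∞ t u := by
      refine contMDiffAt_iff_contDiffAt.1 (ContMDiffAt.comp u (g := c) ?_ hmul)
      rw [h1]
      exact (hcs 1 h1c).contMDiffAt (c.open_source.mem_nhds h1c)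
    have htu : t u = c 1 := by rw [ht]; simp only [h1]
    have hev : f =ᶠ[𝓝 u] fun u' => (LinearMap.toContinuousLinearMap (τ g)) (f (t u')) := by
      have h2 : ∀ᶠ u' in 𝓝 u, g⁻¹ * c.symm u' ∈ c.source :=
        hmul.continuousAt.eventually_mem (by rw [h1]; exact c.open_source.mem_nhds h1c)
      filter_upwards [h2] with u' hu'
      rw [LinearMap.coe_toContinuousLinearMap']
      simp only [hf, ht, c.left_inv hu']
      rw [← Module.End.mul_apply, ← map_mul, mul_inv_cancel_left]
    have hfd : HasFDerivAt f (fderiv ℝ f (c 1)) (t u) := by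
      rw [htu]
      exact ((hfs.contDiffAt (c.open_target.mem_nhds (c.map_source h1c))).differentiableAt
        (by simp)).hasFDerivAt
    have hd := ((LinearMap.toContinuousLinearMap (τ g)).hasFDerivAt.comp u
      (hfd.comp u (hts.differentiableAt (by simp)).hasFDerivAt)).congr_of_eventuallyEq hev
    rw [hd.fderiv]
    refine le_trans ?_ (Submodule.finrank_map_le (τ g) _)
    refine Submodule.finrank_mono ?_
    rintro _ ⟨v, rfl⟩
    exact Submodule.mem_map_of_mem (LinearMap.mem_range_self _ _)
  obtain ⟨O, hO, W, hW, s, hs, hsW, hfsec⟩ :=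
    exists_contDiffOn_section c.open_target hfs (c.map_source h1c) hrank
  rw [hfa] at hW
  obtain ⟨O', hO'O, hO'o, h1O'⟩ := mem_nhds_iff.1
    (Filter.inter_mem (c.continuousAt h1c hO) (c.open_source.mem_nhds h1c))
  -- The section is only known to work for elements of O'. `C` collects those that no right
  -- translation by the stabilizer of z brings into O'. By compactness its image is closed, and it
  -- misses z, so `W` can be shrunk to avoid it.
  set C : Set G := {g | ∃ h, τ h z = z ∧ g * h ∈ O'}ᶜ with hC
  have hCc : IsClosed C := by
    rw [hC, isClosed_compl_iff]
    have : {g | ∃ h, τ h z = z ∧ g * h ∈ O'}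
        = ⋃ h ∈ {h | τ h z = z}, (fun g => g * h) ⁻¹' O' := by
      ext g; simp
    rw [this]
    refine isOpen_biUnion fun h _ => hO'o.preimage ?_
    exact (contMDiff_mul_right (I := 𝓘(ℝ, EG)) (n := ∞) (a := h)).continuous
  have hz : z ∉ (fun g => τ g z) '' C := by
    rintro ⟨g, hg, hgz⟩
    refine hg ⟨g⁻¹, ?_, by simpa using h1O'⟩
    have h2 : τ g⁻¹ (τ g z) = z := by
      rw [← Module.End.mul_apply, ← map_mul]; simp
    simp only at hgz
    rwa [hgz] at h2
  refine ⟨W ∩ ((fun g => τ g z) '' C)ᶜ, Filter.inter_mem hW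
    ((hCc.isCompact.image hτ.continuous).isClosed.isOpen_compl.mem_nhds hz),
    fun y => c.symm (s y), ?_, ?_⟩
  · exact (hci.comp (contMDiffOn_iff_contDiffOn.2 hs) hsW).mono Set.inter_subset_left
  · rintro g ⟨hgW, hgC⟩
    have hg : g ∉ C := fun h => hgC ⟨g, h, rfl⟩
    rw [hC, Set.notMem_compl_iff] at hg
    obtain ⟨h, hh, hgh⟩ := hg
    obtain ⟨hO1, hO2⟩ := hO'O hgh
    have h3 : f (c (g * h)) = τ g z := by
      simp only [hf, c.left_inv hO2]
      rw [map_mul, Module.End.mul_apply, hh]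
    have h4 := hfsec _ hO1 (by rwa [h3])
    rw [h3] at h4
    exact h4

/-- A smooth map into an orbit of a compact Lie group lifts locally to the group. -/
theorem exists_contMDiffOn_lift {E' H' X : Type*} [NormedAddCommGroup E'] [NormedSpace ℝ E']
    [TopologicalSpace H'] {I : ModelWithCorners ℝ E' H'} [TopologicalSpace X]
    [ChartedSpace H' X] (τ : G →* Module.End ℝ V) (z : V)
    (hτ : ContMDiff 𝓘(ℝ, EG) 𝓘(ℝ, V) ∞ fun g => τ g z) {f : X → V} {S : Set X}
    (hS : IsOpen S) (hf : ContMDiffOn I 𝓘(ℝ, V) ∞ f S) (horb : ∀ x ∈ S, ∃ g, f x = τ g z)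
    {a : X} (ha : a ∈ S) :
    ∃ O ⊆ S, IsOpen O ∧ a ∈ O ∧ ∃ h : X → G, ContMDiffOn I 𝓘(ℝ, EG) ∞ h O ∧
      ∀ x ∈ O, f x = τ (h x) z := by
  obtain ⟨W, hW, s, hs, hsec⟩ := exists_contMDiffOn_orbit_section τ z hτ
  -- Translation by `g₀⁻¹` moves the value at `a` to z, where a section exists.
  obtain ⟨g₀, hg₀⟩ := horb a ha
  have hinv : ∀ g y, τ g⁻¹ (τ g y) = y := fun g y => by
    rw [← Module.End.mul_apply, ← map_mul]; simp
  have hf' : ContMDiffOn I 𝓘(ℝ, V) ∞ (fun x => τ g₀⁻¹ (f x)) S :=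
    (LinearMap.toContinuousLinearMap (τ g₀⁻¹)).contMDiff.comp_contMDiffOn hf
  refine ⟨S ∩ (fun x => τ g₀⁻¹ (f x)) ⁻¹' interior W, Set.inter_subset_left,
    hf'.continuousOn.isOpen_inter_preimage hS isOpen_interior, ⟨ha, ?_⟩,
    fun x => g₀ * s (τ g₀⁻¹ (f x)), ?_, ?_⟩
  · rw [Set.mem_preimage, hg₀, hinv]
    exact mem_interior_iff_mem_nhds.2 hW
  · exact (contMDiff_mul_left (I := 𝓘(ℝ, EG)) (n := ∞) (a := g₀)).comp_contMDiffOn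
      ((hs.mono interior_subset).comp (hf'.mono Set.inter_subset_left) fun x hx => hx.2)
  · rintro x ⟨hx, hxW⟩
    obtain ⟨g, hg⟩ := horb x hx
    have h1 : τ g₀⁻¹ (f x) = τ (g₀⁻¹ * g) z := by rw [hg, map_mul, Module.End.mul_apply]
    have h2 : τ (s (τ g₀⁻¹ (f x))) z = τ g₀⁻¹ (f x) := by
      rw [h1]
      exact hsec _ (by rw [← h1]; exact interior_subset hxW)
    rw [map_mul, Module.End.mul_apply, h2, ← Module.End.mul_apply, ← map_mul]
    simp

end Lift

end DiracGauge
end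

noncomputable section
namespace DiracGauge

/-! ### The zero order operator on the fermion bundle. -/

section Bundles

variable {k p N : ℕ} {EG : Type*} [NormedAddCommGroup EG] [NormedSpace ℝ EG]
  {G : Type*} [TopologicalSpace G] [ChartedSpace EG G] [Group G]
  {M : Type*} [TopologicalSpace M] [ChartedSpace (Coord k) M] {ι : Type*}
  {γ : GammaMatrices k p} {R : FermionRep (EG := EG) G N}

namespace FermionRep

theorem mat_one : R.mat 1 = 1 := by simp [mat]

theorem mat_mul (g h : G) : R.mat (g * h) = R.mat g * R.mat h := by simp [mat]

theorem mat_mul_mat_inv (g : G) : R.mat g * R.mat g⁻¹ = 1 := by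
  rw [← mat_mul, mul_inv_cancel, mat_one]

theorem mat_inv_mul_mat (g : G) : R.mat g⁻¹ * R.mat g = 1 := by
  rw [← mat_mul, inv_mul_cancel, mat_one]

variable (R) in
/-- The action of the structure group on `M_N(ℂ)` by conjugation. -/
def conj : G →* Module.End ℝ (Fin N → Fin N → ℂ) where
  toFun g :=
    { toFun := fun y : Matrix (Fin N) (Fin N) ℂ => R.mat g * y * R.mat g⁻¹
      map_add' := fun (y z : Matrix (Fin N) (Fin N) ℂ) =>
        show R.mat g * (y + z) * R.mat g⁻¹ = R.mat g * y * R.mat g⁻¹ + R.mat g * z * R.mat g⁻¹ by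
          rw [Matrix.mul_add, Matrix.add_mul]
      map_smul' := fun c (y : Matrix (Fin N) (Fin N) ℂ) =>
        show R.mat g * (c • y) * R.mat g⁻¹ = c • (R.mat g * y * R.mat g⁻¹) by
          rw [Matrix.mul_smul, Matrix.smul_mul] }
  map_one' := by
    refine LinearMap.ext fun (y : Matrix (Fin N) (Fin N) ℂ) => ?_
    change R.mat 1 * y * R.mat 1⁻¹ = y
    rw [inv_one, mat_one, Matrix.one_mul, Matrix.mul_one]
  map_mul' g h := by
    refine LinearMap.ext fun (y : Matrix (Fin N) (Fin N) ℂ) => ?_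
    change R.mat (g * h) * y * R.mat (g * h)⁻¹ = R.mat g * (R.mat h * y * R.mat h⁻¹) * R.mat g⁻¹
    rw [mul_inv_rev, mat_mul, mat_mul]
    simp only [Matrix.mul_assoc]

theorem conj_apply (g : G) (y : Matrix (Fin N) (Fin N) ℂ) :
    R.conj g y = R.mat g * y * R.mat g⁻¹ := rfl

theorem mem_isotropy_of_conj {u : G} {z : Matrix (Fin N) (Fin N) ℂ} (h : R.conj u z = z) :
    u ∈ R.isotropy z := by
  change R.mat u * z = z * R.mat u
  have h0 : R.mat u * z * R.mat u⁻¹ = z := h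
  have h1 := congrArg (· * R.mat u) h0
  simpa only [Matrix.mul_assoc, mat_inv_mul_mat, Matrix.mul_one] using h1

theorem contMDiff_conj [LieGroup 𝓘(ℝ, EG) ∞ G] (z : Matrix (Fin N) (Fin N) ℂ) :
    ContMDiff 𝓘(ℝ, EG) 𝓘(ℝ, Fin N → Fin N → ℂ) ∞ fun g => R.conj g z := by
  refine contMDiff_pi_space.2 fun a => contMDiff_pi_space.2 fun b => ?_
  have h1 : ∀ a b, ContMDiff 𝓘(ℝ, EG) 𝓘(ℝ, ℂ) ∞ fun g => R.mat g a b := R.smooth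
  have h2 : ∀ a b, ContMDiff 𝓘(ℝ, EG) 𝓘(ℝ, ℂ) ∞ fun g => R.mat g⁻¹ a b := fun a b =>
    (h1 a b).comp (contMDiff_inv 𝓘(ℝ, EG) ∞)
  have h3 : ContDiff ℝ ∞ fun w : ((Fin N → Fin N → ℂ) × (Fin N → Fin N → ℂ)) =>
      ∑ c, (∑ d, w.1 a d * z d c) * w.2 c b := by fun_prop
  have h4 : ContMDiff 𝓘(ℝ, EG) 𝓘(ℝ, (Fin N → Fin N → ℂ) × (Fin N → Fin N → ℂ)) ∞
      fun g => ((fun i j => R.mat g i j, fun i j => R.mat g⁻¹ i j) :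
        (Fin N → Fin N → ℂ) × (Fin N → Fin N → ℂ)) :=
    (contMDiff_pi_space.2 fun i => contMDiff_pi_space.2 fun j => h1 i j).prodMk_space
      (contMDiff_pi_space.2 fun i => contMDiff_pi_space.2 fun j => h2 i j)
  refine (h3.contMDiff.comp h4).congr fun g => ?_
  simp [conj_apply, Matrix.mul_apply]

end FermionRep

theorem GammaMatrices.massPart_smooth {U : Set (Coord k)} {Φ : Coord k → EndFib k N}
    (hΦ : SmoothMatOn Φ U) : SmoothMatOn (fun y => γ.massPart (Φ y)) U := fun a b =>
  contDiffOn_const.mul (ContDiffOn.sum fun s _ => ((SmoothMatOn.const _).mul hΦ) (s, a) (s, b))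

theorem kronecker_commute {m n : Type*} [Fintype m] [Fintype n] [DecidableEq m] [DecidableEq n]
    (X : Matrix m m ℂ) (Y : Matrix n n ℂ) :
    (X ⊗ₖ (1 : Matrix n n ℂ)) * ((1 : Matrix m m ℂ) ⊗ₖ Y)
      = ((1 : Matrix m m ℂ) ⊗ₖ Y) * (X ⊗ₖ (1 : Matrix n n ℂ)) := by
  rw [← Matrix.mul_kronecker_mul, ← Matrix.mul_kronecker_mul]
  simp only [Matrix.one_mul, Matrix.mul_one]

/-- A Clifford connection is the spin connection plus a term 1 ⊗ (·), both commuting with γ_M ⊗ 1,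
while the symbol anticommutes with it. -/
theorem GammaMatrices.IsCliffordData.slashConn_mul_gammaM (hk : 1 ≤ k) {U : Set (Coord k)}
    {e : Coord k → Matrix (Fin (2 * k)) (Fin (2 * k)) ℝ}
    {B : Coord k → Fin (2 * k) → EndFib k N} (h : γ.IsCliffordData U e B) {x : Coord k}
    (hx : x ∈ U) :
    γ.slashConn e B x * (γ.gammaM ⊗ₖ (1 : Matrix (Fin N) (Fin N) ℂ))
      = - ((γ.gammaM ⊗ₖ (1 : Matrix (Fin N) (Fin N) ℂ)) * γ.slashConn e B x) := by
  have hB : ∀ μ, B x μ * (γ.gammaM ⊗ₖ (1 : Matrix (Fin N) (Fin N) ℂ))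
      = (γ.gammaM ⊗ₖ (1 : Matrix (Fin N) (Fin N) ℂ)) * B x μ := by
    intro μ
    have h1 := γ.eq_one_kronecker_of_commute (h.commute_sub_spinConn hx μ)
    have h2 : B x μ = (1 : Matrix (Fin (2 ^ k)) (Fin (2 ^ k)) ℂ)
        ⊗ₖ spinorTrace (B x μ - γ.spinConn N e x μ) + γ.spinConn N e x μ := by
      rw [← h1, sub_add_cancel]
    rw [h2, Matrix.add_mul, Matrix.mul_add, γ.spinConn_mul_gammaM hk, kronecker_commute]
  have hs : ∀ μ, γ.symbol N e μ x * (γ.gammaM ⊗ₖ (1 : Matrix (Fin N) (Fin N) ℂ))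
      = - ((γ.gammaM ⊗ₖ (1 : Matrix (Fin N) (Fin N) ℂ)) * γ.symbol N e μ x) := by
    intro μ
    rw [GammaMatrices.symbol, ← Matrix.mul_kronecker_mul, ← Matrix.mul_kronecker_mul,
      γ.slash_mul_gammaM hk]
    ext s t
    simp [Matrix.kroneckerMap_apply]
  rw [GammaMatrices.slashConn, Matrix.sum_mul, Matrix.mul_sum, ← Finset.sum_neg_distrib]
  refine Finset.sum_congr rfl fun μ _ => ?_
  rw [Matrix.mul_assoc, hB, ← Matrix.mul_assoc, hs, Matrix.neg_mul, Matrix.mul_assoc]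

namespace DiracOperator

variable {F : FermionBundle γ R M ι} {D : DiracOperator F} {A : Connection F}

theorem slashConn_add_zeroOrder (i : ι) :
    (fun y => γ.slashConn (D.e i) (A.B i) y + D.zeroOrder A i y) = D.b i := by
  funext y
  rw [zeroOrder, add_sub_cancel]

theorem zeroOrder_smooth (i : ι) : SmoothMatOn (D.zeroOrder A i) (F.chart i).target :=
  (D.b_smooth i).sub
    (SmoothMatOn.sum _ fun μ _ => (γ.symbol_smooth (D.e_smooth i) μ).mul (A.smooth i μ))

/-- The zero order operator `D - γ ∘ ∇_A` is compatible with the changes of trivialization. -/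
theorem zeroOrder_mul_trans (i j : ι) {x : Coord k} (hx : x ∈ F.overlap i j) :
    D.zeroOrder A i x * F.trans i j x = F.trans i j x * D.zeroOrder A j (F.coordChange i j x) := by
  refine Matrix.ext_of_mulVec_single fun c => ?_
  set v : Fib k N := Pi.single c 1
  set y := F.coordChange i j x with hy
  -- ψ has value v and vanishing covariant derivative at `y`, so both local Dirac operators reduce
  -- to their zero order parts.
  set ψ : Coord k → Fib k N := fun y' => v - ∑ μ, linearTest y μ (A.B j y μ *ᵥ v) y' with hψ
  have hψs : ContDiff ℝ ∞ ψ :=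
    contDiff_const.sub (ContDiff.sum fun μ _ => contDiff_linearTest y μ _)
  have hψy : ψ y = v := by simp [hψ, linearTest_self]
  have hψd : ∀ w, fderiv ℝ ψ y w = - (∑ μ, w μ • A.B j y μ) *ᵥ v := by
    intro w
    have h1 : HasFDerivAt ψ (- ∑ μ, (EuclideanSpace.proj μ : Coord k →L[ℝ] ℝ).smulRight
        (A.B j y μ *ᵥ v)) y := by
      refine (HasFDerivAt.fun_sum fun μ _ => ?_).const_sub v
      exact ((EuclideanSpace.proj μ : Coord k →L[ℝ] ℝ).hasFDerivAt.sub_const (y μ)).smul_const _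
    rw [h1.fderiv, Matrix.neg_mulVec, Matrix.sum_mulVec]
    simp [Matrix.smul_mulVec]
  have hcov : ∀ μ, covDeriv (A.B i) (F.transport i j ψ) μ x = 0 := by
    intro μ
    have h1 := A.compatible i j ψ hψs.contDiffOn x hx (EuclideanSpace.single μ 1) _ rfl
    rw [← hy, hψd, hψy, Matrix.neg_mulVec, neg_add_cancel, Matrix.mulVec_zero] at h1
    rw [← h1, covDeriv, pderiv]
    congr 2
    simp
  have hcov' : ∀ μ, covDeriv (A.B j) ψ μ y = 0 := by
    intro μ
    rw [covDeriv, pderiv, hψd, hψy, Matrix.neg_mulVec]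
    simp
  have h2 := D.compatible i j ψ hψs.contDiffOn x hx
  rw [← slashConn_add_zeroOrder (A := A) i, ← slashConn_add_zeroOrder (A := A) j, γ.localOp_eq,
    γ.localOp_eq] at h2
  simp only [← hy, hcov, hcov', Matrix.mulVec_zero, Finset.sum_const_zero, zero_add, hψy,
    FermionBundle.transport, Matrix.mulVec_mulVec] at h2
  exact h2

section Simple

variable (hD : D.IsSimpleType A)

include hD

theorem IsSimpleType.isCliffordData (i : ι) :
    γ.IsCliffordData (F.chart i).target (D.e i) (A.B i) :=
  ⟨(F.chart i).open_target, D.e_smooth i, D.e_invertible i, A.smooth i, hD.1 i⟩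

theorem IsSimpleType.zeroOrder_anticommute (i : ι) {x : Coord k} (hx : x ∈ (F.chart i).target)
    (a : Fin (2 * k)) :
    γ.gam1 N a * D.zeroOrder A i x = - (D.zeroOrder A i x * γ.gam1 N a) := by
  obtain ⟨Q, hQ⟩ := hD.2 i
  rw [← slashConn_add_zeroOrder (A := A) i] at hQ
  exact (hD.isCliffordData i).anticommute_of_isLichnerowicz (zeroOrder_smooth i) hQ hx a

variable (hk : 1 ≤ k) (hp : p ≤ 2 * k)

include hk hp

theorem IsSimpleType.zeroOrder_eq (i : ι) {x : Coord k} (hx : x ∈ (F.chart i).target) :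
    D.zeroOrder A i x = γ.gammaM ⊗ₖ γ.massPart (D.zeroOrder A i x) :=
  γ.eq_gammaM_kronecker_of_anticommute hk hp (hD.zeroOrder_anticommute i hx)

/-- γ_M commutes with the spin part u of the transition function; multiplying the intertwining
relation by u⁻¹ γ_M and taking the partial trace removes the spinor factor. -/
theorem IsSimpleType.massPart_compatible (i j : ι) {x : Coord k} (hx : x ∈ F.overlap i j) :
    γ.massPart (D.zeroOrder A i x) = R.mat (F.g i j ((F.chart i).symm x))
      * γ.massPart (D.zeroOrder A j (F.coordChange i j x))
      * R.mat (F.g i j ((F.chart i).symm x))⁻¹ := by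
  have hs : (F.chart i).symm x ∈ (F.chart i).source ∩ (F.chart j).source :=
    ⟨(F.chart i).map_target hx.1, hx.2⟩
  have h1 := zeroOrder_mul_trans (D := D) (A := A) i j hx
  rw [hD.zeroOrder_eq hk hp i hx.1, hD.zeroOrder_eq hk hp j (x := F.coordChange i j x)
      ((F.chart j).map_source hs.2),
    FermionBundle.trans, ← Matrix.mul_kronecker_mul, ← Matrix.mul_kronecker_mul,
    γ.spin_mul_gammaM hk (F.S_spin i j _ hs)] at h1
  set u := F.S i j ((F.chart i).symm x)
  have h2 := congrArg (fun Z => spinorTrace (((((u⁻¹ :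
    (Matrix (Fin (2 ^ k)) (Fin (2 ^ k)) ℂ)ˣ) : Matrix (Fin (2 ^ k)) (Fin (2 ^ k)) ℂ) * γ.gammaM)
    ⊗ₖ (1 : Matrix (Fin N) (Fin N) ℂ)) * Z)) h1
  have h3 : ((u⁻¹ : (Matrix (Fin (2 ^ k)) (Fin (2 ^ k)) ℂ)ˣ) :
      Matrix (Fin (2 ^ k)) (Fin (2 ^ k)) ℂ) * γ.gammaM * (γ.gammaM * u) = 1 := by
    rw [Matrix.mul_assoc, ← Matrix.mul_assoc γ.gammaM, γ.gammaM_mul_self hp, Matrix.one_mul,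
      Units.inv_mul]
  simp only [← Matrix.mul_kronecker_mul, h3, Matrix.one_mul, spinorTrace_one_kronecker] at h2
  rw [← h2, Matrix.mul_assoc, FermionRep.mat_mul_mat_inv, Matrix.mul_one]

/-- Oddness of D equates Y = 1 ⊗ (χ𝒟 + 𝒟χ) with −(ΓX + XΓ), where Γ = γ_M ⊗ χ and X is the zero
order part of γ∘∇_A. Now γ_M ⊗ 1 commutes with Y and Γ but anticommutes with X, so it both commutes
and anticommutes with Y; being invertible, it forces Y = 0. -/
theorem IsSimpleType.massPart_odd (i : ι) {x : Coord k} (hx : x ∈ (F.chart i).target) :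
    R.chi * γ.massPart (D.zeroOrder A i x) = - (γ.massPart (D.zeroOrder A i x) * R.chi) := by
  set d := γ.massPart (D.zeroOrder A i x) with hd
  set P := γ.gammaM ⊗ₖ (1 : Matrix (Fin N) (Fin N) ℂ) with hP
  set X := γ.slashConn (D.e i) (A.B i) x with hX
  set Γ := γ.gammaM ⊗ₖ R.chi with hΓ
  set Y := (1 : Matrix (Fin (2 ^ k)) (Fin (2 ^ k)) ℂ) ⊗ₖ (R.chi * d + d * R.chi) with hY
  have hPP : P * P = 1 := by
    rw [hP, ← Matrix.mul_kronecker_mul, γ.gammaM_mul_self hp, Matrix.one_mul,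
      Matrix.one_kronecker_one]
  have hXP : X * P = - (P * X) := (hD.isCliffordData i).slashConn_mul_gammaM hk hx
  have hΓP : Γ * P = P * Γ := by
    rw [hΓ, hP, ← Matrix.mul_kronecker_mul, ← Matrix.mul_kronecker_mul, Matrix.mul_one,
      Matrix.one_mul]
  have hb : D.b i x = X + γ.gammaM ⊗ₖ d := by
    rw [hd, ← hD.zeroOrder_eq hk hp i hx, ← slashConn_add_zeroOrder (A := A) i]
  have hYeq : Γ * (γ.gammaM ⊗ₖ d) + (γ.gammaM ⊗ₖ d) * Γ = Y := by
    rw [hΓ, hY, ← Matrix.mul_kronecker_mul, ← Matrix.mul_kronecker_mul, γ.gammaM_mul_self hp,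
      ← Matrix.kronecker_add]
  have hodd := D.odd i x hx
  rw [hb] at hodd
  have hZ : Y = - (Γ * X + X * Γ) := by
    rw [← hYeq, ← sub_eq_zero, ← sub_eq_zero.2 hodd]
    noncomm_ring
  have h1 : P * Y = Y * P := kronecker_commute _ _
  have h2 : P * Y = - (Y * P) := by
    rw [hZ, Matrix.mul_neg, Matrix.neg_mul, neg_neg, Matrix.mul_add, Matrix.add_mul,
      Matrix.mul_assoc Γ, hXP, Matrix.mul_assoc X, hΓP, Matrix.mul_neg, ← Matrix.mul_assoc Γ, hΓP,
      ← Matrix.mul_assoc X, hXP]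
    noncomm_ring
  have h3 : P * Y = 0 := by
    have h4 : (2 : ℂ) • (P * Y) = 0 := by
      rw [two_smul]
      nth_rewrite 1 [h2]
      rw [h1, neg_add_cancel]
    exact (smul_eq_zero.1 h4).resolve_left two_ne_zero
  have h5 : Y = 0 := by
    rw [← Matrix.one_mul Y, ← hPP, Matrix.mul_assoc, h3, Matrix.mul_zero]
  have h6 : R.chi * d + d * R.chi = 0 := by
    rw [← spinorTrace_one_kronecker (k := k) (R.chi * d + d * R.chi), ← hY, h5]
    ext a b
    simp [spinorTrace]
  exact eq_neg_of_add_eq_zero_left h6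

theorem IsSimpleType.massPart_hermitian {σ : ℝ} (i : ι) {x : Coord k}
    (hx : x ∈ (F.chart i).target) (hherm : (D.zeroOrder A i x)ᴴ = σ • D.zeroOrder A i x) :
    (γ.massPart (D.zeroOrder A i x))ᴴ = σ • γ.massPart (D.zeroOrder A i x) := by
  rw [hD.zeroOrder_eq hk hp i hx, Matrix.conjTranspose_kronecker, γ.gammaM_hermitian hp,
    ← Matrix.kronecker_smul] at hherm
  have h1 := congrArg γ.massPart hherm
  rwa [γ.massPart_gammaM_kronecker hp, γ.massPart_gammaM_kronecker hp] at h1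

variable (D A) in
/-- The factor `𝒟` of the zero order operator `γ_M ⊗ 𝒟` of a Dirac operator of simple type. -/
def massSection : OddClSection F where
  val i x := γ.massPart (D.zeroOrder A i x)
  smooth i := γ.massPart_smooth (zeroOrder_smooth i)
  odd i _ hx := hD.massPart_odd hk hp i hx
  compatible i j _ hx := hD.massPart_compatible hk hp i j hx

end Simple

end DiracOperator

end Bundles

end DiracGauge
end

noncomputable section
namespace DiracGauge

/-! ### Constancy of the norm and reduction of the structure group. -/

section NormSq

variable {m : Type*} [Fintype m]

theorem trace_conjTranspose_mul_self_eq (Z : Matrix m m ℂ) :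
    (Zᴴ * Z).trace = ((normSq Z : ℝ) : ℂ) := by
  refine (Complex.conj_eq_iff_re.1 ?_).symm
  have h := Matrix.trace_conjTranspose (Zᴴ * Z)
  rw [Matrix.conjTranspose_mul, Matrix.conjTranspose_conjTranspose] at h
  exact h.symm

theorem trace_mul_self_eq {σ : ℝ} (hσ : σ * σ = 1) {Z : Matrix m m ℂ} (hZ : Zᴴ = σ • Z) :
    (Z * Z).trace = ((σ * normSq Z : ℝ) : ℂ) := by
  have h := trace_conjTranspose_mul_self_eq Z
  rw [hZ, Matrix.smul_mul, Matrix.trace_smul] at h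
  rw [Complex.ofReal_mul, ← h, Complex.real_smul, ← mul_assoc, ← Complex.ofReal_mul, hσ,
    Complex.ofReal_one, one_mul]

open scoped ComplexOrder in
theorem normSq_eq_zero_iff {Z : Matrix m m ℂ} : normSq Z = 0 ↔ Z = 0 := by
  rw [← Matrix.trace_conjTranspose_mul_self_eq_zero_iff, trace_conjTranspose_mul_self_eq,
    Complex.ofReal_eq_zero]

theorem normSq_neg_I_smul (Z : Matrix m m ℂ) : normSq ((-Complex.I) • Z) = normSq Z := by
  rw [normSq, Matrix.conjTranspose_smul, Matrix.smul_mul, Matrix.mul_smul, smul_smul, normSq]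
  simp

end NormSq

theorem eventually_eq_of_pderiv_eq_zero {k : ℕ} {f : Coord k → ℝ} {U : Set (Coord k)}
    (hU : IsOpen U) (hf : DifferentiableOn ℝ f U) (h : ∀ x ∈ U, ∀ μ, pderiv f μ x = 0)
    {x : Coord k} (hx : x ∈ U) : ∀ᶠ y in 𝓝 x, f y = f x := by
  obtain ⟨r, hr, hb⟩ := Metric.isOpen_iff.1 hU x hx
  filter_upwards [Metric.ball_mem_nhds x hr] with y hy
  refine Metric.isOpen_ball.is_const_of_fderiv_eq_zero (𝕜 := ℝ)
    (convex_ball x r).isPreconnected (hf.mono hb) (fun z hz => ?_) hy (Metric.mem_ball_self hr)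
  refine ContinuousLinearMap.coe_injective
    ((EuclideanSpace.basisFun (Fin (2 * k)) ℝ).toBasis.ext fun μ => ?_)
  simpa [pderiv] using h z (hb hz) μ

section Bundles

variable {k p N : ℕ} {EG : Type*} [NormedAddCommGroup EG] [NormedSpace ℝ EG]
  {G : Type*} [TopologicalSpace G] [ChartedSpace EG G] [Group G]
  {M : Type*} [TopologicalSpace M] [ChartedSpace (Coord k) M] {ι : Type*}
  {γ : GammaMatrices k p} {R : FermionRep (EG := EG) G N}
  {F : FermionBundle γ R M ι} {D : DiracOperator F} {A : Connection F}

namespace DiracOperator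

/-- Elements of Spin(p,q) need not be unitary, so the norm is not visibly invariant under changes of
trivialization. The trace of Φ² is, and by Φ† = σΦ it equals σ‖Φ‖². -/
theorem trace_zeroOrder_sq (i j : ι) {x : Coord k} (hx : x ∈ F.overlap i j) :
    (D.zeroOrder A i x * D.zeroOrder A i x).trace
      = (D.zeroOrder A j (F.coordChange i j x) * D.zeroOrder A j (F.coordChange i j x)).trace := by
  set u := F.S i j ((F.chart i).symm x) with hu
  set T' : EndFib k N := ((u⁻¹ : (Matrix (Fin (2 ^ k)) (Fin (2 ^ k)) ℂ)ˣ) :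
    Matrix (Fin (2 ^ k)) (Fin (2 ^ k)) ℂ) ⊗ₖ R.mat (F.g i j ((F.chart i).symm x))⁻¹ with hT'
  have h1 : F.trans i j x * T' = 1 := by
    rw [FermionBundle.trans, hT', ← Matrix.mul_kronecker_mul, FermionRep.mat_mul_mat_inv,
      Units.mul_inv, Matrix.one_kronecker_one]
  have h2 : T' * F.trans i j x = 1 := by
    rw [FermionBundle.trans, hT', ← Matrix.mul_kronecker_mul, FermionRep.mat_inv_mul_mat,
      Units.inv_mul, Matrix.one_kronecker_one]
  have h3 := zeroOrder_mul_trans (D := D) (A := A) i j hx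
  set T := F.trans i j x
  set Φ := D.zeroOrder A i x
  set Φ' := D.zeroOrder A j (F.coordChange i j x)
  calc (Φ * Φ).trace = (Φ * (Φ * T) * T').trace := by
        rw [Matrix.mul_assoc, Matrix.mul_assoc Φ T, h1, Matrix.mul_one]
    _ = (T * (Φ' * Φ') * T').trace := by
        rw [h3, ← Matrix.mul_assoc, h3, Matrix.mul_assoc T]
    _ = (Φ' * Φ').trace := by
        rw [Matrix.trace_mul_comm, ← Matrix.mul_assoc, h2, Matrix.one_mul]

variable (hk : 2 ≤ k) (hN : 1 ≤ N) (hD : D.IsSimpleType A) {σ : ℝ} (hσ : σ * σ = 1)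
  (hherm : ∀ i, ∀ x ∈ (F.chart i).target, (D.zeroOrder A i x)ᴴ = σ • D.zeroOrder A i x)
  (hEL : D.EulerLagrange A)

include hk hN hD hσ hherm hEL

omit hk hN hD hEL in
theorem normSq_zeroOrder_smooth (i : ι) :
    ContDiffOn ℝ ∞ (fun y => σ * normSq (D.zeroOrder A i y)) (F.chart i).target := by
  have hΦ := zeroOrder_smooth (D := D) (A := A) i
  have h1 : ContDiffOn ℝ ∞ (fun y => (D.zeroOrder A i y * D.zeroOrder A i y).trace)
      (F.chart i).target := ContDiffOn.sum fun s _ => (hΦ.mul hΦ) s s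
  refine (Complex.reCLM.contDiff.comp_contDiffOn h1).congr fun y hy => ?_
  rw [Function.comp_apply, trace_mul_self_eq hσ (hherm i y hy), Complex.reCLM_apply,
    Complex.ofReal_re]

theorem IsSimpleType.ricci_eq (i : ι) {x : Coord k} (hx : x ∈ (F.chart i).target) :
    scalarCurvature (D.metric i) x
        = 4 * (2 * k) * γ.sgn / ((2 * k - 2) * (2 ^ k * N)) * (σ * normSq (D.zeroOrder A i x))
      ∧ ricci (D.metric i) x = (4 * γ.sgn / ((2 * k - 2) * (2 ^ k * N))
          * (σ * normSq (D.zeroOrder A i x))) • D.metric i x := by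
  have hΦ := zeroOrder_smooth (D := D) (A := A) i
  refine (hD.isCliffordData i).ricci_eq hk hN hΦ (fun y hy => hD.zeroOrder_anticommute i hy)
    (normSq_zeroOrder_smooth hσ hherm i)
    (fun y hy => trace_mul_self_eq hσ (hherm i y hy)) (hEL i) hx

/-- The norm of the zero order operator is constant. -/
theorem IsSimpleType.exists_normSq_eq [ConnectedSpace M] :
    ∃ c, ∀ i, ∀ x ∈ (F.chart i).target, normSq (D.zeroOrder A i x) = c := by
  have hσ0 : σ ≠ 0 := left_ne_zero_of_mul_eq_one hσ
  have hc0 : 4 * γ.sgn / ((2 * (k : ℝ) - 2) * (2 ^ k * N)) ≠ 0 := by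
    have hk' : (2 : ℝ) ≤ k := by exact_mod_cast hk
    have hN' : (1 : ℝ) ≤ N := by exact_mod_cast hN
    have hs : γ.sgn ≠ 0 := left_ne_zero_of_mul_eq_one γ.sgn_mul_sgn
    have h1 : 2 * (k : ℝ) - 2 ≠ 0 := by linarith
    have h2 : (N : ℝ) ≠ 0 := by linarith
    positivity
  -- Schur's lemma applied to the factor in Ric = f g, a non-zero multiple of the squared norm.
  have hloc : ∀ i, ∀ x ∈ (F.chart i).target,
      ∀ᶠ y in 𝓝 x, normSq (D.zeroOrder A i y) = normSq (D.zeroOrder A i x) := by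
    intro i x hx
    have hU := (F.chart i).open_target
    have hs : ContDiffOn ℝ ∞ (fun y => 4 * γ.sgn / ((2 * (k : ℝ) - 2) * (2 ^ k * N))
        * (σ * normSq (D.zeroOrder A i y))) (F.chart i).target :=
      contDiffOn_const.mul (normSq_zeroOrder_smooth hσ hherm i)
    have h1 := eventually_eq_of_pderiv_eq_zero hU (hs.differentiableOn (by simp))
      (fun y hy μ => (hD.isCliffordData i).isMetricOn.pderiv_eq_zero_of_ricci hk hs
        (fun w hw => (hD.ricci_eq hk hN hσ hherm hEL i hw).2) hy μ) hx
    filter_upwards [h1] with y hy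
    exact mul_left_cancel₀ hσ0 (mul_left_cancel₀ hc0 hy)
  choose idx hidx using F.cover
  -- The local norms patch to a function on M, locally constant and hence constant by connectedness.
  set ν : M → ℝ := fun m => normSq (D.zeroOrder A (idx m) (F.chart (idx m) m)) with hν
  have hνi : ∀ i, ∀ m ∈ (F.chart i).source, ν m = normSq (D.zeroOrder A i (F.chart i m)) := by
    intro i m hm
    have hl : (F.chart i).symm (F.chart i m) = m := (F.chart i).left_inv hm
    have ho : F.chart i m ∈ F.overlap i (idx m) :=
      ⟨(F.chart i).map_source hm, by rw [Set.mem_preimage, hl]; exact hidx m⟩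
    have h1 := trace_zeroOrder_sq (D := D) (A := A) i (idx m) ho
    have h2 : F.coordChange i (idx m) (F.chart i m) = F.chart (idx m) m := by
      rw [FermionBundle.coordChange, hl]
    rw [h2, trace_mul_self_eq hσ (hherm i _ ((F.chart i).map_source hm)),
      trace_mul_self_eq hσ (hherm (idx m) _ ((F.chart (idx m)).map_source (hidx m)))] at h1
    exact (mul_left_cancel₀ hσ0 (Complex.ofReal_injective h1)).symm
  have hνc : IsLocallyConstant ν := by
    refine (IsLocallyConstant.iff_eventually_eq ν).2 fun m => ?_
    have h1 := ((F.chart (idx m)).continuousAt (hidx m)).eventually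
      (hloc (idx m) _ ((F.chart (idx m)).map_source (hidx m)))
    filter_upwards [h1, (F.chart (idx m)).open_source.mem_nhds (hidx m)] with m' h2 h3
    rw [hνi (idx m) m' h3, h2]
  obtain ⟨m₀⟩ : Nonempty M := inferInstance
  refine ⟨ν m₀, fun i x hx => ?_⟩
  rw [hνc.apply_eq_of_isPreconnected isPreconnected_univ (Set.mem_univ m₀)
    (Set.mem_univ ((F.chart i).symm x)), hνi i _ ((F.chart i).map_target hx),
    (F.chart i).right_inv hx]

omit hk hN hσ hherm hEL in
/-- The zero order operator takes its values in a single orbit of the structure group. -/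
theorem IsSimpleType.exists_orbit [ConnectedSpace M] (hk : 1 ≤ k) (hp : p ≤ 2 * k)
    (htrans : D.IsTransitive A) {c : ℝ}
    (hc : ∀ i, ∀ x ∈ (F.chart i).target, normSq (D.zeroOrder A i x) = c) :
    ∃ i₀, ∃ x₀ ∈ (F.chart i₀).target, ∀ i, ∀ x ∈ (F.chart i).target, ∃ g,
      γ.massPart (D.zeroOrder A i x) = R.conj g (γ.massPart (D.zeroOrder A i₀ x₀)) := by
  obtain ⟨m₀⟩ : Nonempty M := inferInstance
  obtain ⟨i₀, hm₀⟩ := F.cover m₀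
  have hx₀ := (F.chart i₀).map_source hm₀
  refine ⟨i₀, F.chart i₀ m₀, hx₀, fun i x hx => ?_⟩
  -- If c = 0 then Φ vanishes identically and the orbit is that of 0; transitivity is informative
  -- only for c ≠ 0.
  by_cases hc0 : c = 0
  · refine ⟨1, ?_⟩
    rw [normSq_eq_zero_iff.1 ((hc i x hx).trans hc0),
      normSq_eq_zero_iff.1 ((hc i₀ _ hx₀).trans hc0), map_one]
    rfl
  · have hne : ∀ j, ∀ y ∈ (F.chart j).target, D.zeroOrder A j y ≠ 0 := fun j y hy h0 =>
      hc0 ((hc j y hy).symm.trans (normSq_eq_zero_iff.2 h0))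
    have hmem : ∀ j, ∀ y ∈ (F.chart j).target,
        normalized (D.zeroOrder A j y) ∈ D.unitImage A := fun j y hy =>
      ⟨j, y, hy, hne j y hy, 1, by
        rw [inv_one, FermionRep.act, FermionRep.mat_one, Matrix.one_kronecker_one,
          Matrix.one_mul, Matrix.mul_one]⟩
    obtain ⟨g, hg⟩ := htrans _ (hmem i₀ _ hx₀) _ (hmem i x hx)
    refine ⟨g, ?_⟩
    have hs : (((Real.sqrt c)⁻¹ : ℝ) : ℂ) ≠ 0 := by
      have hpos : 0 < c := by
        refine lt_of_le_of_ne ?_ (Ne.symm hc0)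
        rw [← hc i x hx, normSq]
        simp only [Matrix.trace, Matrix.diag_apply, Matrix.mul_apply, Matrix.conjTranspose_apply,
          Complex.re_sum]
        refine Finset.sum_nonneg fun s _ => Finset.sum_nonneg fun t _ => ?_
        rw [Complex.star_def, ← Complex.normSq_eq_conj_mul_self]
        exact Complex.normSq_nonneg _
      exact Complex.ofReal_ne_zero.2 (inv_ne_zero (Real.sqrt_pos.2 hpos).ne')
    -- Both values are normalized by the same constant √c, which cancels.
    rw [normalized, normalized, hc i x hx, hc i₀ _ hx₀, Matrix.mul_smul, Matrix.smul_mul] at hg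
    have h1 := smul_right_injective _ hs hg
    rw [hD.zeroOrder_eq hk hp i₀ hx₀, FermionRep.act, FermionRep.act, ← Matrix.mul_kronecker_mul,
      ← Matrix.mul_kronecker_mul, Matrix.one_mul, Matrix.mul_one] at h1
    rw [h1, γ.massPart_gammaM_kronecker hp]
    rfl

end DiracOperator

/-- A section with values in a single orbit is constant in the frames of a reduction of the
structure group to the isotropy group. -/
theorem OddClSection.exists_reduction [FiniteDimensional ℝ EG] [LieGroup 𝓘(ℝ, EG) ∞ G]
    [CompactSpace G] [IsManifold 𝓘(ℝ, Coord k) ∞ M] (𝒟 : OddClSection F)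
    {z : Matrix (Fin N) (Fin N) ℂ}
    (horb : ∀ i, ∀ x ∈ (F.chart i).target, ∃ g, 𝒟.val i x = R.conj g z) :
    ∃ Q : Reduction F (R.isotropy z), 𝒟.IsConstant Q z := by
  choose idx hidx using F.cover
  -- Locally 𝒟 = ρ(h) z ρ(h)⁻¹ with h smooth; these h are the frames of the reduction.
  have hlift : ∀ a, ∃ O ⊆ (F.chart (idx a)).source, IsOpen O ∧ a ∈ O ∧ ∃ h : M → G,
      ContMDiffOn 𝓘(ℝ, Coord k) 𝓘(ℝ, EG) ∞ h O ∧
        ∀ x ∈ O, 𝒟.val (idx a) (F.chart (idx a) x) = R.conj (h x) z := by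
    intro a
    have hchart : ContMDiffOn 𝓘(ℝ, Coord k) 𝓘(ℝ, Coord k) ∞ (F.chart (idx a))
        (F.chart (idx a)).source := contMDiffOn_of_mem_maximalAtlas (F.chart_mem (idx a))
    refine exists_contMDiffOn_lift (f := fun x => 𝒟.val (idx a) (F.chart (idx a) x)) R.conj z
      (FermionRep.contMDiff_conj z) (F.chart (idx a)).open_source ?_
      (fun x hx => horb _ _ ((F.chart (idx a)).map_source hx)) (hidx a)
    have hval : ContDiffOn ℝ ∞ (F := Fin N → Fin N → ℂ) (𝒟.val (idx a))
        (F.chart (idx a)).target :=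
      contDiffOn_pi.2 fun s => contDiffOn_pi.2 fun t => 𝒟.smooth (idx a) s t
    exact (contMDiffOn_iff_contDiffOn.2 hval).comp hchart fun x hx =>
      (F.chart (idx a)).map_source hx
  choose O hOs hOo haO h hhs hh using hlift
  have hinv : ∀ (g : G) (y : Fin N → Fin N → ℂ), R.conj g⁻¹ (R.conj g y) = y := fun g y => by
    rw [← Module.End.mul_apply, ← map_mul, inv_mul_cancel, map_one, Module.End.one_apply]
  refine ⟨⟨O, hOo, haO, idx, hOs, h, hhs, fun a c x hx => ?_⟩, fun a x hx => ?_⟩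
  -- Both h_a and g_ac h_c carry z to the value of 𝒟 in the trivialization chosen at `a`, so h_a⁻¹
  -- g_ac h_c fixes z.
  · refine FermionRep.mem_isotropy_of_conj ?_
    have hxa := hOs a hx.1
    have hxc := hOs c hx.2
    have hl : (F.chart (idx a)).symm (F.chart (idx a) x) = x := (F.chart (idx a)).left_inv hxa
    have h1 := 𝒟.compatible (idx a) (idx c) (F.chart (idx a) x)
      ⟨(F.chart (idx a)).map_source hxa, by rw [Set.mem_preimage, hl]; exact hxc⟩
    rw [FermionBundle.coordChange, hl, hh a x hx.1, hh c x hx.2] at h1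
    have h2 : R.conj (h a x) z = R.conj (F.g (idx a) (idx c) x) (R.conj (h c x) z) := h1
    have h3 : ∀ (g g' : G) (y : Fin N → Fin N → ℂ),
        R.conj (g * g') y = R.conj g (R.conj g' y) := fun g g' y => by
      rw [map_mul, Module.End.mul_apply]
    refine (h3 _ _ z).trans ((h3 _ _ _).trans ?_)
    rw [← h2]
    exact hinv (h a x) z
  · have h1 := hinv (h a x) z
    rw [← hh a x hx, FermionRep.conj_apply, inv_inv] at h1
    exact h1

end Bundles

end DiracGauge
end

/-! ### The main theorem. -/

theorem mainTheorem2 {k p N : ℕ} (hk : 2 ≤ k) (hp : p ≤ 2 * k) (hN : 1 ≤ N)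
    {EG : Type*} [NormedAddCommGroup EG] [NormedSpace ℝ EG] [FiniteDimensional ℝ EG]
    {G : Type*} [TopologicalSpace G] [ChartedSpace EG G] [Group G]
    [LieGroup 𝓘(ℝ, EG) ∞ G] [CompactSpace G]
    {M : Type*} [TopologicalSpace M] [T2Space M] [ParacompactSpace M] [ConnectedSpace M]
    [ChartedSpace (DiracGauge.Coord k) M] [IsManifold 𝓘(ℝ, DiracGauge.Coord k) ∞ M]
    {ι : Type*} {γ : DiracGauge.GammaMatrices k p} {R : DiracGauge.FermionRep (EG := EG) G N}
    (F : DiracGauge.FermionBundle γ R M ι) (D : DiracGauge.DiracOperator F)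
    (A : DiracGauge.Connection F) (hD : D.IsSimpleType A)
    (σ : ℝ) (hσ : σ = 1 ∨ σ = -1)
    (hherm : ∀ i, ∀ x ∈ (F.chart i).target, (D.zeroOrder A i x)ᴴ = σ • D.zeroOrder A i x)
    (hEL : D.EulerLagrange A) (htrans : D.IsTransitive A) :
    ∃ (𝒟 : DiracGauge.OddClSection F) (z : Matrix (Fin N) (Fin N) ℂ)
      (Q : DiracGauge.Reduction F (R.isotropy z)),
      𝒟.IsConstant Q z ∧ zᴴ = σ • z ∧
      (∀ i, ∀ x ∈ (F.chart i).target, (𝒟.val i x)ᴴ = σ • 𝒟.val i x) ∧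
      (∀ i, ∀ x ∈ (F.chart i).target, D.zeroOrder A i x = γ.gammaM ⊗ₖ 𝒟.val i x) ∧
      D.IsEinstein ∧
      ∃ lam : ℝ, lam = 4 * (2 * k) * γ.sgn * σ / ((2 * k - 2) * (2 ^ k * N)) ∧ lam ≠ 0 ∧
        ∀ i, ∀ x ∈ (F.chart i).target,
          DiracGauge.scalarCurvature (D.metric i) x
            = lam * DiracGauge.normSq (𝒟.massOp i x) := by
  have hk1 : 1 ≤ k := le_trans one_le_two hk
  have hσσ : σ * σ = 1 := by rcases hσ with rfl | rfl <;> norm_num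
  have hk' : (2 : ℝ) ≤ k := by exact_mod_cast hk
  have hN' : (1 : ℝ) ≤ N := by exact_mod_cast hN
  obtain ⟨c, hc⟩ := hD.exists_normSq_eq hk hN hσσ hherm hEL
  obtain ⟨i₀, x₀, hx₀, horb⟩ := hD.exists_orbit hk1 hp htrans hc
  obtain ⟨Q, hQ⟩ := (D.massSection A hD hk1 hp).exists_reduction horb
  -- The matrix z is the value of 𝒟 at the base point of the orbit, and the Einstein constant is the
  -- Ricci factor with ‖Φ‖² = c inserted.
  refine ⟨D.massSection A hD hk1 hp, _, Q, hQ,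
    hD.massPart_hermitian hk1 hp i₀ hx₀ (hherm i₀ x₀ hx₀),
    fun i x hx => hD.massPart_hermitian hk1 hp i hx (hherm i x hx),
    fun i x hx => hD.zeroOrder_eq hk1 hp i hx,
    ⟨4 * γ.sgn / ((2 * k - 2) * (2 ^ k * N)) * (σ * c), fun i x hx => ?_⟩, _, rfl, ?_,
    fun i x hx => ?_⟩
  · rw [(hD.ricci_eq hk hN hσσ hherm hEL i hx).2, hc i x hx]
  · have hs : γ.sgn ≠ 0 := left_ne_zero_of_mul_eq_one γ.sgn_mul_sgn
    have hσ0 : σ ≠ 0 := left_ne_zero_of_mul_eq_one hσσ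
    have h1 : 2 * (k : ℝ) - 2 ≠ 0 := by linarith
    have h2 : (N : ℝ) ≠ 0 := by linarith
    have h3 : (k : ℝ) ≠ 0 := by linarith
    positivity
  -- M_F and Φ differ only by the phase −i, so their norms agree.
  · have h1 : DiracGauge.normSq ((D.massSection A hD hk1 hp).massOp i x)
        = DiracGauge.normSq (D.zeroOrder A i x) := by
      rw [DiracGauge.OddClSection.massOp, DiracGauge.normSq_neg_I_smul]
      exact congrArg _ (hD.zeroOrder_eq hk1 hp i hx).symm
    rw [(hD.ricci_eq hk hN hσσ hherm hEL i hx).1, h1]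
    ring
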